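/- Let $I$ be a totally ordered set, order-isomorphic to an interval of $\mathbb Z$ (finite, $\mathbb Z_-$, $\mathbb Z_+$ or $\mathbb Z$), and write $n\pm1$ for the neighbours of $n$. Let $\mathfrak A\neq 0$ be the CAR algebra over $I$: the unital $C^*$-algebra generated by elements $a_j$, $j\in I$, with $a_ja_k+a_ka_j=0$ and $a_j^+a_k+a_ka_j^+=\delta_{jk}1$. For $\Lambda\subset I$ let $\mathfrak A_\Lambda$ be the unital $C^*$-subalgebra generated by $\{a_j: j\in\Lambda\}$, let $\mathfrak A_{n]}=\mathfrak A_{\{j\le n\}}$, let $\mathrm{Tr}$ be the unnormalized trace of $\mathfrak A_{\{n\}}\cong\mathbb M_2(\mathbb C)$, and put $P^j_1=a_ja_j^+$, $P^j_2=a_j^+a_j$. There is a unique $*$-automorphism $\Theta$ of $\mathfrak A$ with $\Theta(a_j)=-a_j$ for all $j$ (the parity); a functional is even if it is $\Theta$-invariant. Choose the following data. (1) A subset $\Gamma\subset I$ that does not contain the last element of $I$ (if there is one). Let $\Omega=\{1,2\}^\Gamma$. (2) A probability measure $\mu$ on $\Omega$ that is the product, over the maximal intervals of $\Gamma$, of the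 Markov measures determined by distributions $\pi^j_{\omega_j}$ at the places $j\in\Gamma$ and transition matrices $\pi^j_{\omega_j\omega_{j+1}}$ ($j,j+1\in\Gamma$), where $\pi^j_i>0$ for all $j\in\Gamma$, $i=1,2$. (3) A partition of $I\setminus\Gamma$ into blocks, each of the form $\{j\}$ (one-step) or $\{j,j+1\}$ (two-step), and for every block $b$ and $\omega\in\Omega$ an even state $\varphi_{b,\omega}$ on $\mathfrak A_b$, such that $\varphi_{b,\omega}$ does not depend on $\omega$ if $b$ is a two-step block, and for $b=\{j\}$ it is either a function of $\omega_{j-1}$ only (constant in $\omega$ if $j-1$ does not exist or is not in $\Gamma$), or a function of $\omega_{j+1}$ only (constant in $\omega$ if $j+1$ does not exist or is not in $\Gamma$). For every $\omega$ there is a state $\psi_\omega$ on $\mathfrak A_{I\setminus\Gamma}$ with $\psi_\omega(x_1\cdots x_m)=\prod_i\varphi_{b_i,\omega}(x_i)$ for $x_i\in\mathfrak A_{b_i}$ and distinct blocks $b_1,\dots,b_m$. Let $\mathfrak D$ be the $C^*$-algebra generated by $\mathfrak A_{I\setminus\Gamma}$ and the $P^j_i$, $j\in\Gamma$. There is a bounded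 linear map $\mathcal E=\prod_{j}F_j:\mathfrak A\to\mathfrak D$, where $F_j(x)=P^j_1xP^j_1+P^j_2xP^j_2$ for $j\in\Gamma$, $F_j=\mathrm{id}$ for $j\notin\Gamma$, and on $\mathfrak A_\Lambda$ with $\Lambda$ finite the product is taken over $j\in\Lambda$. For every $\omega\in\Omega$ there is a $*$-homomorphism $x\mapsto x(\omega)$ from $\mathfrak D$ to $\mathfrak A_{I\setminus\Gamma}$ with $y(\omega)=y$ for $y\in\mathfrak A_{I\setminus\Gamma}$ and $P^j_i(\omega)=\delta_{i,\omega_j}1$ for $j\in\Gamma$ (evaluation at $\omega$, when $\mathfrak D$ is viewed as the algebra of continuous functions from $\Omega$ to $\mathfrak A_{I\setminus\Gamma}$). For $x\in\mathfrak D$ the map $\omega\mapsto\psi_\omega(x(\omega))$ is measurable, and $$\psi(x)=\int_\Omega\psi_\omega\big(\mathcal E(x)(\omega)\big)\,\mu(d\omega),\qquad x\in\mathfrak A,$$ is a well-defined state on $\mathfrak A$. For each $n\in I$ that is not the last element there is a unique linear map $\mathcal E_n:\mathfrak A_{n+1]}\to\mathfrak A$ such that, for $x\in\mathfrak A_{\{j<n\}}$,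 $x_n\in\mathfrak A_{\{n\}}$, $x_{n+1}\in\mathfrak A_{\{n+1\}}$, (a) if $n\in\Gamma$, $$\mathcal E_n(xx_nx_{n+1})=x\sum_{i=1}^2\mathrm{Tr}(x_nP^n_i)\frac{\psi(P^n_ix_{n+1})}{\psi(P^n_i)}P^n_i;$$ (b) if $\{n,n+1\}$ is a two-step block, or if $n\notin\Gamma$, $n+1\in\Gamma$, $\{n\}$ is a one-step block and $\varphi_{\{n\},\omega}$ does depend on $\omega_{n+1}$, $$\mathcal E_n(xx_nx_{n+1})=\psi(x_nx_{n+1})\,x;$$ (c) in all other cases $$\mathcal E_n(xx_nx_{n+1})=\psi(x_{n+1})\,xx_n.$$ Each $\mathcal E_n$ commutes with $\Theta$ and is a (Umegaki) conditional expectation, that is, a norm-one projection of $\mathfrak A_{n+1]}$ onto a $C^*$-subalgebra of $\mathfrak A_{n]}$. Moreover $\psi$ is a Markov state with respect to the sequence $(\mathcal E_n)$: for every $n$ that is not the last element, $\mathcal E_n$ is completely positive and unital with range in $\mathfrak A_{n]}$, $\mathcal E_n(cy)=c\,\mathcal E_n(y)$ for $c\in\mathfrak A_{\{j<n\}}$ and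 $y\in\mathfrak A_{n+1]}$, $\psi(\mathcal E_n(y))=\psi(y)$ for $y\in\mathfrak A_{n+1]}$, and $\mathcal E_n(\mathfrak A_{\{n,n+1\}})\subset\mathfrak A_{\{n\}}$. -/

import Mathlib

open MeasureTheory
open scoped ComplexOrder Classical

namespace CAR

/-! ### The CAR algebra over a chain -/

section Algebra

variable {I A : Type*} [CStarAlgebra A]

/-- `a` is a family of generators of the CAR algebra `A`: the canonical anticommutation relations
hold, and `A` is generated as a C*-algebra by the `a j`. For nontrivial `A` this determines the pair
`(A, a)` up to a unique *-isomorphism. -/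
structure IsCAR (a : I → A) : Prop where
  anticomm : ∀ j k, a j * a k + a k * a j = 0
  anticomm_star : ∀ j k, star (a j) * a k + a k * star (a j) = if j = k then 1 else 0
  generates : (StarAlgebra.adjoin ℂ (Set.range a)).topologicalClosure = ⊤

/-- The C*-subalgebra `𝔄_Λ` generated by the `a j`, `j ∈ Λ`. -/
noncomputable def loc (a : I → A) (Λ : Set I) : StarSubalgebra ℂ A :=
  (StarAlgebra.adjoin ℂ (a '' Λ)).topologicalClosure

theorem gen_mem_loc (a : I → A) {Λ : Set I} {j : I} (hj : j ∈ Λ) : a j ∈ loc a Λ :=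
  StarSubalgebra.le_topologicalClosure _
    (StarAlgebra.subset_adjoin ℂ _ (Set.mem_image_of_mem a hj))

/-- `Θ` is the parity automorphism. -/
def IsParity (a : I → A) (Θ : A ≃⋆ₐ[ℂ] A) : Prop :=
  ∀ j, Θ (a j) = -a j

/-- The minimal projections `P₁ = a a⁺` (index `0`) and `P₂ = a⁺ a` (index `1`) at the site `j`. -/
noncomputable def proj (a : I → A) (j : I) : Fin 2 → A :=
  ![a j * star (a j), star (a j) * a j]

theorem proj_mem_loc (a : I → A) {Λ : Set I} {j : I} (hj : j ∈ Λ) (i : Fin 2) :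
    proj a j i ∈ loc a Λ := by
  have h := gen_mem_loc a hj
  fin_cases i
  · exact mul_mem h (star_mem h)
  · exact mul_mem (star_mem h) h

/-- `P_i` at the site `n` as an element of the site algebra. -/
noncomputable def siteProj (a : I → A) (n : I) (i : Fin 2) : loc a {n} :=
  ⟨proj a n i, proj_mem_loc a (Set.mem_singleton n) i⟩

/-- The (unnormalized) trace of the full matrix algebra `𝔄_{n} ≅ M₂(ℂ)`. The regular
representation of `M₂(ℂ)` is twice the defining one, so that the trace of left multiplication by
`x` is `2 Tr x`. -/
noncomputable def siteTrace (a : I → A) (n : I) (x : loc a {n}) : ℂ :=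
  LinearMap.trace ℂ (loc a {n}) (LinearMap.mulLeft ℂ x) / 2

/-- A linear functional on a unital *-algebra is a state. -/
def IsState {B : Type*} [Ring B] [StarRing B] [Algebra ℂ B] (φ : B →ₗ[ℂ] ℂ) : Prop :=
  φ 1 = 1 ∧ ∀ x, 0 ≤ φ (star x * x)

/-- A functional on `𝔄_Λ` is even: it is invariant under the parity automorphism (which leaves
`𝔄_Λ` globally invariant). -/
def IsEven (a : I → A) {Λ : Set I} (φ : loc a Λ →ₗ[ℂ] ℂ) : Prop :=
  ∀ Θ : A ≃⋆ₐ[ℂ] A, IsParity a Θ → ∀ x y : loc a Λ, (y : A) = Θ x → φ y = φ x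

/-! ### Conditional expectations and quasi-conditional expectations -/

/-- Complete positivity of a linear map from a *-subalgebra `B` to `A`:
`∑ y_i* E(x_i* x_j) y_j` is a positive element for all finite families. -/
def IsCompletelyPositive {B : StarSubalgebra ℂ A} (E : B →ₗ[ℂ] A) : Prop :=
  ∀ (m : ℕ) (x : Fin m → B) (y : Fin m → A),
    ∃ z : A, ∑ i, ∑ j, star (y i) * E (star (x i) * x j) * y j = star z * z

/-- `E : B → A` is a quasi-conditional expectation with respect to the triplet `C ⊆ R ⊆ B`. -/
structure IsQuasiCondExp (C R : StarSubalgebra ℂ A) {B : StarSubalgebra ℂ A} (E : B →ₗ[ℂ] A) :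
    Prop where
  left_le : C ≤ R
  right_le : R ≤ B
  range_le : ∀ x, E x ∈ R
  completelyPositive : IsCompletelyPositive E
  map_one : E 1 = 1
  map_mul : ∀ c x : B, (c : A) ∈ C → E (c * x) = (c : A) * E x

/-- `E : B → A` is a (Umegaki) conditional expectation of `B` whose range is the C*-subalgebra `R`:
a projection of norm one of `B` onto `R`. -/
structure IsCondExpOnto (R : StarSubalgebra ℂ A) {B : StarSubalgebra ℂ A} (E : B →ₗ[ℂ] A) :
    Prop where
  isClosed : IsClosed (R : Set A)
  le : R ≤ B
  range_le : ∀ x, E x ∈ R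
  map_of_mem : ∀ x : B, (x : A) ∈ R → E x = x
  norm_le : ∀ x : B, ‖E x‖ ≤ ‖(x : A)‖

/-! ### The diagonal conditional expectation `𝓔 = ∏ F_j` and the functions `ω ↦ 𝓔(x)(ω)` -/

/-- `F_j`: the map `x ↦ P₁ x P₁ + P₂ x P₂` if `j ∈ Γ`, and the identity otherwise. -/
noncomputable def siteMap (a : I → A) (Γ : Set I) (j : I) : Module.End ℂ A :=
  if j ∈ Γ then
    ∑ i : Fin 2, LinearMap.mulLeft ℂ (proj a j i) * LinearMap.mulRight ℂ (proj a j i)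
  else 1

/-- The C*-algebra generated by `𝔄_{I \ Γ}` and the even site algebras
`𝔄_{n,+} = span {P₁, P₂}`, `n ∈ Γ`; this is the range of `𝓔`. -/
noncomputable def diagAlg (a : I → A) (Γ : Set I) : StarSubalgebra ℂ A :=
  (StarAlgebra.adjoin ℂ (a '' Γᶜ ∪ {x | ∃ j ∈ Γ, ∃ i, x = proj a j i})).topologicalClosure

/-- `𝓔` is the conditional expectation `∏_j F_j`: on an element localized in a finite region it is
the product of the (mutually commuting, idempotent) maps `F_j` over the region, and it is
continuous. -/
def IsDiagExp (a : I → A) (Γ : Set I) (𝓔 : A →L[ℂ] diagAlg a Γ) : Prop :=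
  ∀ (L : List I) (x : A), x ∈ loc a {j | j ∈ L} →
    (𝓔 x : A) = (L.map (siteMap a Γ)).prod x

/-- `ev` is the evaluation `x ↦ x(ω)` under the standard identification of `diagAlg a Γ` with
the continuous functions `Ω → 𝔄_{I \ Γ}`, `Ω = {1,2}^Γ`: an element of `𝔄_{I \ Γ}` is a constant
function, and `P_i` at the site `j ∈ Γ` is the indicator of `{ω_j = i}`. -/
def IsEvaluation (a : I → A) (Γ : Set I) (ω : Γ → Fin 2)
    (ev : diagAlg a Γ →⋆ₐ[ℂ] loc a Γᶜ) : Prop :=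
  (∀ (x : diagAlg a Γ) (y : loc a Γᶜ), (x : A) = y → ev x = y) ∧
  ∀ (j : Γ) (i : Fin 2) (x : diagAlg a Γ), (x : A) = proj a j i →
    ev x = if ω j = i then 1 else 0

end Algebra

/-! ### Blocks, block states and product states -/

section Blocks

variable {I : Type*} [LinearOrder I] [SuccOrder I]

/-- `D` is an admissible set of left end points `j` of two-step blocks `{j, j + 1}` in `I \ Γ`. -/
def IsTwoStepSet (Γ D : Set I) : Prop :=
  ∀ j ∈ D, ¬ IsMax j ∧ j ∉ Γ ∧ Order.succ j ∉ Γ ∧ Order.succ j ∉ D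

/-- The left end points of all the blocks into which `I \ Γ` is divided. -/
def starts (Γ D : Set I) : Set I :=
  {j | j ∉ Γ ∧ ∀ i ∈ D, Order.succ i ≠ j}

/-- The block with left end point `j`: `{j, j + 1}` if `j ∈ D`, and `{j}` otherwise. -/
def block (D : Set I) (j : I) : Set I :=
  {i | i = j ∨ (j ∈ D ∧ i = Order.succ j)}

variable {A : Type*} [CStarAlgebra A]

/-- Admissible factors of the product states: even states on the block algebras, where a two-step
factor does not depend on `ω`, and a one-step factor at `j` depends on `ω` at most through
the spin at `j - 1` (if `j - 1 ∈ Γ`), or at most through the spin at `j + 1` (if `j + 1 ∈ Γ`). -/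
structure IsBlockFamily (a : I → A) (Γ D : Set I)
    (φ : (j : starts Γ D) → (Γ → Fin 2) → (loc a (block D j) →ₗ[ℂ] ℂ)) : Prop where
  isState : ∀ j ω, IsState (φ j ω)
  isEven : ∀ j ω, IsEven a (φ j ω)
  two_step : ∀ j : starts Γ D, (j : I) ∈ D → ∀ ω ω', φ j ω = φ j ω'
  one_step : ∀ j : starts Γ D, (j : I) ∉ D →
    (∀ ω ω' : Γ → Fin 2, (∀ i : Γ, Order.succ (i : I) = j → ω i = ω' i) → φ j ω = φ j ω') ∨
    (∀ ω ω' : Γ → Fin 2, (∀ i : Γ, (i : I) = Order.succ (j : I) → ω i = ω' i) → φ j ω = φ j ω')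

/-- The function `f` of `ω` really depends on the spin `ω_i`. -/
def DependsOnSpin {Γ : Set I} {X : Type*} (f : (Γ → Fin 2) → X) (i : Γ) : Prop :=
  ∃ ω ω' : Γ → Fin 2, (∀ k, k ≠ i → ω k = ω' k) ∧ f ω ≠ f ω'

/-- `ψ` is the product state on `𝔄_{I \ Γ}` with the given factors on the blocks. -/
def IsProductState (a : I → A) (Γ D : Set I)
    (φ : (j : starts Γ D) → (loc a (block D j) →ₗ[ℂ] ℂ)) (ψ : loc a Γᶜ →ₗ[ℂ] ℂ) : Prop :=
  IsState ψ ∧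
  ∀ (L : List (starts Γ D)) (x : (j : starts Γ D) → loc a (block D j)) (y : loc a Γᶜ),
    L.Nodup → (y : A) = (L.map fun j => (x j : A)).prod →
      ψ y = (L.map fun j => φ j (x j)).prod

end Blocks

/-! ### The classical Markov measure -/

/-- `μ` is the product, over the maximal intervals of `Γ`, of the Markov measures determined by
the distributions `π j` at the places `j` and the transition matrices `p j` from `j` to
`j + 1` (both in `Γ`). It is specified on the cylinders over `Γ ∩ [k, l]`: every `j ∈ Γ ∩ [k, l]`
contributes a transition coefficient if `j - 1 ∈ Γ ∩ [k, l]`, and starts a new factor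
`π j` otherwise. -/
def IsMarkovMeasure {I : Type*} [LinearOrder I] [LocallyFiniteOrder I] [PredOrder I] (Γ : Set I)
    (π : I → Fin 2 → ℝ) (p : I → Fin 2 → Fin 2 → ℝ) (μ : Measure (Γ → Fin 2)) : Prop :=
  ∀ (k l : I) (η : I → Fin 2),
    μ.real {ω | ∀ j : Γ, (j : I) ∈ Set.Icc k l → ω j = η j} =
      ∏ j ∈ (Finset.Icc k l).filter (· ∈ Γ),
        if k < j ∧ Order.pred j ∈ Γ then p (Order.pred j) (η (Order.pred j)) (η j) else π j (η j)

/-! ### The reconstruction -/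

section Reconstruction

variable {I : Type*} [LinearOrder I] [SuccOrder I] {A : Type*} [CStarAlgebra A]

/-- The objects that enter the reconstruction, each given by its defining property: the
diagonal conditional expectation `𝓔`, the evaluations of the elements of its range at the
points `ω`, and the product states `ψ_ω`. -/
structure Ingredients (a : I → A) (Γ D : Set I)
    (φ : (j : starts Γ D) → (Γ → Fin 2) → (loc a (block D j) →ₗ[ℂ] ℂ)) where
  diagExp : A →L[ℂ] diagAlg a Γ
  ev : (Γ → Fin 2) → (diagAlg a Γ →⋆ₐ[ℂ] loc a Γᶜ)
  prodState : (Γ → Fin 2) → (loc a Γᶜ →ₗ[ℂ] ℂ)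
  isDiagExp : IsDiagExp a Γ diagExp
  isEvaluation : ∀ ω, IsEvaluation a Γ ω (ev ω)
  isProductState : ∀ ω, IsProductState a Γ D (fun j => φ j ω) (prodState ω)

/-- The prescription for the two-step expectation at `n`, on products `x x_n x_{n+1}`. -/
def IsStepMap (a : I → A) (Γ D : Set I)
    (φ : (j : starts Γ D) → (Γ → Fin 2) → (loc a (block D j) →ₗ[ℂ] ℂ))
    (ψ : A →ₗ[ℂ] ℂ) (n : I) (E : loc a (Set.Iic (Order.succ n)) →ₗ[ℂ] A) : Prop :=
  ∀ (x : loc a (Set.Iio n)) (xn : loc a {n}) (y : loc a {Order.succ n})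
    (z : loc a (Set.Iic (Order.succ n))), (z : A) = (x : A) * (xn : A) * (y : A) →
    E z =
      if n ∈ Γ then
        (x : A) * ∑ i : Fin 2, (siteTrace a n (xn * siteProj a n i) *
          (ψ (proj a n i * (y : A)) / ψ (proj a n i))) • proj a n i
      else if n ∈ D ∨ ∃ (hn : n ∈ starts Γ D) (h : Order.succ n ∈ Γ),
          DependsOnSpin (φ ⟨n, hn⟩) ⟨Order.succ n, h⟩ then
        ψ ((xn : A) * (y : A)) • (x : A)
      else
        ψ (y : A) • ((x : A) * (xn : A))

/-- `ψ` is a Markov state with respect to the sequence `E n`, `n` not the last site: each `E n` is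
a quasi-conditional expectation with respect to `𝔄_{n-1]} ⊆ 𝔄_{n]} ⊆ 𝔄_{n+1]}` which
preserves `ψ` and maps `𝔄_{[n,n+1]}` into `𝔄_{n}`. -/
structure IsMarkovStateWrt (a : I → A) (ψ : A →ₗ[ℂ] ℂ)
    (E : (n : I) → (loc a (Set.Iic (Order.succ n)) →ₗ[ℂ] A)) : Prop where
  isState : IsState ψ
  isQuasiCondExp : ∀ n, ¬ IsMax n →
    IsQuasiCondExp (loc a (Set.Iio n)) (loc a (Set.Iic n)) (E n)
  invariant : ∀ n, ¬ IsMax n → ∀ x, ψ (E n x) = ψ (x : A)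
  localized : ∀ n, ¬ IsMax n → ∀ x : loc a (Set.Iic (Order.succ n)),
    (x : A) ∈ loc a {n, Order.succ n} → E n x ∈ loc a {n}

end Reconstruction

end CAR

set_option linter.unusedSimpArgs false

namespace CAR

open Filter Topology

attribute [local instance] CStarAlgebra.spectralOrder CStarAlgebra.spectralOrderedRing

/-! ### Density and induction principles for local algebras -/

section Local

variable {I A : Type*} [CStarAlgebra A] {a : I → A}

/-! The state ψ is a mixture of product states. For fixed ω the functional x ↦ ψ_ω(𝓔(x)(ω)) is a
product state χ_ω on all of 𝔄, over the partition of I into cells: the blocks outside Γ, which carry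
φ_{b,ω}, and the single sites j of Γ, which carry the pure state x ↦ Tr(x P_{ω_j})
(`Ingredients.eval_eq`). Everything is therefore tested on words, ordered products of elements of
distinct cells. They span a dense subspace (`IsCAR.mem_of_forall_word`), and on a word χ_ω depends
on finitely many spins only.

The maps come from two devices. First, 𝔄 is a graded tensor product of 𝔄_b, b finite, and the
algebra over the complement of b; slicing with a functional that restricts to an even state on 𝔄_b
is a unital completely positive conditional expectation (`IsCAR.exists_slice`). Evenness is what
makes the signs cancel, since the functional kills odd elements. Secondly, infinite products of
contractions with disjoint supports converge pointwise, because an element over a finite region is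
moved by finitely many factors only (`IsCAR.exists_limit`, `IsCAR.exists_tensor`). Products of site
conjugations, of pinchings, and of slices give Θ, 𝓔, and the evaluations and χ_ω.

Under a Markov measure the spins up to n and the spins from n on are independent given ω_n, and
simply independent when n ∉ Γ (`IsMarkovMeasure.integral_mul`). A block state reads at most one
spin, next to its block, so the cells sort into a past and a future and the property passes to ψ
(`IsMixture.markov`).

The step expectation slices {n, n+1} with ψ in case (b) and {n+1} with ψ in case (c). In case (a) it
slices {n+1} with the conditioned states ψ(P_i ·)/ψ(P_i) and pinches at n. Invariance of ψ is then
the factorization of ψ at the matching cut: before n, after n, or through P_i. Uniqueness holds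
because 𝔄_{n+1]} is the linear span, with no closure needed, of the products x x_n x_{n+1}. -/

theorem isClosed_loc (a : I → A) (Λ : Set I) : IsClosed (loc a Λ : Set A) :=
  StarSubalgebra.isClosed_topologicalClosure _

theorem loc_mono {Λ Λ' : Set I} (h : Λ ⊆ Λ') : loc a Λ ≤ loc a Λ' :=
  StarSubalgebra.topologicalClosure_mono (StarAlgebra.adjoin_mono (Set.image_mono h))

/-- A closed subspace that contains `1` and is stable under right multiplication by the generators
contains the local algebra. -/
theorem mem_of_mem_loc {Λ : Set I} (M : Submodule ℂ A) (hM : IsClosed (M : Set A)) (h1 : 1 ∈ M)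
    (h : ∀ z ∈ M, ∀ j ∈ Λ, z * a j ∈ M ∧ z * star (a j) ∈ M) {z : A} (hz : z ∈ loc a Λ) :
    z ∈ M := by
  -- The *-algebra generated is the plain algebra generated by the `a j` and their adjoints, so
  -- stability under right multiplication extends to all of it; applied to `1 ∈ M` this gives the
  -- inclusion before taking closures.
  have key : ∀ w ∈ Algebra.adjoin ℂ (a '' Λ ∪ star (a '' Λ)), ∀ z ∈ M, z * w ∈ M := by
    intro w hw
    induction hw using Algebra.adjoin_induction with
    | mem x hx =>
      intro z hz
      rcases hx with ⟨j, hj, rfl⟩ | ⟨j, hj, hx⟩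
      · exact (h z hz j hj).1
      · rw [← star_star x, ← hx]
        exact (h z hz j hj).2
    | algebraMap r =>
      intro z hz
      rw [← Algebra.commutes, ← Algebra.smul_def]
      exact M.smul_mem _ hz
    | add x y _ _ hx hy =>
      intro z hz
      rw [mul_add]
      exact M.add_mem (hx z hz) (hy z hz)
    | mul x y _ _ hx hy =>
      intro z hz
      rw [← mul_assoc]
      exact hy _ (hx z hz)
  have hle : ((StarAlgebra.adjoin ℂ (a '' Λ) : StarSubalgebra ℂ A) : Set A) ⊆ M := by
    intro w hw
    have hw' : w ∈ (StarAlgebra.adjoin ℂ (a '' Λ)).toSubalgebra := hw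
    rw [StarAlgebra.adjoin_toSubalgebra] at hw'
    simpa using key w hw' 1 h1
  have hz' : z ∈ closure ((StarAlgebra.adjoin ℂ (a '' Λ) : StarSubalgebra ℂ A) : Set A) := hz
  exact closure_minimal hle hM hz'

theorem IsCAR.loc_univ (ha : IsCAR a) : loc a Set.univ = ⊤ := by
  rw [loc, Set.image_univ]
  exact ha.generates

theorem IsCAR.mem_loc_univ (ha : IsCAR a) (x : A) : x ∈ loc a Set.univ := by
  rw [ha.loc_univ]
  trivial

theorem mem_loc_empty {x : A} (hx : x ∈ loc a ∅) : ∃ c : ℂ, x = c • (1 : A) := by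
  let M : Submodule ℂ A := Submodule.span ℂ {1}
  have hM : IsClosed (M : Set A) := Submodule.closed_of_finiteDimensional M
  have := mem_of_mem_loc M hM (Submodule.mem_span_singleton_self 1) (by simp) hx
  obtain ⟨c, hc⟩ := Submodule.mem_span_singleton.1 this
  exact ⟨c, hc.symm⟩

/-- The local algebra over `Λ` is generated by the local algebras over the finite subsets. -/
theorem mem_of_forall_finite {Λ : Set I} (M : Submodule ℂ A) (hM : IsClosed (M : Set A))
    (h : ∀ F : Finset I, (F : Set I) ⊆ Λ → ∀ z ∈ loc a (F : Set I), z ∈ M) {z : A}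
    (hz : z ∈ loc a Λ) : z ∈ M := by
  -- The finite regions are directed, so the union of their local algebras is a *-subalgebra.
  let V : StarSubalgebra ℂ A :=
    { carrier := {x | ∃ F : Finset I, (F : Set I) ⊆ Λ ∧ x ∈ loc a (F : Set I)}
      mul_mem' := by
        rintro x y ⟨F, hF, hx⟩ ⟨G, hG, hy⟩
        refine ⟨F ∪ G, by simp [hF, hG], mul_mem (loc_mono ?_ hx) (loc_mono ?_ hy)⟩ <;> simp
      add_mem' := by
        rintro x y ⟨F, hF, hx⟩ ⟨G, hG, hy⟩
        refine ⟨F ∪ G, by simp [hF, hG], add_mem (loc_mono ?_ hx) (loc_mono ?_ hy)⟩ <;> simp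
      algebraMap_mem' := fun r => ⟨∅, by simp, algebraMap_mem _ r⟩
      star_mem' := by
        rintro x ⟨F, hF, hx⟩
        exact ⟨F, hF, star_mem hx⟩ }
  have hV : StarAlgebra.adjoin ℂ (a '' Λ) ≤ V := by
    refine StarAlgebra.adjoin_le ?_
    rintro _ ⟨j, hj, rfl⟩
    exact ⟨{j}, by simpa using hj, gen_mem_loc a (by simp)⟩
  have hz' : z ∈ closure ((StarAlgebra.adjoin ℂ (a '' Λ) : StarSubalgebra ℂ A) : Set A) := hz
  refine closure_minimal (fun w hw => ?_) hM hz'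
  obtain ⟨F, hF, hw'⟩ := hV hw
  exact h F hF w hw'

end Local

/-! ### Pointwise limits of infinite composites of contractions -/

section Limit

variable {E : Type*} [NormedAddCommGroup E] [NormedSpace ℂ E]

/-- The composite `T 0 ∘ ⋯ ∘ T (N - 1)`. -/
noncomputable def seqComp (T : ℕ → E →L[ℂ] E) : ℕ → E →L[ℂ] E
  | 0 => 1
  | N + 1 => seqComp T N * T N

theorem seqComp_norm_le {T : ℕ → E →L[ℂ] E} (hT : ∀ n x, ‖T n x‖ ≤ ‖x‖) (N : ℕ) (x : E) :
    ‖seqComp T N x‖ ≤ ‖x‖ := by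
  induction N generalizing x with
  | zero => simp [seqComp]
  | succ N ih => exact (ih _).trans (hT N x)

/-- Pointwise convergence on a dense set of eventually fixed vectors extends to the whole space. -/
theorem exists_limit [CompleteSpace E] {T : ℕ → E →L[ℂ] E} (hT : ∀ n x, ‖T n x‖ ≤ ‖x‖)
    (hd : Dense {x | ∃ N, ∀ n ≥ N, T n x = x}) :
    ∃ S : E →L[ℂ] E, ∀ x, Tendsto (fun N => seqComp T N x) atTop (𝓝 (S x)) := by
  have hc : ∀ x, CauchySeq fun N => seqComp T N x := by
    intro x
    rw [Metric.cauchySeq_iff']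
    intro ε hε
    obtain ⟨y, ⟨N, hN⟩, hy⟩ := Metric.mem_closure_iff.1 (hd x) (ε / 2) (by positivity)
    -- The newest factor acts first, so a vector fixed by all late factors makes the sequence
    -- stationary.
    have hconst : ∀ n ≥ N, seqComp T n y = seqComp T N y := by
      intro n hn
      induction n, hn using Nat.le_induction with
      | base => rfl
      | succ n hn ih =>
        change seqComp T n (T n y) = _
        rw [hN n hn, ih]
    refine ⟨N, fun n hn => ?_⟩
    have h1 : ∀ n, dist (seqComp T n x) (seqComp T n y) ≤ dist x y := by
      intro n
      rw [dist_eq_norm, dist_eq_norm, ← map_sub]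
      exact seqComp_norm_le hT n _
    calc dist (seqComp T n x) (seqComp T N x)
        ≤ dist (seqComp T n x) (seqComp T n y) + dist (seqComp T N y) (seqComp T N x) := by
          rw [← hconst n hn]
          exact dist_triangle _ _ _ |>.trans (by rw [hconst n hn])
      _ ≤ dist x y + dist x y := add_le_add (h1 n) (by rw [dist_comm]; exact h1 N)
      _ < ε := by linarith
  choose S hS using fun x => cauchySeq_tendsto_of_complete (hc x)
  let S' : E →ₗ[ℂ] E :=
    { toFun := S
      map_add' := fun x y => tendsto_nhds_unique (hS (x + y)) (by
        simpa only [map_add] using (hS x).add (hS y))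
      map_smul' := fun c x => tendsto_nhds_unique (hS (c • x)) (by
        simpa only [map_smul, RingHom.id_apply] using (hS x).const_smul c) }
  refine ⟨S'.mkContinuous 1 fun x => ?_, hS⟩
  rw [one_mul]
  exact le_of_tendsto (hS x).norm (Eventually.of_forall fun N => seqComp_norm_le hT N x)

end Limit

/-! ### Anticommutation rules, graded commutation with a generator, uniqueness of the parity -/

section Parity

variable {I A : Type*} [CStarAlgebra A] {a : I → A}

theorem IsCAR.sq (ha : IsCAR a) (j : I) : a j * a j = 0 := by
  have h := ha.anticomm j j
  rw [← two_smul ℂ] at h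
  exact (smul_eq_zero.1 h).resolve_left two_ne_zero

theorem IsCAR.star_sq (ha : IsCAR a) (j : I) : star (a j) * star (a j) = 0 := by
  rw [← star_mul, ha.sq, star_zero]

theorem IsCAR.anti_add (ha : IsCAR a) (j : I) : star (a j) * a j + a j * star (a j) = 1 := by
  simpa using ha.anticomm_star j j

theorem IsCAR.swap (ha : IsCAR a) (j k : I) : a j * a k = -(a k * a j) :=
  eq_neg_of_add_eq_zero_left (ha.anticomm j k)

theorem IsCAR.swap_star (ha : IsCAR a) (j k : I) :
    star (a j) * star (a k) = -(star (a k) * star (a j)) := by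
  rw [← star_mul, ← star_mul, ha.swap, star_neg]

theorem IsCAR.star_swap (ha : IsCAR a) {j k : I} (h : j ≠ k) :
    star (a j) * a k = -(a k * star (a j)) :=
  eq_neg_of_add_eq_zero_left (by rw [ha.anticomm_star, if_neg h])

theorem IsCAR.a_star_a (ha : IsCAR a) (j : I) : a j * star (a j) * a j = a j := by
  have := congrArg (a j * ·) (ha.anti_add j)
  simp only [mul_add, ← mul_assoc, ha.sq, zero_mul, add_zero, mul_one] at this
  exact this

theorem IsCAR.star_a_star (ha : IsCAR a) (j : I) :
    star (a j) * a j * star (a j) = star (a j) := by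
  have := congrArg star (ha.a_star_a j)
  simpa [mul_assoc] using this

/-- A *-homomorphism changing the sign of the generators intertwines multiplication with a
generator on the left and on the right. -/
theorem IsCAR.graded_gen (ha : IsCAR a) (Θ : A ≃⋆ₐ[ℂ] A) (hΘ : IsParity a Θ) (hc : Continuous Θ)
    {j : I} {Λ : Set I} (hj : j ∉ Λ) {x : A} (hx : x ∈ loc a Λ) :
    a j * Θ x = x * a j ∧ star (a j) * Θ x = x * star (a j) := by
  let M : Submodule ℂ A :=
    { carrier := {x | a j * Θ x = x * a j ∧ star (a j) * Θ x = x * star (a j)}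
      add_mem' := by
        rintro x y ⟨hx, hx'⟩ ⟨hy, hy'⟩
        simp [mul_add, add_mul, hx, hy, hx', hy']
      zero_mem' := by simp
      smul_mem' := by
        rintro c x ⟨hx, hx'⟩
        simp [hx, hx'] }
  have hM : IsClosed (M : Set A) := by
    refine IsClosed.inter (isClosed_eq ?_ ?_) (isClosed_eq ?_ ?_) <;> fun_prop
  refine mem_of_mem_loc M hM (by simp [M]) ?_ hx
  rintro z ⟨h1, h2⟩ k hk
  have hjk : j ≠ k := fun h => hj (h ▸ hk)
  refine ⟨⟨?_, ?_⟩, ⟨?_, ?_⟩⟩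
  · rw [map_mul, hΘ, ← mul_assoc, h1, mul_assoc, mul_assoc, mul_neg, ha.swap j k, neg_neg]
  · rw [map_mul, hΘ, ← mul_assoc, h2, mul_assoc, mul_assoc, mul_neg, ha.star_swap hjk, neg_neg]
  · rw [map_mul, map_star, hΘ, ← mul_assoc, h1, mul_assoc, mul_assoc, star_neg, mul_neg,
      ha.star_swap hjk.symm]
  · rw [map_mul, map_star, hΘ, ← mul_assoc, h2, mul_assoc, mul_assoc, star_neg, mul_neg,
      ha.swap_star j k, neg_neg]

theorem IsParity.continuous {Θ : A ≃⋆ₐ[ℂ] A} : Continuous Θ :=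
  AddMonoidHomClass.continuous_of_bound Θ 1 fun x => by
    simpa using NonUnitalStarAlgHom.norm_apply_le Θ x

theorem IsCAR.parity_unique (ha : IsCAR a) {Θ Θ' : A ≃⋆ₐ[ℂ] A} (h : IsParity a Θ)
    (h' : IsParity a Θ') : Θ = Θ' := by
  ext x
  let M : Submodule ℂ A := LinearMap.eqLocus (Θ : A →ₗ[ℂ] A) (Θ' : A →ₗ[ℂ] A)
  have hM : IsClosed (M : Set A) :=
    isClosed_eq IsParity.continuous IsParity.continuous
  refine mem_of_mem_loc M hM (by simp [M]) ?_ (ha.mem_loc_univ x)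
  intro z hz j _
  have hz : Θ z = Θ' z := hz
  constructor <;> simp [M, hz, h j, h' j, map_star]

end Parity

/-! ### Infinite products of maps with disjoint supports -/

section Limit

variable {I A J : Type*} [CStarAlgebra A] {a : I → A}

/-- A countable family of maps as a sequence, along an injection `f : J → ℕ`. -/
noncomputable def seqOf (T : J → A →L[ℂ] A) (f : J → ℕ) (n : ℕ) : A →L[ℂ] A :=
  if h : ∃ c, f c = n then T h.choose else 1

theorem seqOf_apply (T : J → A →L[ℂ] A) {f : J → ℕ} (hf : f.Injective) (c : J) :
    seqOf T f (f c) = T c := by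
  have h : ∃ c', f c' = f c := ⟨c, rfl⟩
  rw [seqOf, dif_pos h, hf h.choose_spec]

theorem seqOf_cases (T : J → A →L[ℂ] A) (f : J → ℕ) (n : ℕ) :
    seqOf T f n = 1 ∨ ∃ c, f c = n ∧ seqOf T f n = T c := by
  by_cases h : ∃ c, f c = n
  · exact Or.inr ⟨h.choose, h.choose_spec, dif_pos h⟩
  · exact Or.inl (dif_neg h)

theorem seqOf_norm_le {T : J → A →L[ℂ] A} (hT : ∀ c x, ‖T c x‖ ≤ ‖x‖) (f : J → ℕ) (n : ℕ)
    (x : A) : ‖seqOf T f n x‖ ≤ ‖x‖ := by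
  rcases seqOf_cases T f n with h | ⟨c, -, h⟩
  · simp [h]
  · rw [h]
    exact hT c x

/-- A finite region meets only finitely many of the disjoint supports, so every element over it is
fixed by almost all factors. Such elements are dense, which is what the abstract limit needs. -/
theorem IsCAR.exists_limit (ha : IsCAR a) {supp : J → Set I}
    (hd : Pairwise (Function.onFun Disjoint supp)) {T : J → A →L[ℂ] A}
    (hT : ∀ c x, ‖T c x‖ ≤ ‖x‖) (hfix : ∀ c, ∀ x ∈ loc a (supp c)ᶜ, T c x = x) (f : J → ℕ) :
    ∃ S : A →L[ℂ] A, ∀ x, Tendsto (fun N => seqComp (seqOf T f) N x) atTop (𝓝 (S x)) := by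
  refine CAR.exists_limit (seqOf_norm_le hT f) ?_
  let V : Submodule ℂ A :=
    { carrier := {x | ∃ N, ∀ n ≥ N, seqOf T f n x = x}
      add_mem' := by
        rintro x y ⟨N, hN⟩ ⟨N', hN'⟩
        refine ⟨max N N', fun n hn => ?_⟩
        rw [map_add, hN n (le_of_max_le_left hn), hN' n (le_of_max_le_right hn)]
      zero_mem' := ⟨0, by simp⟩
      smul_mem' := by
        rintro c x ⟨N, hN⟩
        exact ⟨N, fun n hn => by rw [map_smul, hN n hn]⟩ }
  intro x
  change x ∈ closure (V : Set A)
  rw [← Submodule.topologicalClosure_coe]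
  refine mem_of_forall_finite _ V.isClosed_topologicalClosure (fun F _ z hz => ?_)
    (ha.mem_loc_univ x)
  refine V.le_topologicalClosure ?_
  have hfin : Set.Finite {c | ∃ j ∈ F, j ∈ supp c} := by
    have : {c | ∃ j ∈ F, j ∈ supp c} = ⋃ j ∈ (F : Set I), {c | j ∈ supp c} := by
      ext c
      simp
    rw [this]
    refine F.finite_toSet.biUnion fun j _ => Set.Subsingleton.finite ?_
    intro c hc c' hc'
    by_contra hne
    exact Set.disjoint_left.1 (hd hne) hc hc'
  obtain ⟨N, hN⟩ := (hfin.image f).bddAbove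
  refine ⟨N + 1, fun n hn => ?_⟩
  rcases seqOf_cases T f n with h | ⟨c, hc, h⟩
  · simp [h]
  · rw [h]
    refine hfix c z (loc_mono ?_ hz)
    intro j hj hjc
    have := hN (Set.mem_image_of_mem f (show c ∈ {c | ∃ j ∈ F, j ∈ supp c} from ⟨j, hj, hjc⟩))
    omega

end Limit

/-! ### Existence of the parity and graded commutation of disjoint regions -/

section Parity

variable {I A : Type*} [CStarAlgebra A] {a : I → A}

/-- The self-adjoint unitary `P₁ - P₂` at the site `j`. -/
noncomputable def siteUnitary (a : I → A) (j : I) : A := a j * star (a j) - star (a j) * a j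

theorem star_siteUnitary (j : I) : star (siteUnitary a j) = siteUnitary a j := by
  simp [siteUnitary]

theorem IsCAR.siteUnitary_mul_self (ha : IsCAR a) (j : I) :
    siteUnitary a j * siteUnitary a j = 1 := by
  rw [← ha.anti_add j, siteUnitary]
  simp only [mul_sub, sub_mul, ← mul_assoc, ha.a_star_a, ha.star_a_star]
  simp only [mul_assoc, ha.sq, ha.star_sq]
  simp [add_comm]

theorem IsCAR.siteUnitary_mul_gen_self (ha : IsCAR a) (j : I) :
    siteUnitary a j * a j = -(a j * siteUnitary a j) := by
  simp only [siteUnitary, mul_sub, sub_mul, ← mul_assoc, ha.a_star_a, ha.sq]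
  simp [mul_assoc, ha.sq]

theorem IsCAR.siteUnitary_mul_gen (ha : IsCAR a) {j k : I} (h : j ≠ k) :
    siteUnitary a j * a k = a k * siteUnitary a j := by
  have h1 : a j * star (a j) * a k = a k * (a j * star (a j)) := by
    rw [mul_assoc, ha.star_swap h, mul_neg, ← mul_assoc, ha.swap j k, neg_mul, neg_neg, mul_assoc]
  have h2 : star (a j) * a j * a k = a k * (star (a j) * a j) := by
    rw [mul_assoc, ha.swap j k, mul_neg, ← mul_assoc, ha.star_swap h, neg_mul, neg_neg, mul_assoc]
  rw [siteUnitary, sub_mul, mul_sub, h1, h2]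

/-- Conjugation with the unitary `P₁ - P₂` at the site `j`. -/
noncomputable def siteConj (a : I → A) (j : I) : A →L[ℂ] A :=
  ContinuousLinearMap.mul ℂ A (siteUnitary a j) * (ContinuousLinearMap.mul ℂ A).flip (siteUnitary a j)

theorem siteConj_apply (j : I) (x : A) :
    siteConj a j x = siteUnitary a j * (x * siteUnitary a j) := rfl

theorem IsCAR.siteConj_mul (ha : IsCAR a) (j : I) (x y : A) :
    siteConj a j (x * y) = siteConj a j x * siteConj a j y := by
  simp only [siteConj_apply]
  calc _ = siteUnitary a j * x * 1 * y * siteUnitary a j := by simp only [mul_assoc, one_mul]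
    _ = _ := by rw [← ha.siteUnitary_mul_self j]; simp only [mul_assoc]

theorem siteConj_star (j : I) (x : A) : siteConj a j (star x) = star (siteConj a j x) := by
  simp [siteConj_apply, star_siteUnitary, mul_assoc]

theorem IsCAR.siteConj_one (ha : IsCAR a) (j : I) : siteConj a j 1 = 1 := by
  rw [siteConj_apply, one_mul, ha.siteUnitary_mul_self]

theorem IsCAR.siteConj_gen (ha : IsCAR a) (j k : I) :
    siteConj a j (a k) = if j = k then -a k else a k := by
  rw [siteConj_apply, ← mul_assoc]
  split_ifs with h
  · rw [h, ha.siteUnitary_mul_gen_self, neg_mul, mul_assoc, ha.siteUnitary_mul_self, mul_one]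
  · rw [ha.siteUnitary_mul_gen h, mul_assoc, ha.siteUnitary_mul_self, mul_one]

theorem IsCAR.norm_siteConj_le (ha : IsCAR a) (j : I) (x : A) : ‖siteConj a j x‖ ≤ ‖x‖ := by
  have hu : ‖siteUnitary a j‖ ≤ 1 := by
    nontriviality A
    have := CStarRing.norm_star_mul_self (x := siteUnitary a j)
    rw [star_siteUnitary, ha.siteUnitary_mul_self, norm_one] at this
    nlinarith [norm_nonneg (siteUnitary a j)]
  rw [siteConj_apply]
  calc _ ≤ ‖siteUnitary a j‖ * (‖x‖ * ‖siteUnitary a j‖) :=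
        (norm_mul_le _ _).trans (mul_le_mul_of_nonneg_left (norm_mul_le _ _) (norm_nonneg _))
    _ ≤ 1 * (‖x‖ * 1) := by gcongr
    _ = ‖x‖ := by simp

theorem IsCAR.siteConj_of_mem (ha : IsCAR a) (j : I) {x : A} (hx : x ∈ loc a {j}ᶜ) :
    siteConj a j x = x := by
  let M : Submodule ℂ A := LinearMap.eqLocus (siteConj a j : A →ₗ[ℂ] A) LinearMap.id
  have hM : IsClosed (M : Set A) := isClosed_eq (siteConj a j).continuous continuous_id
  refine mem_of_mem_loc M hM (ha.siteConj_one j) ?_ hx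
  intro z hz k hk
  have hz : siteConj a j z = z := hz
  have hk : j ≠ k := fun h => hk h.symm
  have h1 : siteConj a j (a k) = a k := by rw [ha.siteConj_gen, if_neg hk]
  have h2 : siteConj a j (star (a k)) = star (a k) := by rw [siteConj_star, h1]
  constructor
  · change siteConj a j (z * a k) = z * a k
    rw [ha.siteConj_mul, hz, h1]
  · change siteConj a j (z * star (a k)) = z * star (a k)
    rw [ha.siteConj_mul, hz, h2]

/-- Conjugation with P₁ - P₂ at the site j reverses the sign of `a j` and fixes the other
generators. Each of these is inner, and the parity is the pointwise limit of their products along an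
enumeration of the sites. -/
theorem IsCAR.exists_parity [Countable I] (ha : IsCAR a) :
    ∃ Θ : A ≃⋆ₐ[ℂ] A, IsParity a Θ := by
  obtain ⟨f, hf⟩ := exists_injective_nat I
  obtain ⟨S, hS⟩ := ha.exists_limit (supp := fun j : I => {j}) (T := siteConj a)
    (fun j k h => by simpa using h) ha.norm_siteConj_le (fun j x hx => ha.siteConj_of_mem j hx) f
  set T := seqOf (siteConj a) f
  have hmul : ∀ n x y, T n (x * y) = T n x * T n y := by
    intro n x y
    rcases seqOf_cases (siteConj a) f n with h | ⟨c, -, h⟩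
    · simp [T, h]
    · simp only [T, h, ha.siteConj_mul]
  have hstar : ∀ n x, T n (star x) = star (T n x) := by
    intro n x
    rcases seqOf_cases (siteConj a) f n with h | ⟨c, -, h⟩
    · simp [T, h]
    · simp only [T, h, siteConj_star]
  have hone : ∀ n, T n 1 = 1 := by
    intro n
    rcases seqOf_cases (siteConj a) f n with h | ⟨c, -, h⟩
    · simp [T, h]
    · simp only [T, h, ha.siteConj_one]
  have hgen : ∀ n j, T n (a j) = if f j = n then -a j else a j := by
    intro n j
    split_ifs with hj
    · simp only [T, ← hj, seqOf_apply _ hf, ha.siteConj_gen, if_true]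
    · rcases seqOf_cases (siteConj a) f n with h | ⟨c, hc, h⟩
      · simp [T, h]
      · simp only [T, h, ha.siteConj_gen]
        rw [if_neg]
        rintro rfl
        exact hj hc
  have hmul' : ∀ N x y, seqComp T N (x * y) = seqComp T N x * seqComp T N y := by
    intro N
    induction N with
    | zero => simp [seqComp]
    | succ N ih => intro x y; simp [seqComp, hmul, ih]
  have hstar' : ∀ N x, seqComp T N (star x) = star (seqComp T N x) := by
    intro N
    induction N with
    | zero => simp [seqComp]
    | succ N ih => intro x; simp [seqComp, hstar, ih]
  have hone' : ∀ N, seqComp T N 1 = 1 := by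
    intro N
    induction N with
    | zero => simp [seqComp]
    | succ N ih => simp [seqComp, hone, ih]
  have hgen' : ∀ N j, seqComp T N (a j) = if f j < N then -a j else a j := by
    intro N
    induction N with
    | zero => simp [seqComp]
    | succ N ih =>
      intro j
      change seqComp T N (T N (a j)) = _
      rw [hgen]
      split_ifs with h1 h2 h2
      · rw [map_neg, ih, if_neg (by omega)]
      · omega
      · rw [ih, if_pos (by omega)]
      · rw [ih, if_neg (by omega)]
  have hSmul : ∀ x y, S (x * y) = S x * S y := fun x y =>
    tendsto_nhds_unique (hS (x * y)) (by simpa only [hmul'] using (hS x).mul (hS y))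
  have hSstar : ∀ x, S (star x) = star (S x) := fun x =>
    tendsto_nhds_unique (hS (star x)) (by simpa only [hstar'] using (hS x).star)
  have hSone : S 1 = 1 := tendsto_nhds_unique (hS 1) (by simp only [hone']; exact tendsto_const_nhds)
  have hSgen : ∀ j, S (a j) = -a j := fun j =>
    tendsto_nhds_unique (hS (a j)) (tendsto_const_nhds.congr' (by
      filter_upwards [eventually_gt_atTop (f j)] with N hN
      rw [hgen', if_pos hN]))
  -- The limit is an involution on generators, hence everywhere; this supplies the inverse that a
  -- limit of automorphisms need not have.
  have hSS : ∀ x, S (S x) = x := by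
    intro x
    let M : Submodule ℂ A := LinearMap.eqLocus ((S * S : A →L[ℂ] A) : A →ₗ[ℂ] A) LinearMap.id
    have hM : IsClosed (M : Set A) := isClosed_eq (S * S : A →L[ℂ] A).continuous continuous_id
    refine mem_of_mem_loc M hM (by simp [M, hSone]) ?_ (ha.mem_loc_univ x)
    intro z hz j _
    have hz : S (S z) = z := hz
    constructor
    · change S (S (z * a j)) = z * a j
      simp [hSmul, hz, hSgen]
    · change S (S (z * star (a j))) = z * star (a j)
      simp [hSmul, hz, hSgen, hSstar]
  exact ⟨{ toFun := S, invFun := S, left_inv := hSS, right_inv := hSS, map_mul' := hSmul,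
           map_add' := S.map_add, map_star' := hSstar, map_smul' := S.map_smul }, hSgen⟩

theorem IsCAR.parity_parity (ha : IsCAR a) {Θ : A ≃⋆ₐ[ℂ] A} (hΘ : IsParity a Θ) (x : A) :
    Θ (Θ x) = x := by
  have hc : Continuous Θ := IsParity.continuous
  let M : Submodule ℂ A := LinearMap.eqLocus ((Θ : A →ₗ[ℂ] A) ∘ₗ (Θ : A →ₗ[ℂ] A)) LinearMap.id
  have hM : IsClosed (M : Set A) := isClosed_eq (hc.comp hc) continuous_id
  refine mem_of_mem_loc M hM (by simp [M]) ?_ (ha.mem_loc_univ x)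
  intro z hz j _
  have hz : Θ (Θ z) = z := hz
  constructor
  · change Θ (Θ (z * a j)) = z * a j
    simp [hΘ j, hz]
  · change Θ (Θ (z * star (a j))) = z * star (a j)
    simp [hΘ j, hz, map_star]

theorem IsParity.mem_loc {Θ : A ≃⋆ₐ[ℂ] A} (hΘ : IsParity a Θ) {Λ : Set I} {x : A}
    (hx : x ∈ loc a Λ) : Θ x ∈ loc a Λ := by
  refine mem_of_mem_loc (Submodule.comap (Θ : A →ₗ[ℂ] A) (loc a Λ).toSubalgebra.toSubmodule)
    ((isClosed_loc a Λ).preimage IsParity.continuous) ?_ ?_ hx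
  · change Θ 1 ∈ loc a Λ
    rw [map_one]
    exact one_mem _
  · intro z hz k hk
    have hz : Θ z ∈ loc a Λ := hz
    constructor
    · change Θ (z * a k) ∈ loc a Λ
      rw [map_mul, hΘ]
      exact mul_mem hz (neg_mem (gen_mem_loc a hk))
    · change Θ (z * star (a k)) ∈ loc a Λ
      rw [map_mul, map_star, hΘ]
      exact mul_mem hz (star_mem (neg_mem (gen_mem_loc a hk)))

/-- Graded commutation of the elements localized in disjoint regions. -/
theorem IsCAR.graded (ha : IsCAR a) {Θ : A ≃⋆ₐ[ℂ] A} (hΘ : IsParity a Θ) {b Λ : Set I}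
    (hb : Disjoint b Λ) {e x : A} (he : e ∈ loc a b) (hx : x ∈ loc a Λ) :
    (e + Θ e) * x + (e - Θ e) * Θ x = (2 : ℂ) • (x * e) := by
  have hc : Continuous Θ := IsParity.continuous
  let M : Submodule ℂ A :=
    { carrier := {e | ∀ x ∈ loc a Λ, (e + Θ e) * x + (e - Θ e) * Θ x = (2 : ℂ) • (x * e)}
      add_mem' := by
        intro e e' h h' x hx
        rw [mul_add, smul_add, ← h x hx, ← h' x hx, map_add]
        simp only [add_mul, sub_mul]
        abel
      zero_mem' := by simp
      smul_mem' := by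
        intro c e h x hx
        rw [mul_smul_comm, smul_comm, ← h x hx, map_smul]
        simp only [add_mul, sub_mul, smul_add, smul_sub, smul_mul_assoc] }
  have hM : IsClosed (M : Set A) := by
    have : (M : Set A) = ⋂ x ∈ loc a Λ,
        {e | (e + Θ e) * x + (e - Θ e) * Θ x = (2 : ℂ) • (x * e)} := by
      ext e
      simp [M]
    rw [this]
    exact isClosed_biInter fun x _ => isClosed_eq (by fun_prop) (by fun_prop)
  refine mem_of_mem_loc M hM ?_ ?_ he x hx
  · intro x _
    simp [two_smul, add_mul]
  · intro z hz j hj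
    have hj' : j ∉ Λ := Set.disjoint_left.1 hb hj
    have main : ∀ g : A, Θ g = -g → (∀ x ∈ loc a Λ, g * Θ x = x * g) → z * g ∈ M := by
      intro g hg hgx x hx
      have h1 := hgx x hx
      have h2 := hgx (Θ x) (hΘ.mem_loc hx)
      rw [ha.parity_parity hΘ] at h2
      rw [map_mul, hg, ← mul_assoc, ← smul_mul_assoc, ← hz x hx]
      simp only [add_mul, sub_mul, mul_neg, mul_assoc, h1, h2, neg_mul]
      abel
    exact ⟨main _ (hΘ j) fun x hx => (ha.graded_gen Θ hΘ hc hj' hx).1,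
      main _ (by rw [map_star, hΘ, star_neg]) fun x hx => (ha.graded_gen Θ hΘ hc hj' hx).2⟩

theorem IsCAR.even_commute (ha : IsCAR a) {Θ : A ≃⋆ₐ[ℂ] A} (hΘ : IsParity a Θ) {b Λ : Set I}
    (hb : Disjoint b Λ) {e x : A} (he : e ∈ loc a b) (hx : x ∈ loc a Λ) (h : Θ e = e) :
    e * x = x * e := by
  have := ha.graded hΘ hb he hx
  rw [h, sub_self, zero_mul, add_zero, ← two_smul ℂ, smul_mul_assoc] at this
  exact smul_right_injective A (two_ne_zero : (2 : ℂ) ≠ 0) this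

theorem IsCAR.odd_commute (ha : IsCAR a) {Θ : A ≃⋆ₐ[ℂ] A} (hΘ : IsParity a Θ) {b Λ : Set I}
    (hb : Disjoint b Λ) {e x : A} (he : e ∈ loc a b) (hx : x ∈ loc a Λ) (h : Θ e = -e) :
    e * Θ x = x * e := by
  have := ha.graded hΘ hb he hx
  rw [h, sub_neg_eq_add, add_neg_cancel, zero_mul, zero_add, ← two_smul ℂ, smul_mul_assoc] at this
  exact smul_right_injective A (two_ne_zero : (2 : ℂ) ≠ 0) this

end Parity

/-! ### Expansion over a finite region with coefficients over the complement -/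

section Frame

variable {I A : Type*} [CStarAlgebra A] {a : I → A}

/-- A homogeneous basis of the local algebra over `b`, together with the coefficient maps of the
elements of `A`, which take values in the algebra over the complement. -/
structure Frame (a : I → A) (Θ : A ≃⋆ₐ[ℂ] A) (b : Set I) where
  ι : Type
  [fin : Fintype ι]
  e : ι → A
  e_mem : ∀ k, e k ∈ loc a b
  homogeneous : ∀ k, Θ (e k) = e k ∨ Θ (e k) = -e k
  coeff : ι → A →L[ℂ] A
  coeff_mem : ∀ W z, z ∈ loc a W → ∀ k, coeff k z ∈ loc a (W \ b)
  sum_coeff : ∀ z, ∑ k, coeff k z * e k = z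
  coeff_mul : ∀ x ∈ loc a bᶜ, ∀ k z, coeff k (x * z) = x * coeff k z

attribute [instance] Frame.fin

/-- The map `z ↦ p z q`. -/
noncomputable def sandwich (p q : A) : A →L[ℂ] A :=
  ContinuousLinearMap.mul ℂ A p * (ContinuousLinearMap.mul ℂ A).flip q

@[simp]
theorem sandwich_apply (p q z : A) : sandwich p q z = p * (z * q) := rfl

/-- A *-automorphism as a continuous linear map. -/
noncomputable def autL (Θ : A ≃⋆ₐ[ℂ] A) : A →L[ℂ] A :=
  ⟨(Θ : A →ₗ[ℂ] A), IsParity.continuous⟩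

@[simp]
theorem autL_apply (Θ : A ≃⋆ₐ[ℂ] A) (z : A) : autL Θ z = Θ z := rfl

/-- The coefficient of `z` at `a a⁺`. -/
noncomputable def siteCoeff₁ (a : I → A) (Θ : A ≃⋆ₐ[ℂ] A) (j : I) : A →L[ℂ] A :=
  sandwich (a j * star (a j)) (a j * star (a j)) + sandwich (star (a j)) (a j) * autL Θ

/-- The coefficient of `z` at `a⁺ a`. -/
noncomputable def siteCoeff₂ (a : I → A) (Θ : A ≃⋆ₐ[ℂ] A) (j : I) : A →L[ℂ] A :=
  sandwich (star (a j) * a j) (star (a j) * a j) + sandwich (a j) (star (a j)) * autL Θ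

theorem siteCoeff₁_apply (Θ : A ≃⋆ₐ[ℂ] A) (j : I) (z : A) : siteCoeff₁ a Θ j z =
    a j * (star (a j) * (z * (a j * star (a j)))) + star (a j) * (Θ z * a j) := by
  simp [siteCoeff₁, mul_assoc]

theorem siteCoeff₂_apply (Θ : A ≃⋆ₐ[ℂ] A) (j : I) (z : A) : siteCoeff₂ a Θ j z =
    star (a j) * (a j * (z * (star (a j) * a j))) + a j * (Θ z * star (a j)) := by
  simp [siteCoeff₂, mul_assoc]

theorem IsCAR.rules (ha : IsCAR a) (j : I) (x : A) :
    a j * a j = 0 ∧ star (a j) * star (a j) = 0 ∧ a j * (a j * x) = 0 ∧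
    star (a j) * (star (a j) * x) = 0 ∧ a j * (star (a j) * a j) = a j ∧
    star (a j) * (a j * star (a j)) = star (a j) ∧
    a j * (star (a j) * (a j * x)) = a j * x ∧
    star (a j) * (a j * (star (a j) * x)) = star (a j) * x := by
  refine ⟨ha.sq j, ha.star_sq j, ?_, ?_, ?_, ?_, ?_, ?_⟩
  · rw [← mul_assoc, ha.sq, zero_mul]
  · rw [← mul_assoc, ha.star_sq, zero_mul]
  · rw [← mul_assoc, ha.a_star_a]
  · rw [← mul_assoc, ha.star_a_star]
  · rw [← mul_assoc, ← mul_assoc, ha.a_star_a]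
  · rw [← mul_assoc, ← mul_assoc, ha.star_a_star]

/-- The four coefficients must be treated together: right multiplication by `a j` or its adjoint
moves each of them to another one or to zero, while a generator at another site passes through up to
a sign. Only the joint statement is stable under the induction. -/
theorem IsCAR.siteCoeff_mem (ha : IsCAR a) {Θ : A ≃⋆ₐ[ℂ] A} (hΘ : IsParity a Θ) (j : I) {W : Set I}
    {z : A} (hz : z ∈ loc a W) :
    siteCoeff₁ a Θ j z ∈ loc a (W \ {j}) ∧ siteCoeff₁ a Θ j (z * star (a j)) ∈ loc a (W \ {j}) ∧
    siteCoeff₂ a Θ j (z * a j) ∈ loc a (W \ {j}) ∧ siteCoeff₂ a Θ j z ∈ loc a (W \ {j}) := by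
  have h3 := fun x => (ha.rules j x).2.2.1
  have h4 := fun x => (ha.rules j x).2.2.2.1
  have h5 := (ha.rules j 0).2.2.2.2.1
  have h6 := (ha.rules j 0).2.2.2.2.2.1
  have h7 := fun x => (ha.rules j x).2.2.2.2.2.2.1
  have h8 := fun x => (ha.rules j x).2.2.2.2.2.2.2
  have h1 := ha.sq j
  have h2 := ha.star_sq j
  let L : Submodule ℂ A := (loc a (W \ {j})).toSubalgebra.toSubmodule
  let rs (g : A) : A →L[ℂ] A := (ContinuousLinearMap.mul ℂ A).flip g
  let M : Submodule ℂ A :=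
    (L.comap (siteCoeff₁ a Θ j : A →ₗ[ℂ] A) ⊓
      L.comap (siteCoeff₁ a Θ j * rs (star (a j)) : A →L[ℂ] A).toLinearMap) ⊓
    (L.comap (siteCoeff₂ a Θ j * rs (a j) : A →L[ℂ] A).toLinearMap ⊓
      L.comap (siteCoeff₂ a Θ j : A →ₗ[ℂ] A))
  have hL : IsClosed (L : Set A) := isClosed_loc _ _
  have hM : IsClosed (M : Set A) := by
    refine IsClosed.inter (IsClosed.inter ?_ ?_) (IsClosed.inter ?_ ?_) <;>
      exact hL.preimage (ContinuousLinearMap.continuous _)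
  have mem_M : ∀ z, z ∈ M ↔ siteCoeff₁ a Θ j z ∈ loc a (W \ {j}) ∧
      siteCoeff₁ a Θ j (z * star (a j)) ∈ loc a (W \ {j}) ∧
      siteCoeff₂ a Θ j (z * a j) ∈ loc a (W \ {j}) ∧ siteCoeff₂ a Θ j z ∈ loc a (W \ {j}) := by
    intro z
    exact and_assoc
  rw [← mem_M]
  refine mem_of_mem_loc M hM ?_ ?_ hz
  · rw [mem_M]
    have e1 : siteCoeff₁ a Θ j 1 = 1 := by
      simp only [siteCoeff₁_apply, one_mul, map_one, h6]
      rw [add_comm, ha.anti_add]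
    have e2 : siteCoeff₂ a Θ j 1 = 1 := by
      simp only [siteCoeff₂_apply, one_mul, map_one, h5]
      rw [ha.anti_add]
    refine ⟨?_, ?_, ?_, ?_⟩
    · rw [e1]; exact one_mem _
    · rw [siteCoeff₁_apply]
      simp [h1, h2, h3, h4, h5, h6, map_star, hΘ j]
    · rw [siteCoeff₂_apply]
      simp [h1, h2, h3, h4, h5, h6, map_star, hΘ j]
    · rw [e2]; exact one_mem _
  · intro z hz k hk
    rw [mem_M] at hz
    obtain ⟨z1, z2, z3, z4⟩ := hz
    by_cases hkj : k = j
    · subst hkj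
      rw [mem_M, mem_M]
      simp only [siteCoeff₁_apply, siteCoeff₂_apply, map_mul, map_star, hΘ k, star_neg, mul_assoc]
        at z1 z2 z3 z4 ⊢
      simp only [h1, h2, h3, h4, h5, h6, h7, h8, mul_neg, neg_mul, mul_zero, neg_zero, add_zero,
        zero_add, neg_neg] at z1 z2 z3 z4 ⊢
      exact ⟨⟨zero_mem _, z1, zero_mem _, z3⟩, z2, zero_mem _, z4, zero_mem _⟩
    · have key : ∀ g : A, Θ g = -g → g * a j = -(a j * g) → g * star (a j) = -(star (a j) * g) →
          g ∈ loc a (W \ {j}) → z * g ∈ M := by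
        intro g g1 g2 g3 g4
        have g2' : ∀ x, g * (a j * x) = -(a j * (g * x)) := fun x => by
          rw [← mul_assoc, g2, neg_mul, mul_assoc]
        have g3' : ∀ x, g * (star (a j) * x) = -(star (a j) * (g * x)) := fun x => by
          rw [← mul_assoc, g3, neg_mul, mul_assoc]
        rw [mem_M]
        have e1 : siteCoeff₁ a Θ j (z * g) = siteCoeff₁ a Θ j z * g := by
          simp only [siteCoeff₁_apply, add_mul, mul_assoc, map_mul, g1, g2, g3, g2', g3', mul_neg,
            neg_mul, neg_neg]
        have e2 : siteCoeff₁ a Θ j (z * g * star (a j)) =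
            -(siteCoeff₁ a Θ j (z * star (a j)) * g) := by
          simp only [siteCoeff₁_apply, add_mul, mul_assoc, map_mul, g1, g2, g3, g2', g3', mul_neg,
            neg_mul, neg_neg, neg_add, map_neg, map_star, hΘ j]
        have e3 : siteCoeff₂ a Θ j (z * g * a j) = -(siteCoeff₂ a Θ j (z * a j) * g) := by
          simp only [siteCoeff₂_apply, add_mul, mul_assoc, map_mul, g1, g2, g3, g2', g3', mul_neg,
            neg_mul, neg_neg, neg_add, map_neg, map_star, hΘ j]
        have e4 : siteCoeff₂ a Θ j (z * g) = siteCoeff₂ a Θ j z * g := by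
          simp only [siteCoeff₂_apply, add_mul, mul_assoc, map_mul, g1, g2, g3, g2', g3', mul_neg,
            neg_mul, neg_neg]
        rw [e1, e2, e3, e4]
        exact ⟨mul_mem z1 g4, neg_mem (mul_mem z2 g4), neg_mem (mul_mem z3 g4), mul_mem z4 g4⟩
      have hmem : a k ∈ loc a (W \ {j}) := gen_mem_loc a ⟨hk, hkj⟩
      refine ⟨key _ (hΘ k) (ha.swap k j) ?_ hmem, key _ (by rw [map_star, hΘ, star_neg])
        (ha.star_swap hkj) (ha.swap_star k j) (star_mem hmem)⟩
      rw [ha.star_swap (Ne.symm hkj), neg_neg]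

/-- The matrix units at a site. -/
noncomputable def siteFrame (ha : IsCAR a) {Θ : A ≃⋆ₐ[ℂ] A} (hΘ : IsParity a Θ) (j : I) :
    Frame a Θ {j} where
  ι := Fin 4
  e := ![a j * star (a j), a j, star (a j), star (a j) * a j]
  e_mem k := by
    have h := gen_mem_loc a (Set.mem_singleton j)
    fin_cases k
    · exact mul_mem h (star_mem h)
    · exact h
    · exact star_mem h
    · exact mul_mem (star_mem h) h
  homogeneous k := by
    fin_cases k <;> simp [map_star, hΘ j]
  coeff := ![siteCoeff₁ a Θ j,
    (siteCoeff₁ a Θ j).comp ((ContinuousLinearMap.mul ℂ A).flip (star (a j))),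
    (siteCoeff₂ a Θ j).comp ((ContinuousLinearMap.mul ℂ A).flip (a j)), siteCoeff₂ a Θ j]
  coeff_mem W z hz k := by
    obtain ⟨h1, h2, h3, h4⟩ := ha.siteCoeff_mem hΘ j hz
    fin_cases k
    exacts [h1, h2, h3, h4]
  sum_coeff z := by
    have h3 := fun x => (ha.rules j x).2.2.1
    have h4 := fun x => (ha.rules j x).2.2.2.1
    have h5 := (ha.rules j 0).2.2.2.2.1
    have h6 := (ha.rules j 0).2.2.2.2.2.1
    have h7 := fun x => (ha.rules j x).2.2.2.2.2.2.1
    have h8 := fun x => (ha.rules j x).2.2.2.2.2.2.2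
    have h1 := ha.sq j
    have h2 := ha.star_sq j
    have : z = (star (a j) * a j + a j * star (a j)) * z * (star (a j) * a j + a j * star (a j)) := by
      rw [ha.anti_add, one_mul, mul_one]
    rw [Fin.sum_univ_four]
    conv_rhs => rw [this]
    simp only [Matrix.cons_val, ContinuousLinearMap.mul_apply', ContinuousLinearMap.flip_apply,
      ContinuousLinearMap.comp_apply, siteCoeff₁_apply, siteCoeff₂_apply, map_mul,
      map_star, hΘ j, star_neg, add_mul, mul_add, mul_assoc, mul_neg, neg_mul, h1, h2, h3, h4, h5,
      h6, h7, h8, mul_zero, neg_zero, add_zero]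
    abel
  coeff_mul x hx k z := by
    obtain ⟨g1, g2⟩ := ha.graded_gen Θ hΘ IsParity.continuous (j := j) (by simp) hx
    have hΘx := hΘ.mem_loc hx
    obtain ⟨g3, g4⟩ := ha.graded_gen Θ hΘ IsParity.continuous (j := j) (by simp) hΘx
    rw [ha.parity_parity hΘ] at g3 g4
    have g1' : ∀ y, a j * (Θ x * y) = x * (a j * y) := fun y => by
      rw [← mul_assoc, g1, mul_assoc]
    have g2' : ∀ y, star (a j) * (Θ x * y) = x * (star (a j) * y) := fun y => by
      rw [← mul_assoc, g2, mul_assoc]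
    have g3' : ∀ y, a j * (x * y) = Θ x * (a j * y) := fun y => by
      rw [← mul_assoc, g3, mul_assoc]
    have g4' : ∀ y, star (a j) * (x * y) = Θ x * (star (a j) * y) := fun y => by
      rw [← mul_assoc, g4, mul_assoc]
    fin_cases k <;>
    simp [siteCoeff₁_apply, siteCoeff₂_apply, mul_assoc, g3', g4', g1', g2', mul_add]

/-- The products of the elements of frames over disjoint regions. -/
noncomputable def Frame.union {Θ : A ≃⋆ₐ[ℂ] A} {b b' : Set I} (f : Frame a Θ b) (f' : Frame a Θ b') :
    Frame a Θ (b ∪ b') where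
  ι := f.ι × f'.ι
  e k := f.e k.1 * f'.e k.2
  e_mem k := mul_mem (loc_mono Set.subset_union_left (f.e_mem _))
    (loc_mono Set.subset_union_right (f'.e_mem _))
  homogeneous k := by
    rw [map_mul]
    rcases f.homogeneous k.1 with h1 | h1 <;> rcases f'.homogeneous k.2 with h2 | h2 <;>
      simp [h1, h2]
  coeff k := (f.coeff k.1).comp (f'.coeff k.2)
  coeff_mem W z hz k := by
    have := f.coeff_mem _ _ (f'.coeff_mem W z hz k.2) k.1
    rwa [Set.sdiff_sdiff, Set.union_comm] at this
  sum_coeff z := by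
    rw [Fintype.sum_prod_type_right]
    simp only [← mul_assoc, ← Finset.sum_mul]
    simp only [ContinuousLinearMap.comp_apply, f.sum_coeff, f'.sum_coeff]
  coeff_mul x hx k z := by
    have h1 : x ∈ loc a bᶜ := loc_mono (by simp) hx
    have h2 : x ∈ loc a b'ᶜ := loc_mono (by simp) hx
    simp only [ContinuousLinearMap.comp_apply, f'.coeff_mul x h2, f.coeff_mul x h1]

theorem IsCAR.exists_frame (ha : IsCAR a) {Θ : A ≃⋆ₐ[ℂ] A} (hΘ : IsParity a Θ) {b : Set I}
    (hb : b.Finite) : Nonempty (Frame a Θ b) := by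
  induction b, hb using Set.Finite.induction_on with
  | empty =>
    exact ⟨{ ι := Unit
             e := fun _ => 1
             e_mem := fun _ => one_mem _
             homogeneous := fun _ => Or.inl (map_one Θ)
             coeff := fun _ => 1
             coeff_mem := fun W z hz _ => by simpa using hz
             sum_coeff := by simp
             coeff_mul := by simp }⟩
  | @insert j b hj _ ih =>
    obtain ⟨f⟩ := ih
    rw [Set.insert_eq]
    exact ⟨(siteFrame ha hΘ j).union f⟩

end Frame

/-! ### Norm bounds for states and completely positive maps -/

section Positive

/-- Polarization: reality of the values at 1, x, 1 + x and 1 + ix determines the real and imaginary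
parts of the value at x⁺. -/
theorem map_star_of_nonneg {B : Type*} [Ring B] [StarRing B] [Algebra ℂ B] [StarModule ℂ B]
    {φ : B →ₗ[ℂ] ℂ} (h : ∀ x, 0 ≤ φ (star x * x)) (x : B) : φ (star x) = star (φ x) := by
  have h1 := h 1
  have h2 := h x
  have h3 := h (1 + x)
  have h4 := h (1 + Complex.I • x)
  simp only [star_add, star_one, star_smul, add_mul, mul_add, one_mul, mul_one, smul_mul_assoc,
    mul_smul_comm, map_add, map_smul, smul_smul, smul_eq_mul] at h1 h2 h3 h4
  rw [Complex.nonneg_iff] at h1 h2 h3 h4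
  simp [Complex.add_im, Complex.mul_im] at h1 h2 h3 h4
  apply Complex.ext <;> simp <;> linarith [h1.2, h2.2, h3.2, h4.2]

/-- Positivity at x - φ(x)1 gives |φ(x)|² ≤ φ(x⁺x), and ‖x‖² - x⁺x is a square w⁺w, so that φ(x⁺x) ≤
‖x‖². -/
theorem IsState.norm_apply_le {B : Type*} [CStarAlgebra B] {φ : B →ₗ[ℂ] ℂ} (h : IsState φ)
    (x : B) : ‖φ x‖ ≤ ‖x‖ := by
  have h1 := h.2 (x - algebraMap ℂ B (φ x))
  have hs := map_star_of_nonneg h.2 x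
  obtain ⟨w, hw⟩ := CStarAlgebra.nonneg_iff_eq_star_mul_self.1
    (sub_nonneg.2 (CStarAlgebra.star_mul_le_algebraMap_norm_sq (a := x)))
  have h2 := h.2 w
  rw [← hw] at h2
  have hr : (algebraMap ℝ B (‖x‖ ^ 2)) = ((‖x‖ ^ 2 : ℝ) : ℂ) • (1 : B) := by
    rw [Algebra.algebraMap_eq_smul_one, Complex.coe_smul]
  rw [hr, map_sub, map_smul, h.1, smul_eq_mul, mul_one] at h2
  have h3 : φ (star (x - algebraMap ℂ B (φ x)) * (x - algebraMap ℂ B (φ x))) =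
      φ (star x * x) - star (φ x) * φ x := by
    simp only [Algebra.algebraMap_eq_smul_one, star_sub, star_smul, star_one, sub_mul, mul_sub,
      smul_mul_assoc, mul_smul_comm, one_mul, mul_one, map_sub, map_smul, h.1, hs, smul_eq_mul]
    ring
  rw [h3] at h1
  have h4 : star (φ x) * φ x ≤ ((‖x‖ ^ 2 : ℝ) : ℂ) := (sub_nonneg.1 h1).trans (sub_nonneg.1 h2)
  have h5 : star (φ x) * φ x = ((‖φ x‖ ^ 2 : ℝ) : ℂ) := by
    rw [Complex.star_def, Complex.conj_mul']
    push_cast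
    rfl
  rw [h5] at h4
  have h6 : ‖φ x‖ ^ 2 ≤ ‖x‖ ^ 2 := by exact_mod_cast h4
  exact (sq_le_sq₀ (norm_nonneg _) (norm_nonneg _)).1 h6

variable {A : Type*} [CStarAlgebra A]

/-- Complete positivity of a map `A → A`. -/
def IsCP (Φ : A →L[ℂ] A) : Prop :=
  ∀ (m : ℕ) (x y : Fin m → A), 0 ≤ ∑ i, ∑ j, star (y i) * Φ (star (x i) * x j) * y j

theorem IsCP.nonneg {Φ : A →L[ℂ] A} (h : IsCP Φ) (x : A) : 0 ≤ Φ (star x * x) := by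
  simpa using h 1 (fun _ => x) (fun _ => 1)

theorem IsCP.map_star {Φ : A →L[ℂ] A} (h : IsCP Φ) (x : A) : Φ (star x) = star (Φ x) := by
  have hsa : ∀ x : A, star (Φ (star x * x)) = Φ (star x * x) := fun x =>
    (IsSelfAdjoint.of_nonneg (h.nonneg x)).star_eq
  have h1 : star (Φ 1) = Φ 1 := by simpa using hsa 1
  have h2 := hsa x
  have h3 := hsa (1 + x)
  have h4 := hsa (1 + Complex.I • x)
  simp only [star_add, star_one, add_mul, mul_add, one_mul, mul_one, map_add, h1, h2] at h3
  simp [add_mul, mul_add, h1] at h4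
  have h2' : star (Φ (star x * x)) = Φ (star x * x) := h2
  have h3' : star (Φ x) + star (Φ (star x)) = Φ x + Φ (star x) := by
    rw [← sub_eq_zero] at h3 ⊢
    rw [← h3]
    abel
  have h4' : star (Φ x) - star (Φ (star x)) = Φ (star x) - Φ x := by
    have e : (-Complex.I) • star (Φ x) + Complex.I • star (Φ (star x)) =
        Complex.I • Φ x + (-Complex.I) • Φ (star x) := by
      rw [← sub_eq_zero] at h4 ⊢
      rw [← h4]
      simp [h2']
      abel
    have e2 := congrArg (fun z => Complex.I • z) e
    simpa [smul_smul, sub_eq_add_neg, add_comm] using e2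
  have : (2 : ℂ) • star (Φ x) = (2 : ℂ) • Φ (star x) := by
    rw [two_smul, two_smul]
    calc star (Φ x) + star (Φ x) = (star (Φ x) + star (Φ (star x))) +
          (star (Φ x) - star (Φ (star x))) := by abel
      _ = _ := by rw [h3', h4']; abel
  exact (smul_right_injective A (two_ne_zero : (2 : ℂ) ≠ 0) this).symm

/-- A unital completely positive map is a contraction. -/
theorem IsCP.norm_le {Φ : A →L[ℂ] A} (h : IsCP Φ) (h1 : Φ 1 = 1) (x : A) : ‖Φ x‖ ≤ ‖x‖ := by
  -- The Kadison–Schwarz inequality, read off from complete positivity for the families (x, 1) and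
  -- (1, -Φ x).
  have key : star (Φ x) * Φ x ≤ Φ (star x * x) := by
    have := h 2 ![x, 1] ![1, -Φ x]
    rw [Fin.sum_univ_two, Fin.sum_univ_two, Fin.sum_univ_two] at this
    simp [h1, h.map_star] at this
    exact this
  obtain ⟨w, hw⟩ := CStarAlgebra.nonneg_iff_eq_star_mul_self.1
    (sub_nonneg.2 (CStarAlgebra.star_mul_le_algebraMap_norm_sq (a := x)))
  have h2 := h.nonneg w
  have hr : (algebraMap ℝ A (‖x‖ ^ 2)) = ((‖x‖ ^ 2 : ℝ) : ℂ) • (1 : A) := by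
    rw [Algebra.algebraMap_eq_smul_one, Complex.coe_smul]
  rw [← hw, map_sub, hr, map_smul, h1, ← hr, sub_nonneg] at h2
  have h3 := (CStarAlgebra.norm_le_iff_le_algebraMap (star (Φ x) * Φ x) (sq_nonneg ‖x‖)
    (star_mul_self_nonneg _)).2 (key.trans h2)
  rw [CStarRing.norm_star_mul_self, ← sq] at h3
  exact (sq_le_sq₀ (norm_nonneg _) (norm_nonneg _)).1 h3

end Positive

/-! ### Slice maps with even states -/

section Slice

variable {I A : Type*} [CStarAlgebra A] {a : I → A}

/-- `f` restricts to an even state on the local algebra over `b`. -/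
structure IsEvenStateOn (a : I → A) (Θ : A ≃⋆ₐ[ℂ] A) (b : Set I) (f : A →ₗ[ℂ] ℂ) : Prop where
  map_one : f 1 = 1
  nonneg : ∀ x ∈ loc a b, 0 ≤ f (star x * x)
  even : ∀ x ∈ loc a b, f (Θ x) = f x

/-- `Φ` is the conditional expectation onto the algebra over the complement of `b`
that slices with the even state `f`. -/
structure IsSlice (a : I → A) (Θ : A ≃⋆ₐ[ℂ] A) (b : Set I) (f : A →ₗ[ℂ] ℂ) (Φ : A →L[ℂ] A) :
    Prop where
  cp : IsCP Φ
  mul_left : ∀ x ∈ loc a bᶜ, ∀ z, Φ (x * z) = x * Φ z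
  apply_of_mem : ∀ y ∈ loc a b, Φ y = f y • 1
  mul_mid : ∀ x ∈ loc a bᶜ, ∀ y ∈ loc a b, ∀ z ∈ loc a bᶜ, Φ (x * y * z) = f y • (x * z)
  mem : ∀ W z, z ∈ loc a W → Φ z ∈ loc a (W \ b)
  parity : ∀ z, Φ (Θ z) = Θ (Φ z)
  map_one : Φ 1 = 1

theorem IsSlice.norm_le {Θ : A ≃⋆ₐ[ℂ] A} {b : Set I} {f : A →ₗ[ℂ] ℂ} {Φ : A →L[ℂ] A}
    (h : IsSlice a Θ b f Φ) (x : A) : ‖Φ x‖ ≤ ‖x‖ :=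
  h.cp.norm_le h.map_one x

theorem IsSlice.apply_of_mem_compl {Θ : A ≃⋆ₐ[ℂ] A} {b : Set I} {f : A →ₗ[ℂ] ℂ} {Φ : A →L[ℂ] A}
    (h : IsSlice a Θ b f Φ) {x : A} (hx : x ∈ loc a bᶜ) : Φ x = x := by
  simpa [h.map_one] using h.mul_left x hx 1

theorem IsEvenStateOn.odd {Θ : A ≃⋆ₐ[ℂ] A} {b : Set I} {f : A →ₗ[ℂ] ℂ}
    (h : IsEvenStateOn a Θ b f) {x : A} (hx : x ∈ loc a b) (ho : Θ x = -x) : f x = 0 := by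
  have := h.even x hx
  rw [ho, map_neg] at this
  exact self_eq_neg.1 this.symm

theorem IsEvenStateOn.posSemidef {Θ : A ≃⋆ₐ[ℂ] A} {b : Set I} {f : A →ₗ[ℂ] ℂ}
    (h : IsEvenStateOn a Θ b f) {ι : Type} [Fintype ι] {e : ι → A} (he : ∀ k, e k ∈ loc a b) :
    (Matrix.of fun k l => f (star (e k) * e l)).PosSemidef := by
  have hs : ∀ x ∈ loc a b, f (star x) = star (f x) := by
    intro x hx
    exact map_star_of_nonneg (φ := f ∘ₗ (loc a b).subtype.toAlgHom.toLinearMap)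
      (fun y => h.nonneg y y.2) ⟨x, hx⟩
  rw [Matrix.posSemidef_iff_dotProduct_mulVec]
  refine ⟨?_, fun v => ?_⟩
  · ext k l
    simp only [Matrix.conjTranspose_apply, Matrix.of_apply]
    rw [← hs _ (mul_mem (star_mem (he l)) (he k)), star_mul, star_star]
  · have hm : ∑ k, v k • e k ∈ loc a b := sum_mem fun k _ => (loc a b).smul_mem (he k) _
    have := h.nonneg _ hm
    convert this using 1
    simp only [star_sum, star_smul, Finset.sum_mul, Finset.mul_sum, map_sum, smul_mul_assoc,
      mul_smul_comm, map_smul, dotProduct, Matrix.mulVec, Matrix.of_apply, Pi.star_apply,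
      smul_eq_mul]
    rw [Finset.sum_comm]
    refine Finset.sum_congr rfl fun k _ => Finset.sum_congr rfl fun l _ => ?_
    ring

/-- Expand z as ∑ c_k e_k in a homogeneous frame of 𝔄_b and replace each e_k by f(e_k). Complete
positivity comes from a Stinespring form Φ(x⁺y) = ∑ V_s(x)⁺ V_s(y), obtained by splitting the Gram
matrix f(e_k⁺ e_l) into rank-one pieces. The parity twists produced by moving coefficients past e_k⁺
are consistent because f vanishes on odd elements. -/
theorem IsCAR.exists_slice (ha : IsCAR a) {Θ : A ≃⋆ₐ[ℂ] A} (hΘ : IsParity a Θ) {b : Set I}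
    (hb : b.Finite) {f : A →ₗ[ℂ] ℂ} (hf : IsEvenStateOn a Θ b f) :
    ∃ Φ, IsSlice a Θ b f Φ := by
  obtain ⟨F⟩ := ha.exists_frame hΘ hb
  let Φ : A →L[ℂ] A := ∑ k, f (F.e k) • F.coeff k
  have hΦ : ∀ z, Φ z = ∑ k, f (F.e k) • F.coeff k z := fun z => by
    simp [Φ]
  have hmem : ∀ W z, z ∈ loc a W → Φ z ∈ loc a (W \ b) := by
    intro W z hz
    rw [hΦ]
    exact sum_mem fun k _ => (loc a _).smul_mem (F.coeff_mem W z hz k) _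
  have hleft : ∀ x ∈ loc a bᶜ, ∀ z, Φ (x * z) = x * Φ z := by
    intro x hx z
    rw [hΦ, hΦ, Finset.mul_sum]
    refine Finset.sum_congr rfl fun k _ => ?_
    rw [F.coeff_mul x hx, mul_smul_comm]
  have happ : ∀ y ∈ loc a b, Φ y = f y • 1 := by
    intro y hy
    -- For y over b the coefficients lie over b \ b = ∅, hence are scalars.
    have hc : ∀ k, ∃ c : ℂ, F.coeff k y = c • (1 : A) := fun k => by
      have := F.coeff_mem b y hy k
      rw [Set.sdiff_self] at this
      exact mem_loc_empty this
    choose c hc using hc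
    conv_rhs => rw [← F.sum_coeff y]
    rw [hΦ, map_sum, Finset.sum_smul]
    refine Finset.sum_congr rfl fun k _ => ?_
    rw [hc, smul_mul_assoc, one_mul, map_smul, smul_smul, smul_eq_mul, mul_comm]
  have hcoeff : ∀ k z, F.coeff k z ∈ loc a bᶜ := fun k z => by
    have := F.coeff_mem Set.univ z (ha.mem_loc_univ z) k
    rwa [← Set.compl_eq_univ_sdiff] at this
  have hdisj : Disjoint b bᶜ := disjoint_compl_right
  have hmid : ∀ x ∈ loc a bᶜ, ∀ y ∈ loc a b, ∀ z ∈ loc a bᶜ, Φ (x * y * z) = f y • (x * z) := by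
    intro x hx y hy z hz
    have hΘy := hΘ.mem_loc hy
    have hΘz := hΘ.mem_loc hz
    have e1 := ha.graded hΘ hdisj hy hΘz
    have e2 := ha.graded hΘ hdisj hy hz
    rw [ha.parity_parity hΘ] at e1
    -- Twice the graded commutation: z passes the even part of y unchanged and the odd part as Θ z.
    -- Since f kills y - Θ y, only the first term survives below.
    have e3 : (2 : ℂ) • (y * z) = z * (y + Θ y) + Θ z * (y - Θ y) := by
      have e4 := ha.graded hΘ hdisj hΘy hz
      have e5 := ha.graded hΘ hdisj hΘy hΘz
      rw [ha.parity_parity hΘ] at e4 e5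
      rw [ha.parity_parity hΘ] at e5
      have h2 : (2 : ℂ) ≠ 0 := two_ne_zero
      apply smul_right_injective A h2
      change (2 : ℂ) • _ = (2 : ℂ) • _
      rw [smul_add, mul_add, mul_sub, smul_add, smul_sub, ← e1, ← e2, ← e4, ← e5]
      simp only [two_smul, add_mul, sub_mul]
      abel
    have e6 : (2 : ℂ) • Φ (x * y * z) = (2 : ℂ) • (f y • (x * z)) := by
      rw [← map_smul, mul_assoc, ← mul_smul_comm, e3, mul_add, ← mul_assoc, ← mul_assoc, map_add,
        hleft _ (mul_mem hx hz), hleft _ (mul_mem hx hΘz), happ _ (add_mem hy hΘy),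
        happ _ (sub_mem hy hΘy), map_add, map_sub, hf.even y hy]
      simp [← two_smul ℂ, smul_smul]
    exact smul_right_injective A (two_ne_zero : (2 : ℂ) ≠ 0) e6
  have hone : Φ 1 = 1 := by rw [happ 1 (one_mem _), hf.map_one, one_smul]
  refine ⟨Φ, ?_, hleft, happ, hmid, hmem, ?_, hone⟩
  -- The twist that an element off b undergoes when it passes e_k: trivial for even e_k, and Θ for
  -- odd e_k.
  · let tw : F.ι → A → A := fun k x => if Θ (F.e k) = F.e k then x else Θ x
    have htw : ∀ k, ∀ x ∈ loc a bᶜ, star (F.e k) * x = tw k x * star (F.e k) := by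
      intro k x hx
      have hek := star_mem (F.e_mem k)
      by_cases hk : Θ (F.e k) = F.e k
      · simp only [tw, if_pos hk]
        exact ha.even_commute hΘ hdisj hek hx (by rw [map_star, hk])
      · simp only [tw, if_neg hk]
        have hk' := (F.homogeneous k).resolve_left hk
        have := ha.odd_commute hΘ hdisj hek (hΘ.mem_loc hx) (by rw [map_star, hk', star_neg])
        rwa [ha.parity_parity hΘ] at this
    have htwmem : ∀ k x, x ∈ loc a bᶜ → tw k x ∈ loc a bᶜ := by
      intro k x hx
      simp only [tw]
      split_ifs
      exacts [hx, hΘ.mem_loc hx]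
    have htwmul : ∀ k x y, tw k (x * y) = tw k x * tw k y := by
      intro k x y
      simp only [tw]
      split_ifs <;> simp
    have htwstar : ∀ k x, tw k (star x) = star (tw k x) := by
      intro k x
      simp only [tw]
      split_ifs
      exacts [rfl, map_star Θ x]
    -- A nonzero Gram entry forces e_k and e_l to have the same parity, so both coefficients carry
    -- the same twist.
    have hpar : ∀ k l x, f (star (F.e k) * F.e l) ≠ 0 → tw k x = tw l x := by
      intro k l x hkl
      have hm := mul_mem (star_mem (F.e_mem k)) (F.e_mem l)
      by_cases hk : Θ (F.e k) = F.e k <;> by_cases hl : Θ (F.e l) = F.e l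
      · simp only [tw, if_pos hk, if_pos hl]
      · have hl' := (F.homogeneous l).resolve_left hl
        exact absurd (hf.odd hm (by rw [map_mul, map_star, hk, hl', mul_neg])) hkl
      · have hk' := (F.homogeneous k).resolve_left hk
        exact absurd (hf.odd hm (by rw [map_mul, map_star, hk', hl, star_neg, neg_mul])) hkl
      · simp only [tw, if_neg hk, if_neg hl]
    obtain ⟨r, v, hv⟩ := Matrix.posSemidef_iff_eq_sum_vecMulVec.1 (hf.posSemidef F.e_mem)
    have hv' : ∀ k l, f (star (F.e k) * F.e l) = ∑ s, v s k * star (v s l) := by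
      intro k l
      have := congrFun (congrFun hv k) l
      simpa [Matrix.sum_apply, Matrix.vecMulVec_apply] using this
    have key : ∀ x y : A, Φ (star x * y) =
        ∑ s, star (∑ k, star (v s k) • tw k (F.coeff k x)) *
          ∑ l, star (v s l) • tw l (F.coeff l y) := by
      intro x y
      have e1 : Φ (star x * y) = ∑ k, ∑ l, f (star (F.e k) * F.e l) •
          (star (tw k (F.coeff k x)) * tw l (F.coeff l y)) := by
        conv_lhs => rw [← F.sum_coeff x, ← F.sum_coeff y]
        rw [star_sum, Finset.sum_mul_sum, map_sum]
        refine Finset.sum_congr rfl fun k _ => ?_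
        rw [map_sum]
        refine Finset.sum_congr rfl fun l _ => ?_
        have hm := mul_mem (star_mem (hcoeff k x)) (hcoeff l y)
        have : star (F.coeff k x * F.e k) * (F.coeff l y * F.e l) =
            tw k (star (F.coeff k x) * F.coeff l y) * (star (F.e k) * F.e l) := by
          rw [star_mul, ← mul_assoc (tw k _), ← htw k _ hm]
          simp only [mul_assoc]
        rw [this, hleft _ (htwmem k _ hm), happ _ (mul_mem (star_mem (F.e_mem k)) (F.e_mem l)),
          mul_smul_comm, mul_one, htwmul, htwstar]
        by_cases hkl : f (star (F.e k) * F.e l) = 0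
        · rw [hkl, zero_smul, zero_smul]
        · rw [hpar k l (F.coeff l y) hkl]
      rw [e1]
      simp only [hv', Finset.sum_smul, star_sum, Finset.sum_mul_sum, star_smul, star_star,
        smul_mul_assoc, mul_smul_comm, smul_smul]
      symm
      rw [Finset.sum_comm]
      refine Finset.sum_congr rfl fun k _ => ?_
      rw [Finset.sum_comm]
      refine Finset.sum_congr rfl fun l _ => Finset.sum_congr rfl fun t _ => ?_
      rw [mul_comm]
    intro m x y
    have : ∑ i, ∑ j, star (y i) * Φ (star (x i) * x j) * y j =
        ∑ s, star (∑ i, (∑ k, star (v s k) • tw k (F.coeff k (x i))) * y i) *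
          ∑ i, (∑ k, star (v s k) • tw k (F.coeff k (x i))) * y i := by
      simp only [key]
      have hgen : ∀ X : Fin r → Fin m → A,
          ∑ i, ∑ j, star (y i) * (∑ t, star (X t i) * X t j) * y j =
            ∑ t, star (∑ i, X t i * y i) * ∑ i, X t i * y i := by
        intro X
        simp only [star_sum, Finset.sum_mul_sum, Finset.mul_sum, Finset.sum_mul]
        rw [Finset.sum_comm]
        symm
        rw [Finset.sum_comm]
        refine Finset.sum_congr rfl fun i _ => ?_
        rw [Finset.sum_comm]
        refine Finset.sum_congr rfl fun j _ => Finset.sum_congr rfl fun t _ => ?_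
        rw [star_mul]
        simp only [mul_assoc]
      exact hgen fun t i => ∑ k, star (v t k) • tw k (F.coeff k (x i))
    rw [this]
    exact Finset.sum_nonneg fun s _ => star_mul_self_nonneg _
  · intro z
    conv_lhs => rw [← F.sum_coeff z]
    rw [map_sum, map_sum, hΦ, map_sum]
    refine Finset.sum_congr rfl fun k _ => ?_
    rw [map_mul, hleft _ (hΘ.mem_loc (hcoeff k z)), happ _ (hΘ.mem_loc (F.e_mem k)),
      hf.even _ (F.e_mem k), mul_smul_comm, mul_one, map_smul]

end Slice

/-! ### Words over cells, infinite tensor products, product states -/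

section Words

variable {I A J : Type*} [CStarAlgebra A] {a : I → A}

/-- A partition of the index set into finite cells. -/
structure IsPartition (supp : J → Set I) : Prop where
  disjoint : Pairwise (Function.onFun Disjoint supp)
  finite : ∀ c, (supp c).Finite
  cover : ∀ j, ∃ c, j ∈ supp c

/-- The ordered product of the elements `x c`, `c ∈ L`. -/
noncomputable def word (L : List J) (x : J → A) : A := (L.map x).prod

theorem word_mem {supp : J → Set I} {W : Set I} {L : List J} {x : J → A}
    (hx : ∀ c, x c ∈ loc a (supp c)) (hL : ∀ c ∈ L, supp c ⊆ W) : word L x ∈ loc a W := by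
  refine list_prod_mem fun y hy => ?_
  obtain ⟨c, hc, rfl⟩ := List.mem_map.1 hy
  exact loc_mono (hL c hc) (hx c)

/-- Induction on the number of cells: a frame of the new cell writes z as a finite sum of
coefficients over the old cells times frame elements, and these become the last letters of the
words. Finiteness of the cells makes a closure unnecessary. -/
theorem IsCAR.mem_span_words (ha : IsCAR a) {Θ : A ≃⋆ₐ[ℂ] A} (hΘ : IsParity a Θ) {supp : J → Set I}
    (hs : IsPartition supp) (s : Finset J) {z : A} (hz : z ∈ loc a (⋃ c ∈ s, supp c)) :
    z ∈ Submodule.span ℂ {w : A | ∃ (L : List J) (x : J → A), L.Nodup ∧ (∀ c ∈ L, c ∈ s) ∧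
      (∀ c, x c ∈ loc a (supp c)) ∧ w = word L x} := by
  induction s using Finset.induction_on generalizing z with
  | empty =>
    obtain ⟨c, rfl⟩ := mem_loc_empty (by simpa using hz)
    refine Submodule.smul_mem _ _ (Submodule.subset_span ⟨[], fun _ => 1, by simp, by simp,
      fun c => one_mem _, by simp [word]⟩)
  | @insert c s hc ih =>
    obtain ⟨F⟩ := ha.exists_frame hΘ (hs.finite c)
    rw [← F.sum_coeff z]
    refine Submodule.sum_mem _ fun k _ => ?_
    have hk : F.coeff k z ∈ loc a (⋃ c ∈ s, supp c) := by
      refine loc_mono ?_ (F.coeff_mem _ z hz k)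
      rintro j ⟨hj, hjc⟩
      simp only [Set.mem_iUnion, Finset.mem_insert] at hj ⊢
      obtain ⟨c', rfl | hc', hj'⟩ := hj
      · exact absurd hj' hjc
      · exact ⟨c', hc', hj'⟩
    have hle := ih hk
    refine Submodule.span_induction ?_ ?_ ?_ ?_ hle
    · rintro w ⟨L, x, hL, hLs, hx, rfl⟩
      have hcL : c ∉ L := fun h => hc (hLs c h)
      refine Submodule.subset_span ⟨L ++ [c], Function.update x c (F.e k), ?_, ?_, ?_, ?_⟩
      · simp [List.nodup_append, hL]
        rintro d hd rfl
        exact hcL hd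
      · intro d hd
        rcases List.mem_append.1 hd with hd | hd
        · exact Finset.mem_insert_of_mem (hLs d hd)
        · rw [List.mem_singleton.1 hd]
          exact Finset.mem_insert_self _ _
      · intro d
        by_cases hd : d = c
        · subst hd
          rw [Function.update_self]
          exact F.e_mem k
        · rw [Function.update_of_ne hd]
          exact hx d
      · rw [word, word, List.map_append, List.prod_append]
        congr 1
        · congr 1
          refine List.map_congr_left fun d hd => ?_
          rw [Function.update_of_ne]
          rintro rfl
          exact hcL hd
        · simp
    · rw [zero_mul]
      exact zero_mem _
    · intro w w' _ _ h h'
      rw [add_mul]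
      exact add_mem h h'
    · intro r w _ h
      rw [smul_mul_assoc]
      exact Submodule.smul_mem _ _ h

/-- The words over the cells contained in `W` span a dense subspace of the local algebra, if `W`
is a union of cells. -/
theorem IsCAR.mem_of_forall_word (ha : IsCAR a) {Θ : A ≃⋆ₐ[ℂ] A} (hΘ : IsParity a Θ)
    {supp : J → Set I} (hs : IsPartition supp) {W : Set I}
    (hW : ∀ j ∈ W, ∃ c, j ∈ supp c ∧ supp c ⊆ W) (M : Submodule ℂ A) (hM : IsClosed (M : Set A))
    (h : ∀ (L : List J) (x : J → A), L.Nodup → (∀ c ∈ L, supp c ⊆ W) →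
      (∀ c, x c ∈ loc a (supp c)) → word L x ∈ M) {z : A} (hz : z ∈ loc a W) : z ∈ M := by
  refine mem_of_forall_finite M hM (fun F hF z hz => ?_) hz
  choose c hc hcW using hW
  let s : Finset J := Finset.image (fun j : {j // j ∈ F} => c j.1 (hF j.2)) F.attach
  have h1 : (F : Set I) ⊆ ⋃ d ∈ s, supp d := by
    intro j hj
    simp only [Set.mem_iUnion]
    exact ⟨c j (hF hj), Finset.mem_image.2 ⟨⟨j, hj⟩, F.mem_attach _, rfl⟩, hc j (hF hj)⟩
  refine Submodule.span_le.2 ?_ (ha.mem_span_words hΘ hs s (loc_mono h1 hz))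
  rintro w ⟨L, x, hL, hLs, hx, rfl⟩
  refine h L x hL (fun d hd => ?_) hx
  obtain ⟨j, -, rfl⟩ := Finset.mem_image.1 (hLs d hd)
  exact hcW j (hF j.2)

/-- A unital contraction that acts only on the tensor factor of the region `b`. -/
structure IsLocalMap (a : I → A) (b : Set I) (T : A →L[ℂ] A) : Prop where
  norm_le : ∀ x, ‖T x‖ ≤ ‖x‖
  map_one : T 1 = 1
  mem : ∀ y ∈ loc a b, T y ∈ loc a b
  mul_mid : ∀ x ∈ loc a bᶜ, ∀ y ∈ loc a b, ∀ z ∈ loc a bᶜ, T (x * y * z) = x * T y * z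

theorem IsLocalMap.apply_of_mem_compl {b : Set I} {T : A →L[ℂ] A} (h : IsLocalMap a b T) {x : A}
    (hx : x ∈ loc a bᶜ) : T x = x := by
  simpa [h.map_one] using h.mul_mid x hx 1 (one_mem _) 1 (one_mem _)

theorem isLocalMap_one (b : Set I) : IsLocalMap a b (1 : A →L[ℂ] A) := by
  constructor <;> simp

/-- The cells before and after c are disjoint from it, so `mul_mid` isolates the single letter at c;
if c is not a letter, the whole word lies off c and is fixed. -/
theorem IsLocalMap.apply_word [DecidableEq J] {supp : J → Set I}
    (hd : Pairwise (Function.onFun Disjoint supp))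
    {c : J} {T : A →L[ℂ] A} (h : IsLocalMap a (supp c) T) {L : List J} (hL : L.Nodup) {x : J → A}
    (hx : ∀ c, x c ∈ loc a (supp c)) :
    T (word L x) = word L (Function.update x c (T (x c))) := by
  have hsub : ∀ d, d ≠ c → supp d ⊆ (supp c)ᶜ := fun d hdc =>
    Set.disjoint_left.1 (hd hdc)
  have hupd : ∀ L : List J, c ∉ L → word L (Function.update x c (T (x c))) = word L x := by
    intro L hc
    rw [word, word]
    congr 1
    refine List.map_congr_left fun d hd => Function.update_of_ne ?_ _ _
    rintro rfl
    exact hc hd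
  have hmem : ∀ L : List J, c ∉ L → word L x ∈ loc a (supp c)ᶜ := fun L hc =>
    word_mem hx fun d hd => hsub d fun hdc => hc (hdc ▸ hd)
  by_cases hc : c ∈ L
  · obtain ⟨L₁, L₂, rfl⟩ := List.append_of_mem hc
    have h1 : c ∉ L₁ := fun h1 => by
      have := (List.nodup_append.1 hL).2.2 c h1 c (by simp)
      exact this rfl
    have h2 : c ∉ L₂ := (List.nodup_cons.1 (List.nodup_append.1 hL).2.1).1
    have e : ∀ y : J → A, word (L₁ ++ c :: L₂) y = word L₁ y * y c * word L₂ y := by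
      intro y
      simp [word, mul_assoc]
    rw [e, e, hupd _ h1, hupd _ h2, Function.update_self,
      h.mul_mid _ (hmem _ h1) _ (hx c) _ (hmem _ h2)]
  · rw [hupd L hc, h.apply_of_mem_compl (hmem L hc)]

theorem seqOf_of_forall_ne (T : J → A →L[ℂ] A) {f : J → ℕ} {n : ℕ} (h : ∀ c, f c ≠ n) :
    seqOf T f n = 1 :=
  dif_neg fun ⟨c, hc⟩ => h c hc

theorem seqComp_word {supp : J → Set I} (hd : Pairwise (Function.onFun Disjoint supp))
    {T : J → A →L[ℂ] A} (hT : ∀ c, IsLocalMap a (supp c) (T c)) {f : J → ℕ} (hf : f.Injective)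
    (N : ℕ) {L : List J} (hL : L.Nodup) {x : J → A} (hx : ∀ c, x c ∈ loc a (supp c)) :
    seqComp (seqOf T f) N (word L x) = word L fun c => if f c < N then T c (x c) else x c := by
  induction N generalizing x with
  | zero => simp [seqComp]
  | succ N ih =>
    change seqComp (seqOf T f) N (seqOf T f N (word L x)) = _
    by_cases h : ∃ c, f c = N
    · obtain ⟨c, rfl⟩ := h
      rw [seqOf_apply T hf, (hT c).apply_word hd hL hx, ih]
      · congr 1
        ext d
        by_cases hdc : d = c
        · subst hdc
          simp
        · have : f d ≠ f c := fun h => hdc (hf h)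
          rw [Function.update_of_ne hdc]
          congr 1
          exact propext ⟨fun h => by omega, fun h => by omega⟩
      · intro d
        by_cases hdc : d = c
        · subst hdc
          rw [Function.update_self]
          exact (hT d).mem _ (hx d)
        · rw [Function.update_of_ne hdc]
          exact hx d
    · push Not at h
      rw [seqOf_of_forall_ne T h, one_apply_eq_self, ih hx]
      congr 1
      ext d
      have := h d
      congr 1
      exact propext ⟨fun h => by omega, fun h => by omega⟩

/-- The infinite tensor product of local maps over disjoint cells. -/
theorem IsCAR.exists_tensor (ha : IsCAR a) {supp : J → Set I}
    (hd : Pairwise (Function.onFun Disjoint supp))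
    {T : J → A →L[ℂ] A} (hT : ∀ c, IsLocalMap a (supp c) (T c)) {f : J → ℕ} (hf : f.Injective) :
    ∃ S : A →L[ℂ] A, (∀ x, Tendsto (fun N => seqComp (seqOf T f) N x) atTop (𝓝 (S x))) ∧
      ∀ (L : List J) (x : J → A), L.Nodup → (∀ c, x c ∈ loc a (supp c)) →
        S (word L x) = word L fun c => T c (x c) := by
  obtain ⟨S, hS⟩ := ha.exists_limit hd (fun c => (hT c).norm_le)
    (fun c x hx => (hT c).apply_of_mem_compl hx) f
  refine ⟨S, hS, fun L x hL hx => tendsto_nhds_unique (hS _) (tendsto_const_nhds.congr' ?_)⟩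
  obtain ⟨N, hN⟩ := ((L.toFinset.finite_toSet).image f).bddAbove
  filter_upwards [eventually_gt_atTop N] with n hn
  rw [seqComp_word hd hT hf n hL hx, word, word]
  congr 1
  refine List.map_congr_left fun c hc => ?_
  rw [if_pos]
  exact (hN (Set.mem_image_of_mem f (by simpa using hc))).trans_lt hn

theorem IsSlice.isLocalMap {Θ : A ≃⋆ₐ[ℂ] A} {b : Set I} {f : A →ₗ[ℂ] ℂ} {Φ : A →L[ℂ] A}
    (h : IsSlice a Θ b f Φ) : IsLocalMap a b Φ where
  norm_le := h.norm_le
  map_one := h.map_one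
  mem y hy := by
    rw [h.apply_of_mem y hy]
    exact (loc a b).smul_mem (one_mem _) _
  mul_mid x hx y hy z hz := by
    rw [h.mul_mid x hx y hy z hz, h.apply_of_mem y hy, mul_smul_comm, mul_one, smul_mul_assoc]

theorem nonneg_of_smul_one_nonneg [Nontrivial A] {c : ℂ} (h : 0 ≤ c • (1 : A)) : 0 ≤ c := by
  refine spectrum_nonneg_of_nonneg h ?_
  rw [← Algebra.algebraMap_eq_smul_one, spectrum.scalar_eq]
  rfl

theorem word_smul_one (L : List J) (g : J → ℂ) :
    word L (fun c => g c • (1 : A)) = (L.map g).prod • (1 : A) := by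
  induction L with
  | nil => simp [word]
  | cons c L ih =>
    rw [word, List.map_cons, List.prod_cons, ← word, ih, List.map_cons, List.prod_cons,
      smul_mul_assoc, one_mul, smul_smul]

/-- The product state of even states on the cells. -/
theorem IsCAR.exists_prodState [Nontrivial A] (ha : IsCAR a) {Θ : A ≃⋆ₐ[ℂ] A} (hΘ : IsParity a Θ)
    [Countable J] {supp : J → Set I} (hs : IsPartition supp) {g : J → A →ₗ[ℂ] ℂ}
    (hg : ∀ c, IsEvenStateOn a Θ (supp c) (g c)) :
    ∃ χ : A →ₗ[ℂ] ℂ, IsState χ ∧ ∀ (L : List J) (x : J → A), L.Nodup →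
      (∀ c, x c ∈ loc a (supp c)) → χ (word L x) = (L.map fun c => g c (x c)).prod := by
  obtain ⟨f, hf⟩ := exists_injective_nat J
  choose T hT using fun c => ha.exists_slice hΘ (hs.finite c) (hg c)
  obtain ⟨S, hS, hw⟩ := ha.exists_tensor hs.disjoint (fun c => (hT c).isLocalMap) hf
  have hw' : ∀ (L : List J) (x : J → A), L.Nodup → (∀ c, x c ∈ loc a (supp c)) →
      S (word L x) = (L.map fun c => g c (x c)).prod • (1 : A) := by
    intro L x hL hx
    rw [hw L x hL hx, ← word_smul_one]
    congr 1
    ext c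
    exact (hT c).apply_of_mem _ (hx c)
  -- The limit S takes values in the scalar multiples of 1; any continuous functional with l(1) = 1
  -- reads off the scalar.
  obtain ⟨l, hl⟩ := SeparatingDual.exists_eq_one (R := ℂ) (one_ne_zero (α := A))
  have hS1 : ∀ x, S x = l (S x) • (1 : A) := by
    intro x
    let M : Submodule ℂ A := LinearMap.eqLocus (S : A →ₗ[ℂ] A)
      ((l : A →ₗ[ℂ] ℂ).smulRight (1 : A) ∘ₗ (S : A →ₗ[ℂ] A))
    have hM : IsClosed (M : Set A) :=
      isClosed_eq S.continuous ((l.continuous.comp S.continuous).smul continuous_const)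
    refine ha.mem_of_forall_word hΘ hs (W := Set.univ) ?_ M hM ?_ (ha.mem_loc_univ x)
    · intro j _
      obtain ⟨c, hc⟩ := hs.cover j
      exact ⟨c, hc, Set.subset_univ _⟩
    · intro L x hL _ hx
      change S (word L x) = l (S (word L x)) • (1 : A)
      rw [hw' L x hL hx, map_smul, hl, smul_eq_mul, mul_one]
  -- Positivity of the finite composites is enough, since it passes to pointwise limits.
  have hpos : ∀ N x, 0 ≤ x → 0 ≤ seqComp (seqOf T f) N x := by
    intro N
    induction N with
    | zero => intro x hx; simpa [seqComp] using hx
    | succ N ih =>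
      intro x hx
      refine ih _ ?_
      rcases seqOf_cases T f N with h | ⟨c, -, h⟩
      · simpa [h] using hx
      · obtain ⟨w, rfl⟩ := CStarAlgebra.nonneg_iff_eq_star_mul_self.1 hx
        rw [h]
        exact (hT c).cp.nonneg w
  refine ⟨(l : A →ₗ[ℂ] ℂ) ∘ₗ (S : A →ₗ[ℂ] A), ⟨?_, fun x => ?_⟩, fun L x hL hx => ?_⟩
  · have := hw [] (fun _ => 1) (by simp) (fun _ => one_mem _)
    simp only [word, List.map_nil, List.prod_nil] at this
    simp [this, hl]
  · refine nonneg_of_smul_one_nonneg (A := A) ?_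
    change 0 ≤ l (S _) • (1 : A)
    rw [← hS1]
    exact ge_of_tendsto' (hS _) fun N => hpos N _ (star_mul_self_nonneg x)
  · change l (S (word L x)) = _
    rw [hw' L x hL hx, map_smul, hl, smul_eq_mul, mul_one]

end Words

/-! ### Matrix units at a site and its trace -/

section SiteTrace

variable {I A : Type*} [CStarAlgebra A] {a : I → A}

theorem siteTrace_mul_comm (n : I) (x y : loc a {n}) :
    siteTrace a n (x * y) = siteTrace a n (y * x) := by
  rw [siteTrace, siteTrace, LinearMap.mulLeft_mul, LinearMap.mulLeft_mul]
  congr 1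
  exact LinearMap.trace_mul_comm ℂ _ _

theorem siteTrace_add (n : I) (x y : loc a {n}) :
    siteTrace a n (x + y) = siteTrace a n x + siteTrace a n y := by
  have : LinearMap.mulLeft ℂ (x + y) = LinearMap.mulLeft ℂ x + LinearMap.mulLeft ℂ y := by
    ext z
    simp [add_mul]
  rw [siteTrace, siteTrace, siteTrace, this, map_add, add_div]

theorem siteTrace_smul (n : I) (r : ℂ) (x : loc a {n}) :
    siteTrace a n (r • x) = r * siteTrace a n x := by
  have : LinearMap.mulLeft ℂ (r • x) = r • LinearMap.mulLeft ℂ x := by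
    ext z
    simp
  rw [siteTrace, siteTrace, this, map_smul, smul_eq_mul, mul_div_assoc]

theorem IsCAR.gen_ne_zero [Nontrivial A] (ha : IsCAR a) (n : I) : a n ≠ 0 := by
  intro h
  have := ha.anti_add n
  rw [h] at this
  simp at this

/-- The matrix units as elements of the site algebra. -/
noncomputable def siteUnit (a : I → A) (n : I) : Fin 4 → loc a {n} :=
  ![siteProj a n 0, ⟨a n, gen_mem_loc a rfl⟩, star ⟨a n, gen_mem_loc a rfl⟩, siteProj a n 1]

theorem IsCAR.exists_coeff (ha : IsCAR a) {Θ : A ≃⋆ₐ[ℂ] A} (hΘ : IsParity a Θ) (n : I)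
    (x : loc a {n}) : ∃ c : Fin 4 → ℂ, x = ∑ k, c k • siteUnit a n k := by
  let F := siteFrame ha hΘ n
  have hc : ∀ k, ∃ c : ℂ, F.coeff k x = c • (1 : A) := fun k => by
    have := F.coeff_mem {n} x x.2 k
    rw [Set.sdiff_self] at this
    exact mem_loc_empty this
  choose c hc using hc
  refine ⟨c, Subtype.ext ?_⟩
  rw [← F.sum_coeff (x : A), AddSubmonoidClass.coe_finsetSum]
  refine Finset.sum_congr rfl fun k _ => ?_
  rw [hc, smul_mul_assoc, one_mul]
  change c k • F.e k = c k • (siteUnit a n k : A)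
  congr 1
  fin_cases k <;> rfl

theorem IsCAR.proj_mul_self (ha : IsCAR a) (n : I) (i : Fin 2) :
    proj a n i * proj a n i = proj a n i := by
  obtain ⟨h1, h2, h3, h4, h5, h6, h7, h8⟩ := ha.rules n 1
  fin_cases i <;> simp [proj, mul_assoc, h1, h2, h5, h6]

theorem IsCAR.proj_mul_of_ne (ha : IsCAR a) (n : I) {i k : Fin 2} (h : i ≠ k) :
    proj a n i * proj a n k = 0 := by
  obtain ⟨h1, h2, h3, h4, h5, h6, h7, h8⟩ := ha.rules n (star (a n))
  obtain ⟨-, -, h3', h4', -, -, -, -⟩ := ha.rules n (a n)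
  fin_cases i <;> fin_cases k <;> simp [proj, mul_assoc, h1, h2, h3, h4, h3', h4'] at h ⊢

theorem star_proj (n : I) (i : Fin 2) : star (proj a n i) = proj a n i := by
  fin_cases i <;> simp [proj]

theorem IsCAR.sum_proj (ha : IsCAR a) (n : I) : ∑ i, proj a n i = 1 := by
  rw [Fin.sum_univ_two, ← ha.anti_add n, add_comm]
  rfl

theorem IsCAR.proj_ne_zero [Nontrivial A] (ha : IsCAR a) (n : I) (i : Fin 2) :
    proj a n i ≠ 0 := by
  intro h
  refine ha.gen_ne_zero n ?_
  rw [← ha.a_star_a n]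
  fin_cases i
  · have h : a n * star (a n) = 0 := h
    rw [h, zero_mul]
  · have h : star (a n) * a n = 0 := h
    rw [mul_assoc, h, mul_zero]

/-- Multiplication by matrix units on both sides leaves one coefficient times a nonzero element. -/
theorem IsCAR.linearIndependent_siteUnit [Nontrivial A] (ha : IsCAR a) (n : I) :
    LinearIndependent ℂ (siteUnit a n) := by
  rw [Fintype.linearIndependent_iff]
  intro g hg
  have hg' : g 0 • (a n * star (a n)) + g 1 • a n + g 2 • star (a n) + g 3 • (star (a n) * a n) =
      0 := by
    have := congrArg (Subtype.val) hg
    rw [Fin.sum_univ_four] at this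
    exact this
  obtain ⟨h1, h2, -, -, h5, h6, -, -⟩ := ha.rules n 1
  have h3 := fun x => (ha.rules n x).2.2.1
  have h4 := fun x => (ha.rules n x).2.2.2.1
  have h7 := fun x => (ha.rules n x).2.2.2.2.2.2.1
  have h8 := fun x => (ha.rules n x).2.2.2.2.2.2.2
  have hne := ha.gen_ne_zero n
  have e0 := congrArg (fun z => star (a n) * (z * (a n * star (a n)))) hg'
  have e1 := congrArg (fun z => star (a n) * (z * (star (a n) * a n))) hg'
  have e2 := congrArg (fun z => a n * (z * (a n * star (a n)))) hg'
  have e3 := congrArg (fun z => a n * (z * (star (a n) * a n))) hg'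
  simp [add_mul, mul_add, mul_assoc, h1, h2, h3, h4, h5, h6, h7, h8, hne] at e0 e1 e2 e3
  intro k
  fin_cases k
  exacts [e0, e1, e2, e3]

/-- The site algebra has dimension four, and the trace of the regular representation is halved. -/
theorem IsCAR.siteTrace_one [Nontrivial A] (ha : IsCAR a) {Θ : A ≃⋆ₐ[ℂ] A} (hΘ : IsParity a Θ)
    (n : I) : siteTrace a n 1 = 2 := by
  have hspan : ⊤ ≤ Submodule.span ℂ (Set.range (siteUnit a n)) := by
    intro x _
    obtain ⟨c, hc⟩ := ha.exists_coeff hΘ n x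
    rw [hc]
    exact Submodule.sum_mem _ fun k _ =>
      Submodule.smul_mem _ _ (Submodule.subset_span (Set.mem_range_self k))
  let B := Module.Basis.mk (ha.linearIndependent_siteUnit n) hspan
  have : Module.Finite ℂ (loc a {n}) := Module.Finite.of_basis B
  rw [siteTrace, LinearMap.mulLeft_one, LinearMap.trace_id, Module.finrank_eq_card_basis B]
  norm_num

/-- By cyclicity a a⁺ and a⁺ a have the same trace, and they add up to 1, whose trace is 2. -/
theorem IsCAR.siteTrace_proj [Nontrivial A] (ha : IsCAR a) {Θ : A ≃⋆ₐ[ℂ] A} (hΘ : IsParity a Θ)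
    (n : I) (i : Fin 2) : siteTrace a n (siteProj a n i) = 1 := by
  have h1 : siteTrace a n (siteProj a n 0) = siteTrace a n (siteProj a n 1) :=
    siteTrace_mul_comm n ⟨a n, gen_mem_loc a rfl⟩ (star ⟨a n, gen_mem_loc a rfl⟩)
  have h2 : siteProj a n 0 + siteProj a n 1 = 1 := by
    have := ha.sum_proj n
    rw [Fin.sum_univ_two] at this
    exact Subtype.ext this
  have h3 := siteTrace_add n (siteProj a n 0) (siteProj a n 1)
  rw [h2, ha.siteTrace_one hΘ, h1] at h3
  have h4 : siteTrace a n (siteProj a n 1) = 1 := by linear_combination -h3 / 2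
  fin_cases i
  · exact h1.trans h4
  · exact h4

/-- The projections are minimal, so the compression is a scalar multiple of the projection; taking
the trace identifies the scalar. -/
theorem IsCAR.proj_mul_mul_proj [Nontrivial A] (ha : IsCAR a) {Θ : A ≃⋆ₐ[ℂ] A} (hΘ : IsParity a Θ)
    (n : I) (i : Fin 2) (x : loc a {n}) :
    proj a n i * x * proj a n i = siteTrace a n (x * siteProj a n i) • proj a n i := by
  have hex : ∃ r : ℂ, proj a n i * x * proj a n i = r • proj a n i := by
    obtain ⟨c, hc⟩ := ha.exists_coeff hΘ n x
    obtain ⟨h1, h2, -, -, h5, h6, -, -⟩ := ha.rules n 1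
    have h3 := fun x => (ha.rules n x).2.2.1
    have h4 := fun x => (ha.rules n x).2.2.2.1
    have h7 := fun x => (ha.rules n x).2.2.2.2.2.2.1
    have h8 := fun x => (ha.rules n x).2.2.2.2.2.2.2
    have hx : (x : A) = c 0 • (a n * star (a n)) + c 1 • a n + c 2 • star (a n) +
        c 3 • (star (a n) * a n) := by
      rw [hc, Fin.sum_univ_four]
      rfl
    fin_cases i
    · refine ⟨c 0, ?_⟩
      simp [hx, proj, mul_add, add_mul, mul_assoc, h1, h2, h3, h4, h5, h6, h7, h8]
    · refine ⟨c 3, ?_⟩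
      simp [hx, proj, mul_add, add_mul, mul_assoc, h1, h2, h3, h4, h5, h6, h7, h8]
  obtain ⟨r, hr⟩ := hex
  have hP : siteProj a n i * siteProj a n i = siteProj a n i := Subtype.ext (ha.proj_mul_self n i)
  have hr' : siteProj a n i * x * siteProj a n i = r • siteProj a n i := Subtype.ext hr
  have := congrArg (siteTrace a n) hr'
  rw [siteTrace_mul_comm, ← mul_assoc, hP, siteTrace_mul_comm, siteTrace_smul,
    ha.siteTrace_proj hΘ, mul_one] at this
  rw [hr, this]

end SiteTrace

/-! ### The partition of the chain into blocks and sites of Γ -/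

section Cells

variable {I : Type*} [LinearOrder I] [SuccOrder I]

/-- The cells: the blocks of the complement of `Γ`, and the sites of `Γ`. -/
def cell (Γ D : Set I) : starts Γ D ⊕ Γ → Set I :=
  Sum.elim (fun j => block D j) (fun j => {(j : I)})

theorem IsTwoStepSet.block_subset {Γ D : Set I} (hD : IsTwoStepSet Γ D) (j : starts Γ D) :
    block D j ⊆ Γᶜ := by
  rintro i (rfl | ⟨hj, rfl⟩)
  · exact j.2.1
  · exact (hD _ hj).2.2.1

theorem IsTwoStepSet.mem_starts {Γ D : Set I} (hD : IsTwoStepSet Γ D) {j : I} (hj : j ∈ D) :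
    j ∈ starts Γ D := by
  refine ⟨(hD j hj).2.1, ?_⟩
  rintro i hi rfl
  exact (hD i hi).2.2.2 hj

/-- Two blocks that meet coincide: a start is never the right end of a two-step block, and the
successor is injective at the left ends because these are not maximal. -/
theorem IsTwoStepSet.isPartition {Γ D : Set I} (hD : IsTwoStepSet Γ D) :
    IsPartition (cell Γ D) where
  disjoint := by
    have key : ∀ j j' : starts Γ D, ∀ i, i ∈ block D j → i ∈ block D j' → j = j' := by
      rintro j j' i (rfl | ⟨hj, rfl⟩) (h | ⟨hj', h⟩)
      · exact Subtype.ext h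
      · exact absurd h.symm (j.2.2 _ hj')
      · exact absurd h (j'.2.2 _ hj)
      · exact Subtype.ext
          ((Order.succ_eq_succ_iff_of_not_isMax (hD _ hj).1 (hD _ hj').1).1 h)
    rintro (j | j) (j' | j') hne <;> refine Set.disjoint_left.2 fun i hi hi' => ?_
    · exact hne (congrArg _ (key j j' i hi hi'))
    · have hi' : i = j' := hi'
      exact hD.block_subset j hi (hi' ▸ j'.2)
    · have hi : i = j := hi
      exact hD.block_subset j' hi' (hi ▸ j.2)
    · have hi : i = j := hi
      have hi' : i = j' := hi'
      exact hne (congrArg _ (Subtype.ext (hi.symm.trans hi')))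
  finite := by
    rintro (j | j)
    · refine Set.Finite.subset (Set.toFinite {(j : I), Order.succ (j : I)}) ?_
      rintro i (rfl | ⟨-, rfl⟩) <;> simp
    · exact Set.finite_singleton _
  cover := by
    intro i
    by_cases hi : i ∈ Γ
    · exact ⟨Sum.inr ⟨i, hi⟩, rfl⟩
    · by_cases hs : i ∈ starts Γ D
      · exact ⟨Sum.inl ⟨i, hs⟩, Or.inl rfl⟩
      · have : ∃ k ∈ D, Order.succ k = i := by
          by_contra h
          push Not at h
          exact hs ⟨hi, h⟩
        obtain ⟨k, hk, rfl⟩ := this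
        exact ⟨Sum.inl ⟨k, hD.mem_starts hk⟩, Or.inr ⟨hk, rfl⟩⟩

end Cells

/-! ### Pure site states and pinchings -/

section Functionals

variable {I A : Type*} [CStarAlgebra A] {a : I → A}

/-- A linear extension of a functional on a local algebra. -/
noncomputable def extendL {b : Set I} (φ : loc a b →ₗ[ℂ] ℂ) : A →ₗ[ℂ] ℂ :=
  (LinearMap.exists_extend (p := (loc a b).toSubalgebra.toSubmodule) φ).choose

theorem extendL_apply {b : Set I} (φ : loc a b →ₗ[ℂ] ℂ) {x : A} (hx : x ∈ loc a b) :
    extendL φ x = φ ⟨x, hx⟩ := by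
  have := (LinearMap.exists_extend (p := (loc a b).toSubalgebra.toSubmodule) φ).choose_spec
  exact LinearMap.congr_fun this ⟨x, hx⟩

/-- The pure state `x ↦ Tr (x P_i)` of the site algebra. -/
noncomputable def siteState (a : I → A) (n : I) (i : Fin 2) : loc a {n} →ₗ[ℂ] ℂ where
  toFun x := siteTrace a n (x * siteProj a n i)
  map_add' x y := by rw [add_mul, siteTrace_add]
  map_smul' r x := by rw [smul_mul_assoc, siteTrace_smul]; rfl

theorem IsParity.proj {Θ : A ≃⋆ₐ[ℂ] A} (hΘ : IsParity a Θ) (n : I) (i : Fin 2) :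
    Θ (CAR.proj a n i) = CAR.proj a n i := by
  fin_cases i <;> simp [CAR.proj, map_star, hΘ n]

theorem IsCAR.proj_commute (ha : IsCAR a) {Θ : A ≃⋆ₐ[ℂ] A} (hΘ : IsParity a Θ) (n : I)
    (i : Fin 2) {x : A} (hx : x ∈ loc a {n}ᶜ) : proj a n i * x = x * proj a n i :=
  ha.even_commute hΘ disjoint_compl_right (proj_mem_loc a (Set.mem_singleton n) i) hx (hΘ.proj n i)

theorem IsCAR.proj_mul_proj_comm (ha : IsCAR a) {Θ : A ≃⋆ₐ[ℂ] A} (hΘ : IsParity a Θ) (n m : I)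
    (i k : Fin 2) : proj a n i * proj a m k = proj a m k * proj a n i := by
  by_cases h : n = m
  · subst h
    by_cases hik : i = k
    · rw [hik]
    · rw [ha.proj_mul_of_ne n hik, ha.proj_mul_of_ne n (Ne.symm hik)]
  · exact ha.proj_commute hΘ n i (proj_mem_loc a (show m ∈ ({n} : Set I)ᶜ from Ne.symm h) k)

/-- This compression formula determines the pure state, because the projection is nonzero;
normalization, positivity and evenness are all derived from it. -/
theorem IsCAR.siteState_spec [Nontrivial A] (ha : IsCAR a) {Θ : A ≃⋆ₐ[ℂ] A} (hΘ : IsParity a Θ)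
    (n : I) (i : Fin 2) {x : A} (hx : x ∈ loc a {n}) :
    proj a n i * x * proj a n i = extendL (siteState a n i) x • proj a n i := by
  rw [extendL_apply _ hx]
  exact ha.proj_mul_mul_proj hΘ n i ⟨x, hx⟩

theorem IsCAR.smul_proj_inj [Nontrivial A] (ha : IsCAR a) {n : I} {i : Fin 2} {r s : ℂ}
    (h : r • proj a n i = s • proj a n i) : r = s :=
  smul_left_injective ℂ (ha.proj_ne_zero n i) h

/-- Conjugation with the generator or its adjoint carries one projection to the other, so positivity
of r P for one of them gives it for both, hence for r 1. -/
theorem IsCAR.nonneg_of_smul_proj_nonneg [Nontrivial A] (ha : IsCAR a) {n : I} {i : Fin 2} {r : ℂ}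
    (h : 0 ≤ r • proj a n i) : 0 ≤ r := by
  refine nonneg_of_smul_one_nonneg (A := A) ?_
  rw [← ha.anti_add n, smul_add]
  obtain ⟨-, -, -, -, h5, h6, -, -⟩ := ha.rules n 1
  fin_cases i
  · have h : 0 ≤ r • (a n * star (a n)) := h
    have h' := star_left_conjugate_nonneg h (a n)
    simp only [mul_smul_comm, smul_mul_assoc, mul_assoc, h5] at h'
    exact add_nonneg h' h
  · have h : 0 ≤ r • (star (a n) * a n) := h
    have h' := star_left_conjugate_nonneg h (star (a n))
    simp only [mul_smul_comm, smul_mul_assoc, mul_assoc, star_star, h6] at h'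
    exact add_nonneg h h'

/-- Multiplicativity of the pure state at the diagonal projections is what will make the evaluation
at ω a homomorphism on 𝔇. -/
theorem IsCAR.siteState_proj_mul [Nontrivial A] (ha : IsCAR a) {Θ : A ≃⋆ₐ[ℂ] A}
    (hΘ : IsParity a Θ) (n : I) (i k : Fin 2) {x : A} (hx : x ∈ loc a {n}) :
    extendL (siteState a n i) (proj a n k * x) =
      (if i = k then 1 else 0) * extendL (siteState a n i) x := by
  have hk := proj_mem_loc a (Set.mem_singleton n) k
  refine ha.smul_proj_inj (n := n) (i := i) ?_
  rw [← ha.siteState_spec hΘ n i (mul_mem hk hx)]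
  split_ifs with h
  · subst h
    rw [one_mul, ← ha.siteState_spec hΘ n i hx, ← mul_assoc (proj a n i), ha.proj_mul_self]
  · rw [zero_mul, zero_smul, ← mul_assoc (proj a n i), ha.proj_mul_of_ne n h, zero_mul, zero_mul]

theorem IsCAR.siteState_isEvenStateOn [Nontrivial A] (ha : IsCAR a) {Θ : A ≃⋆ₐ[ℂ] A}
    (hΘ : IsParity a Θ) (n : I) (i : Fin 2) :
    IsEvenStateOn a Θ {n} (extendL (siteState a n i)) where
  map_one := by
    refine ha.smul_proj_inj (n := n) (i := i) ?_
    rw [← ha.siteState_spec hΘ n i (one_mem _), mul_one, ha.proj_mul_self, one_smul]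
  nonneg x hx := by
    refine ha.nonneg_of_smul_proj_nonneg (n := n) (i := i) ?_
    rw [← ha.siteState_spec hΘ n i (mul_mem (star_mem hx) hx)]
    have := star_mul_self_nonneg (x * proj a n i)
    rw [star_mul, star_proj] at this
    simpa only [mul_assoc] using this
  even x hx := by
    refine ha.smul_proj_inj (n := n) (i := i) ?_
    rw [← ha.siteState_spec hΘ n i (hΘ.mem_loc hx)]
    have := congrArg Θ (ha.siteState_spec hΘ n i hx)
    rwa [map_mul, map_mul, map_smul, hΘ.proj] at this

theorem isCP_one : IsCP (1 : A →L[ℂ] A) := by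
  intro m x y
  have : ∑ i, ∑ j, star (y i) * (1 : A →L[ℂ] A) (star (x i) * x j) * y j =
      star (∑ i, x i * y i) * ∑ i, x i * y i := by
    rw [star_sum, Finset.sum_mul_sum]
    simp [mul_assoc]
  rw [this]
  exact star_mul_self_nonneg _

theorem IsCP.conj {Φ : A →L[ℂ] A} (h : IsCP Φ) (w : A) : IsCP (sandwich (star w) w * Φ) := by
  intro m x y
  have := h m x fun i => w * y i
  simpa [mul_assoc] using this

theorem IsCP.add {Φ Ψ : A →L[ℂ] A} (h : IsCP Φ) (h' : IsCP Ψ) : IsCP (Φ + Ψ) := by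
  intro m x y
  simpa [mul_add, add_mul, Finset.sum_add_distrib] using add_nonneg (h m x y) (h' m x y)

/-- The map `F_j` as a continuous map. -/
noncomputable def pinch (a : I → A) (j : I) : A →L[ℂ] A :=
  sandwich (proj a j 0) (proj a j 0) + sandwich (proj a j 1) (proj a j 1)

theorem pinch_apply (j : I) (x : A) : pinch a j x =
    proj a j 0 * (x * proj a j 0) + proj a j 1 * (x * proj a j 1) := rfl

theorem siteMap_of_mem {Γ : Set I} {j : I} (hj : j ∈ Γ) (x : A) :
    siteMap a Γ j x = pinch a j x := by
  simp [siteMap, if_pos hj, pinch_apply]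

theorem siteMap_of_notMem {Γ : Set I} {j : I} (hj : j ∉ Γ) (x : A) : siteMap a Γ j x = x := by
  simp [siteMap, if_neg hj]

theorem isCP_pinch (j : I) : IsCP (pinch a j) := by
  have h := (isCP_one.conj (proj a j 0)).add (isCP_one.conj (proj a j 1))
  simpa [star_proj, pinch] using h

theorem IsCAR.pinch_of_commute (ha : IsCAR a) {j : I} {x : A}
    (h : ∀ i, proj a j i * x = x * proj a j i) : pinch a j x = x := by
  rw [pinch_apply, ← h, ← h, ← mul_assoc, ← mul_assoc, ha.proj_mul_self, ha.proj_mul_self,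
    ← add_mul, ← Fin.sum_univ_two (f := proj a j), ha.sum_proj, one_mul]

theorem IsCAR.isLocalMap_pinch (ha : IsCAR a) {Θ : A ≃⋆ₐ[ℂ] A} (hΘ : IsParity a Θ) (j : I) :
    IsLocalMap a {j} (pinch a j) where
  norm_le := (isCP_pinch j).norm_le (ha.pinch_of_commute fun i => by simp)
  map_one := ha.pinch_of_commute fun i => by simp
  mem y hy := by
    have h := proj_mem_loc a (Set.mem_singleton j)
    exact add_mem (mul_mem (h 0) (mul_mem hy (h 0))) (mul_mem (h 1) (mul_mem hy (h 1)))
  mul_mid x hx y hy z hz := by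
    have h1 : ∀ i w, proj a j i * (x * w) = x * (proj a j i * w) := fun i w => by
      rw [← mul_assoc, ha.proj_commute hΘ j i hx, mul_assoc]
    simp only [pinch_apply, mul_add, add_mul, mul_assoc, h1, ha.proj_commute hΘ j _ hz]

theorem IsCAR.pinch_pinch (ha : IsCAR a) (j : I) (x : A) :
    pinch a j (pinch a j x) = pinch a j x := by
  refine ha.pinch_of_commute fun i => ?_
  have h01 := ha.proj_mul_of_ne j (show (0 : Fin 2) ≠ 1 by simp)
  have h10 := ha.proj_mul_of_ne j (show (1 : Fin 2) ≠ 0 by simp)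
  rw [pinch_apply, mul_add, add_mul]
  fin_cases i <;>
  simp only [Fin.zero_eta, Fin.mk_one, mul_assoc, ha.proj_mul_self, h01, h10, mul_zero] <;>
  simp only [← mul_assoc, ha.proj_mul_self, h01, h10, zero_mul]

theorem IsCAR.pinch_comm (ha : IsCAR a) {Θ : A ≃⋆ₐ[ℂ] A} (hΘ : IsParity a Θ) (j k : I) (x : A) :
    pinch a j (pinch a k x) = pinch a k (pinch a j x) := by
  have h := ha.proj_mul_proj_comm hΘ j k
  have h' : ∀ i i' w, proj a j i * (proj a k i' * w) = proj a k i' * (proj a j i * w) :=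
    fun i i' w => by rw [← mul_assoc, h, mul_assoc]
  simp only [pinch_apply, mul_add, add_mul, mul_assoc, h, h']
  abel

theorem IsCAR.pinch_eq [Nontrivial A] (ha : IsCAR a) {Θ : A ≃⋆ₐ[ℂ] A} (hΘ : IsParity a Θ) (j : I)
    {x : A} (hx : x ∈ loc a {j}) :
    pinch a j x = ∑ i, extendL (siteState a j i) x • proj a j i := by
  rw [pinch_apply, Fin.sum_univ_two, ← ha.siteState_spec hΘ j 0 hx, ← ha.siteState_spec hΘ j 1 hx,
    mul_assoc, mul_assoc]

end Functionals

/-! ### The algebra 𝔇 and the maps F_j -/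

section DiagAlg

variable {I A : Type*} [CStarAlgebra A] {a : I → A}

theorem gen_mem_diagAlg {Γ : Set I} {j : I} (hj : j ∉ Γ) : a j ∈ diagAlg a Γ :=
  StarSubalgebra.le_topologicalClosure _
    (StarAlgebra.subset_adjoin ℂ _ (Or.inl (Set.mem_image_of_mem a hj)))

theorem proj_mem_diagAlg {Γ : Set I} {j : I} (hj : j ∈ Γ) (i : Fin 2) :
    proj a j i ∈ diagAlg a Γ :=
  StarSubalgebra.le_topologicalClosure _
    (StarAlgebra.subset_adjoin ℂ _ (Or.inr ⟨j, hj, i, rfl⟩))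

theorem isClosed_diagAlg (a : I → A) (Γ : Set I) : IsClosed (diagAlg a Γ : Set A) :=
  StarSubalgebra.isClosed_topologicalClosure _

theorem loc_compl_le_diagAlg (a : I → A) (Γ : Set I) : loc a Γᶜ ≤ diagAlg a Γ :=
  StarSubalgebra.topologicalClosure_mono (StarAlgebra.adjoin_mono Set.subset_union_left)

/-- Closed *-subalgebras containing the generators contain `diagAlg`. -/
theorem diagAlg_le {Γ : Set I} {B : StarSubalgebra ℂ A} (hB : IsClosed (B : Set A))
    (h1 : ∀ j ∉ Γ, a j ∈ B) (h2 : ∀ j ∈ Γ, ∀ i, proj a j i ∈ B) : diagAlg a Γ ≤ B := by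
  refine StarSubalgebra.topologicalClosure_minimal (StarAlgebra.adjoin_le ?_) hB
  rintro _ (⟨j, hj, rfl⟩ | ⟨j, hj, i, rfl⟩)
  exacts [h1 j hj, h2 j hj i]

/-- The centralizer of the projection is closed and contains the generators of 𝔇: the `a k` with k ∉
Γ, since the projection is even, and the commuting projections at the sites of Γ. -/
theorem IsCAR.proj_commute_diagAlg (ha : IsCAR a) {Θ : A ≃⋆ₐ[ℂ] A} (hΘ : IsParity a Θ) {Γ : Set I}
    {j : I} (hj : j ∈ Γ) (i : Fin 2) {x : A} (hx : x ∈ diagAlg a Γ) :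
    proj a j i * x = x * proj a j i := by
  have hB : IsClosed (StarSubalgebra.centralizer ℂ {proj a j i} : Set A) := by
    have : (StarSubalgebra.centralizer ℂ {proj a j i} : Set A) =
        {x | proj a j i * x = x * proj a j i} := by
      ext x
      rw [SetLike.mem_coe, StarSubalgebra.mem_centralizer_iff]
      simp [star_proj]
    rw [this]
    exact isClosed_eq (by fun_prop) (by fun_prop)
  have hle : diagAlg a Γ ≤ StarSubalgebra.centralizer ℂ {proj a j i} := by
    refine diagAlg_le hB (fun k hk => ?_) fun k hk i' => ?_
    · rw [StarSubalgebra.mem_centralizer_iff]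
      rintro _ rfl
      have := ha.proj_commute hΘ j i (gen_mem_loc a (show k ∈ ({j} : Set I)ᶜ by
        rintro rfl; exact hk hj))
      rw [star_proj]
      exact ⟨this, this⟩
    · rw [StarSubalgebra.mem_centralizer_iff]
      rintro _ rfl
      have := ha.proj_mul_proj_comm hΘ j k i i'
      rw [star_proj]
      exact ⟨this, this⟩
  exact (StarSubalgebra.mem_centralizer_iff ℂ |>.1 (hle hx) _ rfl).1

theorem siteMap_mem {Γ : Set I} {W : Set I} {j : I} (hj : j ∈ W) {x : A} (hx : x ∈ loc a W) :
    siteMap a Γ j x ∈ loc a W := by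
  by_cases h : j ∈ Γ
  · have hp := proj_mem_loc a hj
    rw [siteMap_of_mem h]
    exact add_mem (mul_mem (hp 0) (mul_mem hx (hp 0))) (mul_mem (hp 1) (mul_mem hx (hp 1)))
  · rwa [siteMap_of_notMem h]

theorem siteMap_prod_mem {Γ : Set I} {W : Set I} {L : List I} (hL : ∀ j ∈ L, j ∈ W) {x : A}
    (hx : x ∈ loc a W) : (L.map (siteMap a Γ)).prod x ∈ loc a W := by
  induction L with
  | nil => simpa using hx
  | cons j L ih =>
    rw [List.map_cons, List.prod_cons, Module.End.mul_apply]
    exact siteMap_mem (hL j (by simp)) (ih fun k hk => hL k (by simp [hk]))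

/-- The pinchings commute and are idempotent, so one more copy of a factor already present is
absorbed. -/
theorem IsCAR.pinch_siteMap_prod (ha : IsCAR a) {Θ : A ≃⋆ₐ[ℂ] A} (hΘ : IsParity a Θ) {Γ : Set I}
    {L : List I} {k : I} (hk : k ∈ Γ) (hkL : k ∈ L) (x : A) :
    pinch a k ((L.map (siteMap a Γ)).prod x) = (L.map (siteMap a Γ)).prod x := by
  induction L with
  | nil => simp at hkL
  | cons j L ih =>
    rw [List.map_cons, List.prod_cons, Module.End.mul_apply]
    by_cases h : j ∈ Γ
    · rw [siteMap_of_mem h]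
      by_cases hjk : k = j
      · rw [hjk, ha.pinch_pinch]
      · rw [ha.pinch_comm hΘ, ih (by simpa [hjk] using hkL)]
    · rw [siteMap_of_notMem h]
      exact ih (by
        rcases List.mem_cons.1 hkL with rfl | h'
        · exact absurd hk h
        · exact h')

theorem IsCAR.diagExp_unique (ha : IsCAR a) {Γ : Set I} {S S' : A →L[ℂ] diagAlg a Γ}
    (h : IsDiagExp a Γ S) (h' : IsDiagExp a Γ S') (x : A) : S x = S' x := by
  refine mem_of_forall_finite (LinearMap.eqLocus (S : A →ₗ[ℂ] diagAlg a Γ) S')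
    (isClosed_eq S.continuous S'.continuous) (fun F _ z hz => ?_) (ha.mem_loc_univ x)
  have hz' : z ∈ loc a {j | j ∈ F.toList} := by simpa using hz
  exact Subtype.ext ((h _ _ hz').trans (h' _ _ hz').symm)

/-- The elements of 𝔇 localized in finite regions are dense in 𝔇, and each F_j fixes them because
the projections over Γ commute with 𝔇. -/
theorem IsCAR.diagExp_of_mem (ha : IsCAR a) {Θ : A ≃⋆ₐ[ℂ] A} (hΘ : IsParity a Θ) {Γ : Set I}
    {S : A →L[ℂ] diagAlg a Γ} (h : IsDiagExp a Γ S) {x : A} (hx : x ∈ diagAlg a Γ) :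
    (S x : A) = x := by
  have hcl : diagAlg a Γ ≤ (⊤ : StarSubalgebra ℂ A) := le_top
  let V : StarSubalgebra ℂ A :=
    { carrier := {x | x ∈ diagAlg a Γ ∧ ∃ F : Finset I, x ∈ loc a (F : Set I)}
      mul_mem' := by
        rintro x y ⟨hx, F, hF⟩ ⟨hy, G, hG⟩
        refine ⟨mul_mem hx hy, F ∪ G, mul_mem (loc_mono ?_ hF) (loc_mono ?_ hG)⟩ <;> simp
      add_mem' := by
        rintro x y ⟨hx, F, hF⟩ ⟨hy, G, hG⟩
        refine ⟨add_mem hx hy, F ∪ G, add_mem (loc_mono ?_ hF) (loc_mono ?_ hG)⟩ <;> simp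
      algebraMap_mem' := fun r => ⟨algebraMap_mem _ r, ∅, algebraMap_mem _ r⟩
      star_mem' := by
        rintro x ⟨hx, F, hF⟩
        exact ⟨star_mem hx, F, star_mem hF⟩ }
  have hV : StarAlgebra.adjoin ℂ (a '' Γᶜ ∪ {x | ∃ j ∈ Γ, ∃ i, x = proj a j i}) ≤ V := by
    refine StarAlgebra.adjoin_le ?_
    rintro _ (⟨j, hj, rfl⟩ | ⟨j, hj, i, rfl⟩)
    · exact ⟨gen_mem_diagAlg hj, {j}, gen_mem_loc a (by simp)⟩
    · exact ⟨proj_mem_diagAlg hj i, {j}, proj_mem_loc a (by simp) i⟩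
  have hM : IsClosed {x | (S x : A) = x} :=
    isClosed_eq (continuous_subtype_val.comp S.continuous) continuous_id
  have hx' : x ∈ closure ((StarAlgebra.adjoin ℂ
    (a '' Γᶜ ∪ {x | ∃ j ∈ Γ, ∃ i, x = proj a j i}) : StarSubalgebra ℂ A) : Set A) := hx
  refine closure_minimal (fun w hw => ?_) hM hx'
  obtain ⟨hwd, F, hF⟩ := hV hw
  have hF' : w ∈ loc a {j | j ∈ F.toList} := by simpa using hF
  change (S w : A) = w
  rw [h _ _ hF']
  generalize F.toList = L
  induction L with
  | nil => rfl
  | cons j L ih =>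
    rw [List.map_cons, List.prod_cons, Module.End.mul_apply, ih]
    by_cases hj : j ∈ Γ
    · rw [siteMap_of_mem hj, ha.pinch_of_commute fun i => ha.proj_commute_diagAlg hΘ hj i hwd]
    · rw [siteMap_of_notMem hj]

end DiagAlg

/-! ### Existence of the diagonal expectation 𝓔 -/

section DiagExp

variable {I : Type*} [LinearOrder I] [SuccOrder I] {A : Type*} [CStarAlgebra A] {a : I → A}

/-- The factor of the diagonal expectation in a cell. -/
noncomputable def cellPinch (a : I → A) (Γ D : Set I) : starts Γ D ⊕ Γ → A →L[ℂ] A :=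
  Sum.elim (fun _ => 1) (fun j => pinch a j)

theorem IsCAR.isLocalMap_cellPinch (ha : IsCAR a) {Θ : A ≃⋆ₐ[ℂ] A} (hΘ : IsParity a Θ)
    (Γ D : Set I) (c : starts Γ D ⊕ Γ) : IsLocalMap a (cell Γ D c) (cellPinch a Γ D c) := by
  rcases c with j | j
  · exact isLocalMap_one _
  · exact ha.isLocalMap_pinch hΘ j

theorem IsTwoStepSet.univ_cover {Γ D : Set I} (hD : IsTwoStepSet Γ D) :
    ∀ j ∈ (Set.univ : Set I), ∃ c, j ∈ cell Γ D c ∧ cell Γ D c ⊆ Set.univ := fun j _ =>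
  let ⟨c, hc⟩ := hD.isPartition.cover j
  ⟨c, hc, Set.subset_univ _⟩

/-- Two continuous linear maps that agree on words are equal. -/
theorem IsCAR.ext_words {E : Type*} [AddCommGroup E] [Module ℂ E] [TopologicalSpace E] [T2Space E]
    (ha : IsCAR a) {Θ : A ≃⋆ₐ[ℂ] A}
    (hΘ : IsParity a Θ) {Γ D : Set I} (hD : IsTwoStepSet Γ D) {S T : A →ₗ[ℂ] E}
    (hS : Continuous S) (hT : Continuous T)
    (h : ∀ (L : List (starts Γ D ⊕ Γ)) (x : starts Γ D ⊕ Γ → A), L.Nodup →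
      (∀ c, x c ∈ loc a (cell Γ D c)) → S (word L x) = T (word L x)) (z : A) : S z = T z :=
  ha.mem_of_forall_word hΘ hD.isPartition hD.univ_cover (LinearMap.eqLocus S T)
    (isClosed_eq hS hT) (fun L x hL _ hx => h L x hL hx) (ha.mem_loc_univ z)

/-- The infinite tensor product S of the pinchings absorbs every F_j and fixes whatever all of them
fix. A local x can therefore be replaced by its finite product of F_j, which S leaves alone. The
formula on words is kept for the comparison with product states. -/
theorem IsCAR.exists_diagExp [Countable I] [Nontrivial A] (ha : IsCAR a) {Θ : A ≃⋆ₐ[ℂ] A}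
    (hΘ : IsParity a Θ) {Γ D : Set I} (hD : IsTwoStepSet Γ D) :
    ∃ S : A →L[ℂ] diagAlg a Γ, IsDiagExp a Γ S ∧
      ∀ (L : List (starts Γ D ⊕ Γ)) (x : starts Γ D ⊕ Γ → A), L.Nodup →
        (∀ c, x c ∈ loc a (cell Γ D c)) →
        (S (word L x) : A) = word L fun c => cellPinch a Γ D c (x c) := by
  have hs := hD.isPartition
  obtain ⟨f, hf⟩ := exists_injective_nat (starts Γ D ⊕ Γ)
  have hT := ha.isLocalMap_cellPinch hΘ Γ D
  obtain ⟨S, hS, hw⟩ := ha.exists_tensor hs.disjoint hT hf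
  have hmem : ∀ x, S x ∈ diagAlg a Γ := by
    intro x
    refine ha.mem_of_forall_word hΘ hs hD.univ_cover
      ((diagAlg a Γ).toSubalgebra.toSubmodule.comap (S : A →ₗ[ℂ] A))
      ((isClosed_diagAlg a Γ).preimage S.continuous) ?_ (ha.mem_loc_univ x)
    intro L x hL _ hx
    change S (word L x) ∈ diagAlg a Γ
    rw [hw L x hL hx]
    refine list_prod_mem fun y hy => ?_
    obtain ⟨c, -, rfl⟩ := List.mem_map.1 hy
    rcases c with j | j
    · exact loc_compl_le_diagAlg a Γ (loc_mono (hD.block_subset j) (hx (Sum.inl j)))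
    · change pinch a j (x (Sum.inr j)) ∈ _
      rw [ha.pinch_eq hΘ j (hx (Sum.inr j))]
      exact sum_mem fun i _ => (diagAlg a Γ).smul_mem (proj_mem_diagAlg j.2 i) _
  have hSF : ∀ j ∈ Γ, ∀ x, S (pinch a j x) = S x := by
    intro j hj x
    refine ha.ext_words hΘ hD (S := ((S * pinch a j : A →L[ℂ] A) : A →ₗ[ℂ] A))
      (T := (S : A →ₗ[ℂ] A)) (S * pinch a j).continuous S.continuous ?_ x
    intro L x hL hx
    change S (pinch a j (word L x)) = S (word L x)
    have hj' := ha.isLocalMap_pinch hΘ j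
    rw [IsLocalMap.apply_word (c := Sum.inr ⟨j, hj⟩) hs.disjoint hj' hL hx,
      hw L _ hL, hw L _ hL hx]
    · congr 1
      ext c
      by_cases hc : c = Sum.inr ⟨j, hj⟩
      · subst hc
        rw [Function.update_self]
        exact ha.pinch_pinch j _
      · rw [Function.update_of_ne hc]
    · intro c
      by_cases hc : c = Sum.inr ⟨j, hj⟩
      · subst hc
        rw [Function.update_self]
        exact hj'.mem _ (hx (Sum.inr ⟨j, hj⟩))
      · rw [Function.update_of_ne hc]
        exact hx c
  have hfix : ∀ x, (∀ j ∈ Γ, pinch a j x = x) → S x = x := by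
    intro x hx
    refine tendsto_nhds_unique (hS x) (tendsto_const_nhds.congr fun N => ?_)
    induction N with
    | zero => rfl
    | succ N ih =>
      change x = seqComp _ N (seqOf _ f N x)
      rcases seqOf_cases (cellPinch a Γ D) f N with h | ⟨c, -, h⟩
      · rw [h]
        exact ih
      · rcases c with j | j
        · rw [h]
          exact ih
        · rw [h, show cellPinch a Γ D (Sum.inr j) x = x from hx j j.2]
          exact ih
  have hSL : ∀ (L : List I) x, S ((L.map (siteMap a Γ)).prod x) = S x := by
    intro L
    induction L with
    | nil => intro x; rfl
    | cons j L ih =>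
      intro x
      rw [List.map_cons, List.prod_cons, Module.End.mul_apply]
      by_cases h : j ∈ Γ
      · rw [siteMap_of_mem h, hSF j h, ih]
      · rw [siteMap_of_notMem h, ih]
  refine ⟨S.codRestrict (diagAlg a Γ).toSubalgebra.toSubmodule hmem, ?_, hw⟩
  intro L x hx
  change S x = _
  rw [← hSL L x]
  refine hfix _ fun k hk => ?_
  by_cases hkL : k ∈ L
  · exact ha.pinch_siteMap_prod hΘ hk hkL x
  · refine (ha.isLocalMap_pinch hΘ k).apply_of_mem_compl (loc_mono ?_
      (siteMap_prod_mem (W := {j | j ∈ L}) (fun j hj => hj) hx))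
    rintro j hj rfl
    exact hkL hj

end DiagExp

/-! ### Evaluation of elements of 𝔇 at a configuration -/

section Evaluation

variable {I A : Type*} [CStarAlgebra A] {a : I → A}

/-- A slice map with a functional that is multiplicative at the even element `p`. -/
theorem IsSlice.apply_even_mul (ha : IsCAR a) {Θ : A ≃⋆ₐ[ℂ] A} (hΘ : IsParity a Θ) {b : Set I}
    (hb : b.Finite) {f : A →ₗ[ℂ] ℂ} {Φ : A →L[ℂ] A} (h : IsSlice a Θ b f Φ) {p : A}
    (hp : p ∈ loc a b) (he : Θ p = p) {r : ℂ} (hr : ∀ y ∈ loc a b, f (p * y) = r * f y) (z : A) :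
    Φ (p * z) = r • Φ z := by
  obtain ⟨F⟩ := ha.exists_frame hΘ hb
  rw [← F.sum_coeff z, Finset.mul_sum, map_sum, map_sum, Finset.smul_sum]
  refine Finset.sum_congr rfl fun k _ => ?_
  have hc : F.coeff k z ∈ loc a bᶜ := by
    have := F.coeff_mem Set.univ z (ha.mem_loc_univ z) k
    rwa [← Set.compl_eq_univ_sdiff] at this
  rw [← mul_assoc, ha.even_commute hΘ disjoint_compl_right hp hc he, mul_assoc, h.mul_left _ hc,
    h.mul_left _ hc, h.apply_of_mem _ (mul_mem hp (F.e_mem k)), h.apply_of_mem _ (F.e_mem k),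
    hr _ (F.e_mem k)]
  simp [smul_smul]

/-- Slice every site j of Γ with the pure state of ω_j and pass to the limit S. On 𝔄 the map S is
only linear, but the pure states are multiplicative at the diagonal projections and S is linear over
the algebra off Γ, so all generators of 𝔇 lie in its multiplicative domain. -/
theorem IsCAR.exists_evaluation [Countable I] [Nontrivial A] (ha : IsCAR a) {Θ : A ≃⋆ₐ[ℂ] A}
    (hΘ : IsParity a Θ) (Γ : Set I) (ω : Γ → Fin 2) :
    ∃ ev : diagAlg a Γ →⋆ₐ[ℂ] loc a Γᶜ, IsEvaluation a Γ ω ev := by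
  obtain ⟨f, hf⟩ := exists_injective_nat Γ
  choose T hT using fun j : Γ => ha.exists_slice hΘ (Set.finite_singleton (j : I))
    (ha.siteState_isEvenStateOn hΘ j (ω j))
  have hd : Pairwise (Function.onFun Disjoint fun j : Γ => ({(j : I)} : Set I)) := by
    intro j k hjk
    simpa [Function.onFun, Subtype.ext_iff] using fun h => hjk (Subtype.ext h)
  obtain ⟨S, hS, -⟩ := ha.exists_tensor hd (fun j => (hT j).isLocalMap) hf
  have hleft : ∀ x ∈ loc a Γᶜ, ∀ z, S (x * z) = x * S z := by
    intro x hx z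
    refine tendsto_nhds_unique (hS _) (((hS z).const_mul x).congr fun N => ?_)
    induction N generalizing z with
    | zero => rfl
    | succ N ih =>
      change _ = seqComp _ N (seqOf _ f N _)
      rcases seqOf_cases T f N with h | ⟨c, -, h⟩
      · rw [h]
        simp only [seqComp, h, mul_one]
        exact ih z
      · rw [h, (hT c).mul_left x (loc_mono (by simp) hx), ← ih]
        simp only [seqComp, h]
        rfl
  have hproj : ∀ (j : Γ) i z, S (proj a j i * z) = (if ω j = i then (1 : ℂ) else 0) • S z := by
    intro j i z
    set r : ℂ := if ω j = i then (1 : ℂ) else 0 with hr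
    -- Only the factor numbered f j sees the projection at j, so the scalar is present as soon as N
    -- exceeds f j; all other factors let the projection pass.
    have key : ∀ N > f j, ∀ z, seqComp (seqOf T f) N (proj a j i * z) =
        r • seqComp (seqOf T f) N z := by
      intro N hN
      induction N, hN using Nat.le_induction with
      | base =>
        intro z
        change seqComp _ (f j) (seqOf T f (f j) _) = r • seqComp _ (f j) (seqOf T f (f j) _)
        rw [seqOf_apply T hf, (hT j).apply_even_mul ha hΘ (Set.finite_singleton _)
          (proj_mem_loc a (Set.mem_singleton _) i) (hΘ.proj j i)
          (fun y hy => ha.siteState_proj_mul hΘ j (ω j) i hy), map_smul]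
      | succ N hN ih =>
        intro z
        change seqComp _ N (seqOf T f N _) = r • seqComp _ N (seqOf T f N _)
        rcases seqOf_cases T f N with h | ⟨c, hc, h⟩
        · rw [h]
          exact ih z
        · rw [h, (hT c).mul_left, ih]
          refine proj_mem_loc a ?_ i
          intro hjc
          have : c = j := Subtype.ext (Set.mem_singleton_iff.1 hjc).symm
          subst this
          omega
    refine tendsto_nhds_unique (hS _) (((hS z).const_smul r).congr' ?_)
    filter_upwards [eventually_gt_atTop (f j)] with N hN
    exact (key N hN z).symm
  have hone : S 1 = 1 := by
    refine tendsto_nhds_unique (hS 1) (tendsto_const_nhds.congr fun N => ?_)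
    induction N with
    | zero => rfl
    | succ N ih =>
      change _ = seqComp _ N (seqOf T f N _)
      rcases seqOf_cases T f N with h | ⟨c, -, h⟩
      · rw [h]
        exact ih
      · rw [h, (hT c).map_one]
        exact ih
  have hstar : ∀ x, S (star x) = star (S x) := by
    intro x
    refine tendsto_nhds_unique (hS _) ((hS x).star.congr fun N => ?_)
    induction N generalizing x with
    | zero => rfl
    | succ N ih =>
      change star (seqComp _ N (seqOf T f N _)) = seqComp _ N (seqOf T f N _)
      rcases seqOf_cases T f N with h | ⟨c, -, h⟩
      · rw [h]
        exact ih x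
      · rw [h, (hT c).cp.map_star]
        exact ih _
  -- The two-sided multiplicative domain of S. Both sides are required so that it is stable under
  -- the involution.
  let B : StarSubalgebra ℂ A :=
    { carrier := {u | (∀ v, S (u * v) = S u * S v) ∧ ∀ v, S (v * u) = S v * S u}
      mul_mem' := by
        rintro u u' ⟨h1, h2⟩ ⟨h1', h2'⟩
        refine ⟨fun v => ?_, fun v => ?_⟩
        · rw [mul_assoc, h1, h1', h1, mul_assoc]
        · rw [← mul_assoc, h2', h2, h2', mul_assoc]
      add_mem' := by
        rintro u u' ⟨h1, h2⟩ ⟨h1', h2'⟩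
        refine ⟨fun v => ?_, fun v => ?_⟩
        · rw [add_mul, map_add, map_add, h1, h1', add_mul]
        · rw [mul_add, map_add, map_add, h2, h2', mul_add]
      algebraMap_mem' := by
        intro r
        rw [Algebra.algebraMap_eq_smul_one]
        constructor <;> intro v <;> simp [hone]
      star_mem' := by
        rintro u ⟨h1, h2⟩
        refine ⟨fun v => ?_, fun v => ?_⟩
        · have := congrArg star (h2 (star v))
          rwa [← hstar, star_mul, star_star, star_mul, ← hstar, ← hstar, star_star] at this
        · have := congrArg star (h1 (star v))
          rwa [← hstar, star_mul, star_star, star_mul, ← hstar, ← hstar, star_star] at this }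
  have hB : IsClosed (B : Set A) := by
    have : (B : Set A) = (⋂ v, {u | S (u * v) = S u * S v}) ∩ ⋂ v, {u | S (v * u) = S v * S u} := by
      ext u
      simp [B]
    rw [this]
    refine IsClosed.inter (isClosed_iInter fun v => isClosed_eq ?_ ?_)
      (isClosed_iInter fun v => isClosed_eq ?_ ?_) <;> fun_prop
  have hright : ∀ u, (∀ v, S (star u * v) = S (star u) * S v) → ∀ v, S (v * u) = S v * S u := by
    intro u h v
    have := congrArg star (h (star v))
    rwa [← hstar, star_mul, star_star, star_mul, ← hstar, ← hstar, star_star, star_star] at this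
  have hfix : ∀ x ∈ loc a Γᶜ, S x = x := by
    intro x hx
    simpa [hone] using hleft x hx 1
  have hSproj : ∀ (j : Γ) i, S (proj a j i) = (if ω j = i then (1 : ℂ) else 0) • (1 : A) := by
    intro j i
    simpa [hone] using hproj j i 1
  have hle : diagAlg a Γ ≤ B := by
    refine diagAlg_le hB (fun k hk => ?_) fun k hk i => ?_
    · have hm := gen_mem_loc a (show k ∈ Γᶜ from hk)
      refine ⟨fun v => ?_, hright _ fun v => ?_⟩
      · rw [hleft _ hm, hfix _ hm]
      · rw [hleft _ (star_mem hm), hfix _ (star_mem hm)]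
    · have hP : ∀ v, S (proj a k i * v) = S (proj a k i) * S v := fun v => by
        rw [hproj ⟨k, hk⟩, hSproj ⟨k, hk⟩, smul_mul_assoc, one_mul]
      exact ⟨hP, hright _ (by rwa [star_proj])⟩
  have hmem : ∀ x ∈ diagAlg a Γ, S x ∈ loc a Γᶜ := by
    let C : StarSubalgebra ℂ A :=
      { carrier := {x | x ∈ B ∧ S x ∈ loc a Γᶜ}
        mul_mem' := by
          rintro x y ⟨hx, hx'⟩ ⟨hy, hy'⟩
          refine ⟨mul_mem hx hy, ?_⟩
          change S (x * y) ∈ _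
          rw [hx.1]
          exact mul_mem hx' hy'
        add_mem' := by
          rintro x y ⟨hx, hx'⟩ ⟨hy, hy'⟩
          refine ⟨add_mem hx hy, ?_⟩
          change S (x + y) ∈ _
          rw [map_add]
          exact add_mem hx' hy'
        algebraMap_mem' := by
          intro r
          refine ⟨algebraMap_mem _ r, ?_⟩
          change S (algebraMap ℂ A r) ∈ _
          rw [Algebra.algebraMap_eq_smul_one, map_smul, hone]
          exact (loc a Γᶜ).smul_mem (one_mem _) r
        star_mem' := by
          rintro x ⟨hx, hx'⟩
          refine ⟨star_mem hx, ?_⟩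
          change S (star x) ∈ _
          rw [hstar]
          exact star_mem hx' }
    have hC : IsClosed (C : Set A) :=
      hB.inter ((isClosed_loc a Γᶜ).preimage S.continuous)
    have : diagAlg a Γ ≤ C := by
      refine diagAlg_le hC (fun k hk => ?_) fun k hk i => ?_
      · refine ⟨hle (gen_mem_diagAlg hk), ?_⟩
        have hm := gen_mem_loc a (show k ∈ Γᶜ from hk)
        change S (a k) ∈ _
        rwa [hfix _ hm]
      · refine ⟨hle (proj_mem_diagAlg hk i), ?_⟩
        rw [hSproj ⟨k, hk⟩]
        exact (loc a Γᶜ).smul_mem (one_mem _) _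
    exact fun x hx => (this hx).2
  refine ⟨{ toFun := fun x => ⟨S x, hmem x x.2⟩
            map_one' := Subtype.ext hone
            map_mul' := fun x y => Subtype.ext ((hle x.2).1 y)
            map_zero' := Subtype.ext (map_zero S)
            map_add' := fun x y => Subtype.ext (map_add S _ _)
            commutes' := fun r => Subtype.ext ?_
            map_star' := fun x => Subtype.ext (hstar x) }, ?_, ?_⟩
  · change S (algebraMap ℂ A r) = algebraMap ℂ A r
    rw [Algebra.algebraMap_eq_smul_one, map_smul, hone]
  · intro x y hxy
    refine Subtype.ext ?_
    change S x = y
    rw [hxy, hfix _ y.2]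
  · intro j i x hx
    refine Subtype.ext ?_
    change S x = _
    rw [hx, hSproj]
    split_ifs <;> simp

end Evaluation

/-! ### Reduction of ψ_ω(𝓔(x)(ω)) to a product state over all cells -/

section Ingredients

variable {I : Type*} [LinearOrder I] [SuccOrder I] {A : Type*} [CStarAlgebra A] {a : I → A}

/-- The states on the cells at the configuration `ω`: the block states, and the pure states of the
site algebras over `Γ`. -/
noncomputable def cellState {Γ D : Set I}
    (φ : (j : starts Γ D) → (Γ → Fin 2) → (loc a (block D j) →ₗ[ℂ] ℂ)) (ω : Γ → Fin 2) :
    starts Γ D ⊕ Γ → A →ₗ[ℂ] ℂ :=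
  Sum.elim (fun j => extendL (φ j ω)) (fun j => extendL (siteState a (j : I) (ω j)))

theorem IsBlockFamily.isEvenStateOn [Nontrivial A] (ha : IsCAR a) {Θ : A ≃⋆ₐ[ℂ] A}
    (hΘ : IsParity a Θ) {Γ D : Set I}
    {φ : (j : starts Γ D) → (Γ → Fin 2) → (loc a (block D j) →ₗ[ℂ] ℂ)}
    (hφ : IsBlockFamily a Γ D φ) (ω : Γ → Fin 2) (c : starts Γ D ⊕ Γ) :
    IsEvenStateOn a Θ (cell Γ D c) (cellState φ ω c) := by
  rcases c with j | j
  · refine ⟨?_, fun x (hx : x ∈ loc a (block D j)) => ?_,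
      fun x (hx : x ∈ loc a (block D j)) => ?_⟩
    · exact (extendL_apply _ (one_mem _)).trans (hφ.isState j ω).1
    · change 0 ≤ extendL (φ j ω) _
      rw [extendL_apply _ (mul_mem (star_mem hx) hx)]
      exact (hφ.isState j ω).2 ⟨x, hx⟩
    · change extendL (φ j ω) _ = extendL (φ j ω) _
      rw [extendL_apply _ hx, extendL_apply _ (hΘ.mem_loc hx)]
      exact hφ.isEven j ω Θ hΘ _ _ rfl
  · exact ha.siteState_isEvenStateOn hΘ j (ω j)

/-- `χ` is the product of the cell states at the configuration `ω`. -/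
def IsCellProduct (a : I → A) {Γ D : Set I}
    (φ : (j : starts Γ D) → (Γ → Fin 2) → (loc a (block D j) →ₗ[ℂ] ℂ)) (ω : Γ → Fin 2)
    (χ : A →ₗ[ℂ] ℂ) : Prop :=
  IsState χ ∧ ∀ (L : List (starts Γ D ⊕ Γ)) (x : starts Γ D ⊕ Γ → A), L.Nodup →
    (∀ c, x c ∈ loc a (cell Γ D c)) → χ (word L x) = (L.map fun c => cellState φ ω c (x c)).prod

theorem IsBlockFamily.exists_cellProduct [Countable I] [Nontrivial A] (ha : IsCAR a)
    {Θ : A ≃⋆ₐ[ℂ] A} (hΘ : IsParity a Θ) {Γ D : Set I} (hD : IsTwoStepSet Γ D)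
    {φ : (j : starts Γ D) → (Γ → Fin 2) → (loc a (block D j) →ₗ[ℂ] ℂ)}
    (hφ : IsBlockFamily a Γ D φ) (ω : Γ → Fin 2) : ∃ χ, IsCellProduct a φ ω χ :=
  ha.exists_prodState hΘ hD.isPartition (hφ.isEvenStateOn ha hΘ ω)

/-- The product state on the algebra off Γ is the restriction of the product state over all cells.
-/
theorem IsBlockFamily.nonempty_ingredients [Countable I] [Nontrivial A] (ha : IsCAR a)
    {Θ : A ≃⋆ₐ[ℂ] A} (hΘ : IsParity a Θ) {Γ D : Set I} (hD : IsTwoStepSet Γ D)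
    {φ : (j : starts Γ D) → (Γ → Fin 2) → (loc a (block D j) →ₗ[ℂ] ℂ)}
    (hφ : IsBlockFamily a Γ D φ) : Nonempty (Ingredients a Γ D φ) := by
  obtain ⟨S, hS, -⟩ := ha.exists_diagExp hΘ hD
  choose ev hev using ha.exists_evaluation hΘ Γ
  choose χ hχ using hφ.exists_cellProduct ha hΘ hD
  refine ⟨⟨S, ev, fun ω => χ ω ∘ₗ (loc a Γᶜ).subtype.toAlgHom.toLinearMap, hS, hev,
    fun ω => ⟨⟨(hχ ω).1.1, fun x => (hχ ω).1.2 x⟩, ?_⟩⟩⟩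
  intro L x y hL hy
  have := (hχ ω).2 (L.map Sum.inl) (Sum.elim (fun j => (x j : A)) fun _ => 1)
    (hL.map Sum.inl_injective) (by
      rintro (j | j)
      · exact (x j).2
      · exact one_mem _)
  rw [word, List.map_map, List.map_map] at this
  change χ ω y = _
  rw [hy]
  refine this.trans ?_
  congr 1
  refine List.map_congr_left fun j _ => ?_
  exact extendL_apply _ (x j).2

/-- Both sides are continuous, so words decide. On a word 𝓔 pinches the letters over Γ, the
evaluation turns each of them into the scalar given by its pure state, and the product state handles
the remaining block letters. Any choice of ingredients thus gives the same function of ω. -/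
theorem Ingredients.eval_eq [Countable I] [Nontrivial A] (ha : IsCAR a)
    {Θ : A ≃⋆ₐ[ℂ] A} (hΘ : IsParity a Θ) {Γ D : Set I} (hD : IsTwoStepSet Γ D)
    {φ : (j : starts Γ D) → (Γ → Fin 2) → (loc a (block D j) →ₗ[ℂ] ℂ)}
    (S : Ingredients a Γ D φ) (ω : Γ → Fin 2) {χ : A →ₗ[ℂ] ℂ} (hχ : IsCellProduct a φ ω χ) (x : A) :
    S.prodState ω (S.ev ω (S.diagExp x)) = χ x := by
  obtain ⟨E, hE, hEw⟩ := ha.exists_diagExp hΘ hD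
  have hSE : ∀ x, S.diagExp x = E x := ha.diagExp_unique S.isDiagExp hE
  let i1 : CStarAlgebra (loc a Γᶜ) :=
    StarSubalgebra.cstarAlgebra (loc a Γᶜ) (h_closed := isClosed_loc a Γᶜ)
  let i2 : CStarAlgebra (diagAlg a Γ) :=
    StarSubalgebra.cstarAlgebra (diagAlg a Γ) (h_closed := isClosed_diagAlg a Γ)
  have hps := S.isProductState ω
  have hev := S.isEvaluation ω
  -- States and *-homomorphisms of C*-algebras are contractions; this is where the C*-structures on
  -- the two closed subalgebras enter.
  have hc : ∀ y : diagAlg a Γ, ‖S.prodState ω (S.ev ω y)‖ ≤ 1 * ‖y‖ := by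
    intro y
    rw [one_mul]
    exact (hps.1.norm_apply_le (S.ev ω y)).trans (NonUnitalStarAlgHom.norm_apply_le (S.ev ω) y)
  let Ψ : diagAlg a Γ →L[ℂ] ℂ := LinearMap.mkContinuous
    (S.prodState ω ∘ₗ (S.ev ω).toAlgHom.toLinearMap) 1 hc
  refine ha.ext_words hΘ hD (S := ((Ψ.comp S.diagExp : A →L[ℂ] ℂ) : A →ₗ[ℂ] ℂ)) (T := χ)
    (Ψ.comp S.diagExp).continuous
    (AddMonoidHomClass.continuous_of_bound χ 1 fun x => by
      simpa using hχ.1.norm_apply_le x) ?_ x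
  intro L x hL hx
  change S.prodState ω (S.ev ω (S.diagExp (word L x))) = χ (word L x)
  rw [hχ.2 L x hL hx, hSE]
  let y : (j : starts Γ D) → loc a (block D j) := fun j => ⟨x (Sum.inl j), hx (Sum.inl j)⟩
  let y' : starts Γ D → loc a Γᶜ := fun j => ⟨x (Sum.inl j), loc_mono (hD.block_subset j) (y j).2⟩
  let X : starts Γ D ⊕ Γ → diagAlg a Γ := Sum.elim
    (fun j => ⟨x (Sum.inl j), loc_compl_le_diagAlg a Γ (y' j).2⟩)
    (fun j => ∑ i, extendL (siteState a (j : I) i) (x (Sum.inr j)) •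
      ⟨proj a j i, proj_mem_diagAlg j.2 i⟩)
  have hX : ∀ c, (X c : A) = cellPinch a Γ D c (x c) := by
    rintro (j | j)
    · rfl
    · change _ = pinch a j _
      rw [ha.pinch_eq hΘ j (hx (Sum.inr j))]
      simp only [X, Sum.elim_inr, AddSubmonoidClass.coe_finsetSum]
      rfl
  have hEX : E (word L x) = (L.map X).prod := by
    refine Subtype.ext ?_
    rw [hEw L x hL hx, word, ← StarSubalgebra.coe_subtype, map_list_prod, List.map_map]
    congr 1
    exact List.map_congr_left fun c _ => (hX c).symm
  have hev1 : ∀ j, S.ev ω (X (Sum.inl j)) = y' j := fun j => hev.1 _ _ rfl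
  have hev2 : ∀ j : Γ, S.ev ω (X (Sum.inr j)) = cellState φ ω (Sum.inr j) (x (Sum.inr j)) • 1 := by
    intro j
    simp only [X, Sum.elim_inr, map_sum, map_smul]
    rw [Finset.sum_eq_single (ω j)]
    · rw [hev.2 j (ω j) _ rfl, if_pos rfl]
      rfl
    · intro i _ hi
      rw [hev.2 j i _ rfl, if_neg (Ne.symm hi), smul_zero]
    · simp
  rw [hEX, map_list_prod, List.map_map]
  -- The scalars from the letters over Γ are collected in r, and the block letters are left in their
  -- original order in K, the form to which the product formula applies.
  have key : ∀ L : List (starts Γ D ⊕ Γ), L.Nodup → ∃ (K : List (starts Γ D)) (r : ℂ), K.Nodup ∧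
      (∀ j ∈ K, Sum.inl j ∈ L) ∧ (L.map (S.ev ω ∘ X)).prod = r • (K.map y').prod ∧
      (L.map fun c => cellState φ ω c (x c)).prod = r * (K.map fun j => φ j ω (y j)).prod := by
    intro L
    induction L with
    | nil => exact fun _ => ⟨[], 1, by simp, by simp, by simp, by simp⟩
    | cons c L ih =>
      intro hL
      obtain ⟨K, r, h1, h2, h3, h4⟩ := ih (List.nodup_cons.1 hL).2
      rcases c with j | j
      · refine ⟨j :: K, r, ?_, ?_, ?_, ?_⟩
        · exact List.nodup_cons.2 ⟨fun hj => (List.nodup_cons.1 hL).1 (h2 j hj), h1⟩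
        · intro k hk
          rcases List.mem_cons.1 hk with rfl | hk
          · simp
          · exact List.mem_cons_of_mem _ (h2 k hk)
        · rw [List.map_cons, List.prod_cons, h3, Function.comp_apply, hev1, List.map_cons,
            List.prod_cons, mul_smul_comm]
        · rw [List.map_cons, List.prod_cons, h4, List.map_cons, List.prod_cons,
            show cellState φ ω (Sum.inl j) (x (Sum.inl j)) = φ j ω (y j) from
              extendL_apply _ (hx (Sum.inl j))]
          ring
      · refine ⟨K, cellState φ ω (Sum.inr j) (x (Sum.inr j)) * r, h1, fun k hk =>
          List.mem_cons_of_mem _ (h2 k hk), ?_, ?_⟩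
        · rw [List.map_cons, List.prod_cons, h3, Function.comp_apply, hev2, smul_mul_assoc, one_mul,
            smul_smul]
        · rw [List.map_cons, List.prod_cons, h4]
          ring
  obtain ⟨K, r, h1, -, h3, h4⟩ := key L hL
  rw [h3, h4, map_smul, smul_eq_mul]
  congr 1
  refine hps.2 K y _ h1 ?_
  rw [← StarSubalgebra.coe_subtype, map_list_prod, List.map_map]
  rfl

end Ingredients

/-! ### Conditional independence under the classical Markov measure -/

section Markov

variable {I : Type*} {Γ : Set I}

/-- A function of finitely many spins is measurable and bounded. -/
theorem measurable_of_dependsOn {f : (Γ → Fin 2) → ℂ} {s : Set Γ} (hs : s.Finite)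
    (hf : DependsOn f s) : Measurable f ∧ ∃ C, ∀ ω, ‖f ω‖ ≤ C := by
  have : Finite s := hs
  obtain ⟨F, rfl⟩ := dependsOn_iff_exists_comp.1 hf
  have hr : Measurable (s.domRestrict (π := fun _ : Γ => Fin 2)) := by
    refine measurable_pi_lambda _ fun j => measurable_pi_apply _
  refine ⟨(measurable_of_finite F).comp hr, ?_⟩
  obtain ⟨C, hC⟩ := (Set.finite_range fun x => ‖F x‖).bddAbove
  exact ⟨C, fun ω => hC ⟨_, rfl⟩⟩

theorem integrable_of_dependsOn {f : (Γ → Fin 2) → ℂ} {s : Set Γ} (hs : s.Finite)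
    (hf : DependsOn f s) (μ : Measure (Γ → Fin 2)) [IsProbabilityMeasure μ] : Integrable f μ := by
  obtain ⟨h1, C, hC⟩ := measurable_of_dependsOn hs hf
  exact Integrable.of_bound h1.aestronglyMeasurable C (Filter.Eventually.of_forall hC)

theorem DependsOn.mul' {f g : (Γ → Fin 2) → ℂ} {s t : Set Γ} (hf : DependsOn f s)
    (hg : DependsOn g t) : DependsOn (fun ω => f ω * g ω) (s ∪ t) := by
  intro ω ω' h
  change f ω * g ω = f ω' * g ω'
  rw [hf fun i hi => h i (Or.inl hi), hg fun i hi => h i (Or.inr hi)]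

variable [LinearOrder I]

/-- The cylinder set of the configurations that agree with `η` on `Γ ∩ [k, l]`. -/
def cylinder (Γ : Set I) (k l : I) (η : I → Fin 2) : Set (Γ → Fin 2) :=
  {ω | ∀ j : Γ, (j : I) ∈ Set.Icc k l → ω j = η j}

/-- The indicator function of a cylinder set. -/
noncomputable def cylFun (Γ : Set I) (k l : I) (η : I → Fin 2) : (Γ → Fin 2) → ℂ :=
  (cylinder Γ k l η).indicator fun _ => 1

theorem cylFun_apply (k l : I) (η : I → Fin 2) (ω : Γ → Fin 2) :
    cylFun Γ k l η ω = if ∀ j : Γ, (j : I) ∈ Set.Icc k l → ω j = η j then 1 else 0 := by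
  rw [cylFun, Set.indicator_apply]
  rfl

theorem dependsOn_cylFun (k l : I) (η : I → Fin 2) :
    DependsOn (cylFun Γ k l η) {j : Γ | (j : I) ∈ Set.Icc k l} := by
  intro ω ω' h
  rw [cylFun_apply, cylFun_apply]
  refine if_congr ⟨fun h' j hj => ?_, fun h' j hj => ?_⟩ rfl rfl
  · rw [← h j hj, h' j hj]
  · rw [h j hj, h' j hj]

variable [LocallyFiniteOrder I]

theorem finite_window (Γ : Set I) (k l : I) : {j : Γ | (j : I) ∈ Set.Icc k l}.Finite :=
  (Set.finite_Icc k l).preimage Subtype.val_injective.injOn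

theorem measurableSet_cylinder (k l : I) (η : I → Fin 2) : MeasurableSet (cylinder Γ k l η) := by
  have : cylinder Γ k l η = ⋂ j : Γ, ⋂ _ : (j : I) ∈ Set.Icc k l, {ω | ω j = η j} := by
    ext ω
    simp [cylinder]
  rw [this]
  exact MeasurableSet.iInter fun j => MeasurableSet.iInter fun _ =>
    measurableSet_eq_fun (measurable_pi_apply j) measurable_const

theorem integral_cylFun (μ : Measure (Γ → Fin 2)) (k l : I) (η : I → Fin 2) :
    ∫ ω, cylFun Γ k l η ω ∂μ = μ.real (cylinder Γ k l η) := by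
  rw [cylFun, integral_indicator_const _ (measurableSet_cylinder k l η)]
  simp

/-- A function of the spins in a window is a linear combination of indicators of cylinders. -/
theorem mem_span_cylFun {f : (Γ → Fin 2) → ℂ} {k l : I}
    (hf : DependsOn f {j : Γ | (j : I) ∈ Set.Icc k l}) :
    f ∈ Submodule.span ℂ (Set.range (cylFun Γ k l)) := by
  let G := {j : Γ // (j : I) ∈ Set.Icc k l}
  have : Fintype G := (finite_window Γ k l).fintype
  -- The value 0 outside the window is immaterial, since a cylinder only tests the spins inside it.
  let ext : (G → Fin 2) → I → Fin 2 := fun η j =>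
    if h : ∃ h : j ∈ Γ, j ∈ Set.Icc k l then η ⟨⟨j, h.1⟩, h.2⟩ else 0
  have hext : ∀ (η : G → Fin 2) (j : G), ext η ((j : Γ) : I) = η j := by
    intro η j
    simp only [ext]
    rw [dif_pos ⟨j.1.2, j.2⟩]
  have : f = ∑ η : G → Fin 2, f (fun j => ext η j) • cylFun Γ k l (ext η) := by
    funext ω
    rw [Finset.sum_apply, Finset.sum_eq_single fun j : G => ω j]
    · rw [Pi.smul_apply, cylFun_apply, if_pos, smul_eq_mul, mul_one]
      · exact hf fun j hj => (hext (fun j : G => ω j.1) ⟨j, hj⟩).symm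
      · exact fun j hj => (hext (fun j : G => ω j.1) ⟨j, hj⟩).symm
    · intro η _ hη
      rw [Pi.smul_apply, cylFun_apply, if_neg, smul_zero]
      intro h
      refine hη (funext fun j => ?_)
      rw [h j.1 j.2, hext]
    · simp
  rw [this]
  exact Submodule.sum_mem _ fun η _ =>
    Submodule.smul_mem _ _ (Submodule.subset_span ⟨_, rfl⟩)

variable [PredOrder I]

/-- The Markov property on cylinders. -/
theorem IsMarkovMeasure.cylinder_mul {π : I → Fin 2 → ℝ} {p : I → Fin 2 → Fin 2 → ℝ}
    {μ : Measure (Γ → Fin 2)} (hμ : IsMarkovMeasure Γ π p μ) {k n l : I} (hk : k ≤ n) (hl : n ≤ l)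
    (η : I → Fin 2) :
    μ.real (cylinder Γ k l η) * μ.real (cylinder Γ n n η) =
      μ.real (cylinder Γ k n η) * μ.real (cylinder Γ n l η) := by
  have h := fun k l => hμ k l η
  simp only [Finset.prod_filter] at h
  have hsplit : ∀ k, k ≤ n → Finset.Icc k l = Finset.Icc k n ∪ Finset.Ioc n l := by
    intro k hk
    ext j
    simp only [Finset.mem_union, Finset.mem_Icc, Finset.mem_Ioc]
    constructor
    · rintro ⟨h1, h2⟩
      rcases le_or_gt j n with h3 | h3
      exacts [Or.inl ⟨h1, h3⟩, Or.inr ⟨h3, h2⟩]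
    · rintro (⟨h1, h2⟩ | ⟨h1, h2⟩)
      exacts [⟨h1, h2.trans hl⟩, ⟨hk.trans h1.le, h2⟩]
  have hdisj : ∀ k, Disjoint (Finset.Icc k n) (Finset.Ioc n l) := by
    intro k
    rw [Finset.disjoint_left]
    intro j hj hj'
    exact absurd (Finset.mem_Icc.1 hj).2 (not_le.2 (Finset.mem_Ioc.1 hj').1)
  -- Beyond n the factors do not notice whether the window starts at k or at n, as both k < j and n
  -- < j hold there. All four cylinders then share the same two kinds of factors.
  have hswap : ∏ j ∈ Finset.Ioc n l, (if j ∈ Γ then if k < j ∧ Order.pred j ∈ Γ then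
        p (Order.pred j) (η (Order.pred j)) (η j) else π j (η j) else 1) =
      ∏ j ∈ Finset.Ioc n l, (if j ∈ Γ then if n < j ∧ Order.pred j ∈ Γ then
        p (Order.pred j) (η (Order.pred j)) (η j) else π j (η j) else 1) := by
    refine Finset.prod_congr rfl fun j hj => ?_
    have h1 := (Finset.mem_Ioc.1 hj).1
    simp only [h1, hk.trans_lt h1, true_and]
  change μ.real {ω | _} * μ.real {ω | _} = μ.real {ω | _} * μ.real {ω | _}
  rw [h k l, h k n, h n l, h n n, hsplit k hk, hsplit n le_rfl, Finset.prod_union (hdisj k),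
    Finset.prod_union (hdisj n), hswap]
  ring

/-- The Markov property for functions of finitely many spins. -/
theorem IsMarkovMeasure.integral_mul {π : I → Fin 2 → ℝ} {p : I → Fin 2 → Fin 2 → ℝ}
    {μ : Measure (Γ → Fin 2)} [IsProbabilityMeasure μ] (hμ : IsMarkovMeasure Γ π p μ) (n : I)
    (η : I → Fin 2) {f g : (Γ → Fin 2) → ℂ} {s t : Set Γ} (hs : s.Finite) (ht : t.Finite)
    (hsn : ∀ j ∈ s, (j : I) ≤ n) (htn : ∀ j ∈ t, n ≤ (j : I))
    (hf : DependsOn f s) (hg : DependsOn g t) :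
    (∫ ω, cylFun Γ n n η ω * (f ω * g ω) ∂μ) * ∫ ω, cylFun Γ n n η ω ∂μ =
      (∫ ω, cylFun Γ n n η ω * f ω ∂μ) * ∫ ω, cylFun Γ n n η ω * g ω ∂μ := by
  -- Adding n to the finite set of sites makes it nonempty and forces the window to reach n.
  obtain ⟨k, hk, hks⟩ : ∃ k ≤ n, ∀ j ∈ s, k ≤ (j : I) := by
    let F : Finset I := insert n (hs.toFinset.image Subtype.val)
    have hF : F.Nonempty := ⟨n, by simp [F]⟩
    refine ⟨F.min' hF, F.min'_le n (by simp [F]), fun j hj => F.min'_le _ ?_⟩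
    simp only [F, Finset.mem_insert, Finset.mem_image, Set.Finite.mem_toFinset]
    exact Or.inr ⟨j, hj, rfl⟩
  obtain ⟨l, hl, hlt⟩ : ∃ l ≥ n, ∀ j ∈ t, (j : I) ≤ l := by
    let F : Finset I := insert n (ht.toFinset.image Subtype.val)
    have hF : F.Nonempty := ⟨n, by simp [F]⟩
    refine ⟨F.max' hF, F.le_max' n (by simp [F]), fun j hj => F.le_max' _ ?_⟩
    simp only [F, Finset.mem_insert, Finset.mem_image, Set.Finite.mem_toFinset]
    exact Or.inr ⟨j, hj, rfl⟩
  have hf' : DependsOn f {j : Γ | (j : I) ∈ Set.Icc k n} :=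
    hf.mono fun j hj => ⟨hks j hj, hsn j hj⟩
  have hg' : DependsOn g {j : Γ | (j : I) ∈ Set.Icc n l} :=
    hg.mono fun j hj => ⟨htn j hj, hlt j hj⟩
  -- The identity is bilinear in f and g, so cylinder indicators suffice. If one of them contradicts
  -- η at n, both sides vanish; otherwise the three patterns glue to a single η', and the Markov
  -- property on cylinders applies.
  have core : ∀ η₁ η₂ : I → Fin 2,
      (∫ ω, cylFun Γ n n η ω * (cylFun Γ k n η₁ ω * cylFun Γ n l η₂ ω) ∂μ) *
        ∫ ω, cylFun Γ n n η ω ∂μ =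
      (∫ ω, cylFun Γ n n η ω * cylFun Γ k n η₁ ω ∂μ) *
        ∫ ω, cylFun Γ n n η ω * cylFun Γ n l η₂ ω ∂μ := by
    intro η₁ η₂
    by_cases h : ∃ h : n ∈ Γ, η₁ n ≠ η n ∨ η₂ n ≠ η n
    · obtain ⟨hn, h⟩ := h
      have hz : ∀ η' k' l', k' ≤ n → n ≤ l' → η' n ≠ η n → ∀ ω : Γ → Fin 2,
          cylFun Γ n n η ω * cylFun Γ k' l' η' ω = 0 := by
        intro η' k' l' hk' hl' hne ω
        rw [cylFun_apply, cylFun_apply]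
        by_contra hcon
        have h1 : ∀ j : Γ, (j : I) ∈ Set.Icc n n → ω j = η j := by
          by_contra h1
          exact hcon (by rw [if_neg h1, zero_mul])
        have h2 : ∀ j : Γ, (j : I) ∈ Set.Icc k' l' → ω j = η' j := by
          by_contra h2
          exact hcon (by rw [if_neg h2, mul_zero])
        exact hne ((h2 ⟨n, hn⟩ ⟨hk', hl'⟩).symm.trans (h1 ⟨n, hn⟩ ⟨le_rfl, le_rfl⟩))
      rcases h with h | h
      · have h1 := hz η₁ k n hk le_rfl h
        have h2 : ∀ ω, cylFun Γ n n η ω * (cylFun Γ k n η₁ ω * cylFun Γ n l η₂ ω) = 0 := fun ω => by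
          rw [← mul_assoc, h1, zero_mul]
        simp only [h1, h2, integral_zero, zero_mul]
      · have h1 := hz η₂ n l le_rfl hl h
        have h2 : ∀ ω, cylFun Γ n n η ω * (cylFun Γ k n η₁ ω * cylFun Γ n l η₂ ω) = 0 := fun ω => by
          rw [mul_left_comm, h1, mul_zero]
        simp only [h1, h2, integral_zero, zero_mul, mul_zero]
    · push Not at h
      let η' : I → Fin 2 := fun j => if j ≤ n then η₁ j else η₂ j
      have e1 : ∀ j ∈ Γ, j ≤ n → η' j = η₁ j := fun j _ hj => if_pos hj
      have e2 : ∀ j ∈ Γ, n ≤ j → η' j = η₂ j := by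
        intro j hjΓ hj
        by_cases hjn : j ≤ n
        · obtain rfl := le_antisymm hj hjn
          rw [e1 _ hjΓ hj, (h hjΓ).1, (h hjΓ).2]
        · exact if_neg hjn
      have e3 : ∀ j ∈ Γ, j = n → η' j = η j := by
        rintro j hjΓ rfl
        rw [e1 _ hjΓ le_rfl, (h hjΓ).1]
      have hc1 : cylFun Γ k n η₁ = cylFun Γ k n η' := by
        funext ω
        rw [cylFun_apply, cylFun_apply]
        refine if_congr (forall_congr' fun j => imp_congr_right fun hj => ?_) rfl rfl
        rw [e1 j j.2 hj.2]
      have hc2 : cylFun Γ n l η₂ = cylFun Γ n l η' := by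
        funext ω
        rw [cylFun_apply, cylFun_apply]
        refine if_congr (forall_congr' fun j => imp_congr_right fun hj => ?_) rfl rfl
        rw [e2 j j.2 hj.1]
      have hc3 : cylFun Γ n n η = cylFun Γ n n η' := by
        funext ω
        rw [cylFun_apply, cylFun_apply]
        refine if_congr (forall_congr' fun j => imp_congr_right fun hj => ?_) rfl rfl
        rw [e3 j j.2 (le_antisymm hj.2 hj.1)]
      have hsub : ∀ k' l', k' ≤ n → n ≤ l' → ∀ ω : Γ → Fin 2,
          cylFun Γ n n η' ω * cylFun Γ k' l' η' ω = cylFun Γ k' l' η' ω := by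
        intro k' l' hk' hl' ω
        rw [cylFun_apply n n, cylFun_apply k' l']
        by_cases h1 : ∀ j : Γ, (j : I) ∈ Set.Icc k' l' → ω j = η' j
        · rw [if_pos h1, mul_one, if_pos]
          exact fun j hj => h1 j ⟨hk'.trans hj.1, hj.2.trans hl'⟩
        · rw [if_neg h1, mul_zero]
      have hglue : ∀ ω : Γ → Fin 2, cylFun Γ k n η' ω * cylFun Γ n l η' ω = cylFun Γ k l η' ω := by
        intro ω
        rw [cylFun_apply, cylFun_apply, cylFun_apply, ite_zero_mul_ite_zero, mul_one]
        refine if_congr ⟨?_, ?_⟩ rfl rfl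
        · rintro ⟨h1, h2⟩ j hj
          rcases le_total (j : I) n with h3 | h3
          exacts [h1 j ⟨hj.1, h3⟩, h2 j ⟨h3, hj.2⟩]
        · intro h1
          exact ⟨fun j hj => h1 j ⟨hj.1, hj.2.trans hl⟩, fun j hj => h1 j ⟨hk.trans hj.1, hj.2⟩⟩
      simp only [hc1, hc2, hc3, hglue, hsub _ _ hk le_rfl, hsub _ _ le_rfl hl, hsub _ _ hk hl,
        integral_cylFun]
      exact_mod_cast hμ.cylinder_mul hk hl η'
  have hfin := finite_window Γ
  have hint : ∀ {u : (Γ → Fin 2) → ℂ} {k' l'}, DependsOn u {j : Γ | (j : I) ∈ Set.Icc k' l'} →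
      Integrable (fun ω => cylFun Γ n n η ω * u ω) μ := fun hu =>
    integrable_of_dependsOn ((hfin _ _).union (hfin _ _)) (DependsOn.mul' (dependsOn_cylFun n n η) hu) μ
  have hint2 : ∀ {u v : (Γ → Fin 2) → ℂ}, DependsOn u {j : Γ | (j : I) ∈ Set.Icc k n} →
      DependsOn v {j : Γ | (j : I) ∈ Set.Icc n l} →
      Integrable (fun ω => cylFun Γ n n η ω * (u ω * v ω)) μ := fun hu hv =>
    integrable_of_dependsOn ((hfin _ _).union ((hfin _ _).union (hfin _ _)))
      (DependsOn.mul' (dependsOn_cylFun n n η) (DependsOn.mul' hu hv)) μ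
  have step1 : ∀ η₁, (∫ ω, cylFun Γ n n η ω * (cylFun Γ k n η₁ ω * g ω) ∂μ) *
        ∫ ω, cylFun Γ n n η ω ∂μ =
      (∫ ω, cylFun Γ n n η ω * cylFun Γ k n η₁ ω ∂μ) * ∫ ω, cylFun Γ n n η ω * g ω ∂μ := by
    intro η₁
    have hf₁ := dependsOn_cylFun (Γ := Γ) k n η₁
    -- The dependence on the window is carried through the span induction because additivity of the
    -- integral needs integrability of each summand.
    suffices DependsOn g {j : Γ | (j : I) ∈ Set.Icc n l} ∧ _ from this.2
    refine Submodule.span_induction (p := fun g _ => DependsOn g {j : Γ | (j : I) ∈ Set.Icc n l} ∧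
      (∫ ω, cylFun Γ n n η ω * (cylFun Γ k n η₁ ω * g ω) ∂μ) * ∫ ω, cylFun Γ n n η ω ∂μ =
      (∫ ω, cylFun Γ n n η ω * cylFun Γ k n η₁ ω ∂μ) * ∫ ω, cylFun Γ n n η ω * g ω ∂μ)
      ?_ ?_ ?_ ?_ (mem_span_cylFun hg')
    · rintro _ ⟨η₂, rfl⟩
      exact ⟨dependsOn_cylFun n l η₂, core η₁ η₂⟩
    · exact ⟨fun _ _ _ => rfl, by simp⟩
    · rintro u v _ _ ⟨hu, hu'⟩ ⟨hv, hv'⟩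
      refine ⟨fun ω ω' h => ?_, ?_⟩
      · rw [Pi.add_apply, Pi.add_apply, hu h, hv h]
      · simp only [Pi.add_apply, mul_add]
        rw [integral_add (hint2 hf₁ hu) (hint2 hf₁ hv), integral_add (hint hu) (hint hv), add_mul,
          hu', hv', mul_add]
    · rintro r u _ ⟨hu, hu'⟩
      refine ⟨fun ω ω' h => ?_, ?_⟩
      · rw [Pi.smul_apply, Pi.smul_apply, hu h]
      · simp only [Pi.smul_apply, mul_smul_comm]
        rw [integral_smul, integral_smul, smul_mul_assoc, hu', mul_smul_comm]
  suffices DependsOn f {j : Γ | (j : I) ∈ Set.Icc k n} ∧ _ from this.2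
  refine Submodule.span_induction (p := fun f _ => DependsOn f {j : Γ | (j : I) ∈ Set.Icc k n} ∧
    (∫ ω, cylFun Γ n n η ω * (f ω * g ω) ∂μ) * ∫ ω, cylFun Γ n n η ω ∂μ =
    (∫ ω, cylFun Γ n n η ω * f ω ∂μ) * ∫ ω, cylFun Γ n n η ω * g ω ∂μ)
    ?_ ?_ ?_ ?_ (mem_span_cylFun hf')
  · rintro _ ⟨η₁, rfl⟩
    exact ⟨dependsOn_cylFun k n η₁, step1 η₁⟩
  · exact ⟨fun _ _ _ => rfl, by simp⟩
  · rintro u v _ _ ⟨hu, hu'⟩ ⟨hv, hv'⟩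
    refine ⟨fun ω ω' h => ?_, ?_⟩
    · rw [Pi.add_apply, Pi.add_apply, hu h, hv h]
    · simp only [Pi.add_apply, mul_add, add_mul]
      rw [integral_add (hint2 hu hg') (hint2 hv hg'), integral_add (hint hu) (hint hv), add_mul,
        hu', hv', add_mul]
  · rintro r u _ ⟨hu, hu'⟩
    refine ⟨fun ω ω' h => ?_, ?_⟩
    · rw [Pi.smul_apply, Pi.smul_apply, hu h]
    · simp only [Pi.smul_apply, mul_smul_comm, smul_mul_assoc]
      rw [integral_smul, integral_smul, smul_mul_assoc, hu', smul_mul_assoc]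

end Markov

/-! ### Which spins a cell state reads -/

section Dependence

variable {I : Type*} [LinearOrder I] [SuccOrder I] {A : Type*} [CStarAlgebra A] {a : I → A}
  {Γ D : Set I} {φ : (j : starts Γ D) → (Γ → Fin 2) → (loc a (block D j) →ₗ[ℂ] ℂ)}

theorem dependsOn_cellState_inl {j : starts Γ D} {s : Set Γ} (h : DependsOn (φ j) s) :
    DependsOn (fun ω => cellState φ ω (Sum.inl j)) s := by
  intro ω ω' hω
  change extendL (φ j ω) = extendL (φ j ω')
  rw [h hω]

theorem dependsOn_cellState_inr (j : Γ) :
    DependsOn (fun ω => cellState φ ω (Sum.inr j)) {j} := by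
  intro ω ω' hω
  change extendL (siteState a (j : I) (ω j)) = extendL (siteState a (j : I) (ω' j))
  rw [hω j rfl]

theorem finite_pred_set (hΓ : ∀ n ∈ Γ, ¬ IsMax n) (j : I) :
    {i : Γ | Order.succ (i : I) = j}.Finite := by
  refine Set.Subsingleton.finite ?_
  intro i hi i' hi'
  have hi : Order.succ (i : I) = j := hi
  have hi' : Order.succ (i' : I) = j := hi'
  exact Subtype.ext ((Order.succ_eq_succ_iff_of_not_isMax (hΓ i i.2) (hΓ i' i'.2)).1
    (hi.trans hi'.symm))

theorem finite_succ_set (j : I) : {i : Γ | (i : I) = Order.succ j}.Finite :=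
  Set.Subsingleton.finite fun _ hi _ hi' => Subtype.ext (Eq.trans hi (Eq.symm hi'))

/-- A block state depends at most on the spin before or on the spin after the block. -/
theorem IsBlockFamily.dependsOn (hφ : IsBlockFamily a Γ D φ) (j : starts Γ D) :
    DependsOn (φ j) ∅ ∨ DependsOn (φ j) {i : Γ | Order.succ (i : I) = j} ∨
      DependsOn (φ j) {i : Γ | (i : I) = Order.succ (j : I)} := by
  by_cases hj : (j : I) ∈ D
  · exact Or.inl fun ω ω' _ => hφ.two_step j hj ω ω'
  · exact Or.inr ((hφ.one_step j hj).imp (fun h ω ω' hω => h ω ω' hω)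
      (fun h ω ω' hω => h ω ω' hω))

theorem IsBlockFamily.exists_dependsOn (hΓ : ∀ n ∈ Γ, ¬ IsMax n) (hφ : IsBlockFamily a Γ D φ)
    (c : starts Γ D ⊕ Γ) :
    ∃ s : Set Γ, s.Finite ∧ DependsOn (fun ω => cellState φ ω c) s := by
  rcases c with j | j
  · rcases hφ.dependsOn j with h | h | h
    · exact ⟨_, Set.finite_empty, dependsOn_cellState_inl h⟩
    · exact ⟨_, finite_pred_set hΓ _, dependsOn_cellState_inl h⟩
    · exact ⟨_, finite_succ_set _, dependsOn_cellState_inl h⟩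
  · exact ⟨_, Set.finite_singleton j, dependsOn_cellState_inr j⟩

/-- The cell state depends on finitely many spins, all of them in `W`. -/
def DependsWithin (φ : (j : starts Γ D) → (Γ → Fin 2) → (loc a (block D j) →ₗ[ℂ] ℂ))
    (W : Set I) (c : starts Γ D ⊕ Γ) : Prop :=
  ∃ s : Set Γ, s.Finite ∧ (∀ i ∈ s, (i : I) ∈ W) ∧ DependsOn (fun ω => cellState φ ω c) s

/-- A block before n reads at most the spin next to it, and even the one on its right is at most n.
-/
theorem IsBlockFamily.dependsWithin_Iic (hΓ : ∀ n ∈ Γ, ¬ IsMax n) (hφ : IsBlockFamily a Γ D φ)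
    {n : I} {c : starts Γ D ⊕ Γ} (hc : cell Γ D c ⊆ Set.Iio n) :
    DependsWithin φ (Set.Iic n) c := by
  rcases c with j | j
  · have hj : (j : I) < n := hc (Or.inl rfl)
    rcases hφ.dependsOn j with h | h | h
    · exact ⟨_, Set.finite_empty, by simp, dependsOn_cellState_inl h⟩
    · refine ⟨_, finite_pred_set hΓ _, fun i hi => ?_, dependsOn_cellState_inl h⟩
      have hi : Order.succ (i : I) = j := hi
      exact (Order.le_succ (i : I)).trans (hi.le.trans hj.le)
    · refine ⟨_, finite_succ_set _, fun i hi => ?_, dependsOn_cellState_inl h⟩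
      have hi : (i : I) = Order.succ (j : I) := hi
      exact hi.le.trans (Order.succ_le_of_lt hj)
  · have hj : (j : I) < n := hc rfl
    exact ⟨_, Set.finite_singleton j, by simpa using hj.le, dependsOn_cellState_inr j⟩

/-- A block that starts at n + 1 reads at most the spin at n or the spin after n + 1. -/
theorem IsBlockFamily.dependsWithin_Ici (hΓ : ∀ n ∈ Γ, ¬ IsMax n) (hφ : IsBlockFamily a Γ D φ)
    {n : I} (hn : ¬ IsMax n) (hs : Order.succ n ∈ starts Γ D) :
    DependsWithin φ (Set.Ici n) (Sum.inl ⟨Order.succ n, hs⟩) := by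
  rcases hφ.dependsOn ⟨Order.succ n, hs⟩ with h | h | h
  · exact ⟨_, Set.finite_empty, by simp, dependsOn_cellState_inl h⟩
  · refine ⟨_, finite_pred_set hΓ _, fun i hi => ?_, dependsOn_cellState_inl h⟩
    have hi : Order.succ (i : I) = Order.succ n := hi
    exact ((Order.succ_eq_succ_iff_of_not_isMax (hΓ i i.2) hn).1 hi).ge
  · refine ⟨_, finite_succ_set _, fun i hi => ?_, dependsOn_cellState_inl h⟩
    have hi : (i : I) = Order.succ (Order.succ n) := hi
    exact ((Order.le_succ n).trans (Order.le_succ _)).trans hi.ge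

theorem dependsWithin_inr {W : Set I} (j : Γ) (hj : (j : I) ∈ W) :
    DependsWithin φ W (Sum.inr j) :=
  ⟨_, Set.finite_singleton j, by simpa using hj, dependsOn_cellState_inr j⟩

/-- The cell that contains the successor of a site that is not the left site of a block. -/
theorem IsBlockFamily.exists_cell_succ (hΓ : ∀ n ∈ Γ, ¬ IsMax n) (hD : IsTwoStepSet Γ D)
    (hφ : IsBlockFamily a Γ D φ) {n : I} (hn : ¬ IsMax n) (hnD : n ∉ D) :
    ∃ c, Order.succ n ∈ cell Γ D c ∧ ¬ cell Γ D c ⊆ Set.Iic n ∧ DependsWithin φ (Set.Ici n) c := by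
  have hlt : ¬ Order.succ n ≤ n := not_le.2 (Order.lt_succ_of_not_isMax hn)
  by_cases h : Order.succ n ∈ Γ
  · exact ⟨Sum.inr ⟨_, h⟩, rfl, fun hc => hlt (hc rfl),
      dependsWithin_inr _ (Order.le_succ n)⟩
  · have hs : Order.succ n ∈ starts Γ D := by
      refine ⟨h, fun i hi his => hnD ?_⟩
      rwa [← (Order.succ_eq_succ_iff_of_not_isMax (hD i hi).1 hn).1 his]
    exact ⟨Sum.inl ⟨_, hs⟩, Or.inl rfl, fun hc => hlt (hc (Or.inl rfl)),
      hφ.dependsWithin_Ici hΓ hn hs⟩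

theorem dependsOn_list_prod {W : Set I} {L : List (starts Γ D ⊕ Γ)} (x : starts Γ D ⊕ Γ → A)
    (h : ∀ c ∈ L, DependsWithin φ W c) :
    ∃ s : Set Γ, s.Finite ∧ (∀ i ∈ s, (i : I) ∈ W) ∧
      DependsOn (fun ω => (L.map fun c => cellState φ ω c (x c)).prod) s := by
  induction L with
  | nil => exact ⟨∅, Set.finite_empty, by simp, fun _ _ _ => rfl⟩
  | cons c L ih =>
    obtain ⟨s, h1, h2, h3⟩ := ih fun c hc => h c (List.mem_cons_of_mem _ hc)
    obtain ⟨s', h1', h2', h3'⟩ := h c (by simp)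
    refine ⟨s' ∪ s, h1'.union h1, ?_, ?_⟩
    · rintro i (hi | hi)
      exacts [h2' i hi, h2 i hi]
    · intro ω ω' hω
      simp only [List.map_cons, List.prod_cons]
      have e1 : cellState φ ω c = cellState φ ω' c := h3' fun i hi => hω i (Or.inl hi)
      have e2 : (L.map fun c => cellState φ ω c (x c)).prod =
        (L.map fun c => cellState φ ω' c (x c)).prod := h3 fun i hi => hω i (Or.inr hi)
      rw [e1, e2]

end Dependence

/-! ### The mixed state and its Markov property -/

section Mixture

variable {I : Type*} [LinearOrder I] [SuccOrder I] {A : Type*} [CStarAlgebra A] {a : I → A}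
  {Γ D : Set I} {φ : (j : starts Γ D) → (Γ → Fin 2) → (loc a (block D j) →ₗ[ℂ] ℂ)}

theorem IsCellProduct.word_mul_word {ω : Γ → Fin 2} {χ : A →ₗ[ℂ] ℂ} (hχ : IsCellProduct a φ ω χ)
    {L L' : List (starts Γ D ⊕ Γ)} (hL : (L ++ L').Nodup) {x x' : starts Γ D ⊕ Γ → A}
    (hx : ∀ c, x c ∈ loc a (cell Γ D c)) (hx' : ∀ c, x' c ∈ loc a (cell Γ D c)) :
    χ (word L x * word L' x') = (L.map fun c => cellState φ ω c (x c)).prod *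
      (L'.map fun c => cellState φ ω c (x' c)).prod := by
  let X : starts Γ D ⊕ Γ → A := fun c => if c ∈ L then x c else x' c
  have h1 : ∀ c ∈ L, X c = x c := fun c hc => if_pos hc
  have h2 : ∀ c ∈ L', X c = x' c := fun c hc => if_neg fun hc' =>
    (List.nodup_append.1 hL).2.2 c hc' c hc rfl
  have := hχ.2 (L ++ L') X hL fun c => by
    simp only [X]
    split_ifs
    exacts [hx c, hx' c]
  rw [word, List.map_append, List.prod_append, List.map_append, List.prod_append,
    List.map_congr_left h1, List.map_congr_left h2] at this
  rw [word, word, this]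
  congr 2
  · exact List.map_congr_left fun c hc => by rw [h1 c hc]
  · exact List.map_congr_left fun c hc => by rw [h2 c hc]

/-- The parity acts letter by letter on words, and every cell state is even. -/
theorem IsCellProduct.parity [Nontrivial A] (ha : IsCAR a) {Θ : A ≃⋆ₐ[ℂ] A} (hΘ : IsParity a Θ)
    (hD : IsTwoStepSet Γ D) (hφ : IsBlockFamily a Γ D φ) {ω : Γ → Fin 2} {χ : A →ₗ[ℂ] ℂ}
    (hχ : IsCellProduct a φ ω χ) (x : A) : χ (Θ x) = χ x := by
  have hc : Continuous χ := AddMonoidHomClass.continuous_of_bound χ 1 fun x => by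
    simpa using hχ.1.norm_apply_le x
  refine ha.ext_words hΘ hD (S := χ ∘ₗ (Θ : A →ₗ[ℂ] A)) (T := χ)
    (hc.comp IsParity.continuous) hc ?_ x
  intro L x hL hx
  change χ (Θ (word L x)) = χ (word L x)
  have : Θ (word L x) = word L fun c => Θ (x c) := by
    rw [word, map_list_prod, List.map_map]
    rfl
  rw [this, hχ.2 L _ hL fun c => hΘ.mem_loc (hx c), hχ.2 L x hL hx]
  congr 1
  exact List.map_congr_left fun c _ => (hφ.isEvenStateOn ha hΘ ω c).even _ (hx c)

/-- On words only finitely many spins matter. The bound |χ_ω(x)| ≤ ‖x‖ turns norm convergence of x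
into pointwise convergence in ω, so measurability survives the closure. -/
theorem IsCellProduct.measurable [Countable I] [Nontrivial A] (ha : IsCAR a) {Θ : A ≃⋆ₐ[ℂ] A}
    (hΘ : IsParity a Θ) (hΓ : ∀ n ∈ Γ, ¬ IsMax n) (hD : IsTwoStepSet Γ D)
    (hφ : IsBlockFamily a Γ D φ) {χ : (Γ → Fin 2) → A →ₗ[ℂ] ℂ}
    (hχ : ∀ ω, IsCellProduct a φ ω (χ ω)) (x : A) : Measurable fun ω => χ ω x := by
  let M : Submodule ℂ A :=
    { carrier := {x | Measurable fun ω => χ ω x}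
      add_mem' := by
        intro x y hx hy
        have hx : Measurable fun ω => χ ω x := hx
        have hy : Measurable fun ω => χ ω y := hy
        change Measurable fun ω => χ ω (x + y)
        simp only [map_add]
        exact hx.add hy
      zero_mem' := by
        change Measurable fun ω => χ ω 0
        simp
      smul_mem' := by
        intro r x hx
        have hx : Measurable fun ω => χ ω x := hx
        change Measurable fun ω => χ ω (r • x)
        simp only [map_smul]
        exact hx.const_smul r }
  have hM : IsClosed (M : Set A) := by
    refine IsSeqClosed.isClosed fun u x hu hx => ?_
    change Measurable fun ω => χ ω x
    refine measurable_of_tendsto_metrizable hu (tendsto_pi_nhds.2 fun ω => ?_)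
    have hc : Continuous (χ ω) := AddMonoidHomClass.continuous_of_bound (χ ω) 1 fun x => by
      simpa using (hχ ω).1.norm_apply_le x
    exact (hc.tendsto x).comp hx
  refine ha.mem_of_forall_word hΘ hD.isPartition hD.univ_cover M hM ?_ (ha.mem_loc_univ x)
  intro L x hL _ hx
  change Measurable fun ω => χ ω (word L x)
  simp only [fun ω => (hχ ω).2 L x hL hx]
  obtain ⟨s, h1, -, h3⟩ := dependsOn_list_prod (φ := φ) (W := Set.univ) (L := L) x fun c _ =>
    let ⟨s, h1, h2⟩ := hφ.exists_dependsOn hΓ c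
    ⟨s, h1, by simp, h2⟩
  exact (measurable_of_dependsOn h1 h3).1

/-- `ψ` is the mixture of the functionals `χ ω`. -/
structure IsMixture (μ : Measure (Γ → Fin 2)) (χ : (Γ → Fin 2) → A →ₗ[ℂ] ℂ) (ψ : A →ₗ[ℂ] ℂ) :
    Prop where
  isState : IsState ψ
  integrable : ∀ x, Integrable (fun ω => χ ω x) μ
  eq : ∀ x, ψ x = ∫ ω, χ ω x ∂μ

theorem IsCellProduct.exists_mixture [Countable I] [Nontrivial A] (ha : IsCAR a) {Θ : A ≃⋆ₐ[ℂ] A}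
    (hΘ : IsParity a Θ) (hΓ : ∀ n ∈ Γ, ¬ IsMax n) (hD : IsTwoStepSet Γ D)
    (hφ : IsBlockFamily a Γ D φ) {χ : (Γ → Fin 2) → A →ₗ[ℂ] ℂ}
    (hχ : ∀ ω, IsCellProduct a φ ω (χ ω)) (μ : Measure (Γ → Fin 2)) [IsProbabilityMeasure μ] :
    ∃ ψ, IsMixture μ χ ψ := by
  have hint : ∀ x, Integrable (fun ω => χ ω x) μ := fun x =>
    Integrable.of_bound (IsCellProduct.measurable ha hΘ hΓ hD hφ hχ x).aestronglyMeasurable ‖x‖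
      (Eventually.of_forall fun ω => (hχ ω).1.norm_apply_le x)
  refine ⟨{ toFun := fun x => ∫ ω, χ ω x ∂μ, map_add' := ?_, map_smul' := ?_ },
    ⟨?_, fun x => ?_⟩, hint, fun x => rfl⟩
  · intro x y
    simp only [map_add]
    exact integral_add (hint x) (hint y)
  · intro r x
    simp only [map_smul]
    exact integral_smul r _
  · change ∫ ω, χ ω 1 ∂μ = 1
    simp [fun ω => (hχ ω).1.1]
  · exact integral_nonneg fun ω => (hχ ω).1.2 x

omit [LinearOrder I] [SuccOrder I] in
theorem IsMixture.continuous {μ : Measure (Γ → Fin 2)} {χ : (Γ → Fin 2) → A →ₗ[ℂ] ℂ}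
    {ψ : A →ₗ[ℂ] ℂ} (hψ : IsMixture μ χ ψ) : Continuous ψ :=
  AddMonoidHomClass.continuous_of_bound ψ 1 fun x => by
    simpa using hψ.isState.norm_apply_le x

theorem IsMixture.parity [Nontrivial A] (ha : IsCAR a) {Θ : A ≃⋆ₐ[ℂ] A} (hΘ : IsParity a Θ)
    (hD : IsTwoStepSet Γ D) (hφ : IsBlockFamily a Γ D φ) {μ : Measure (Γ → Fin 2)}
    {χ : (Γ → Fin 2) → A →ₗ[ℂ] ℂ} (hχ : ∀ ω, IsCellProduct a φ ω (χ ω))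
    {ψ : A →ₗ[ℂ] ℂ} (hψ : IsMixture μ χ ψ) (x : A) : ψ (Θ x) = ψ x := by
  simp only [hψ.eq, fun ω => (hχ ω).parity ha hΘ hD hφ x]

theorem IsMixture.isEvenStateOn [Nontrivial A] (ha : IsCAR a) {Θ : A ≃⋆ₐ[ℂ] A} (hΘ : IsParity a Θ)
    (hD : IsTwoStepSet Γ D) (hφ : IsBlockFamily a Γ D φ) {μ : Measure (Γ → Fin 2)}
    {χ : (Γ → Fin 2) → A →ₗ[ℂ] ℂ} (hχ : ∀ ω, IsCellProduct a φ ω (χ ω))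
    {ψ : A →ₗ[ℂ] ℂ} (hψ : IsMixture μ χ ψ) (b : Set I) : IsEvenStateOn a Θ b ψ where
  map_one := hψ.isState.1
  nonneg x _ := hψ.isState.2 x
  even x _ := hψ.parity ha hΘ hD hφ hχ x

/-- The Markov property of the mixture. -/
theorem IsMixture.markov [LocallyFiniteOrder I] [PredOrder I] (ha : IsCAR a)
    {Θ : A ≃⋆ₐ[ℂ] A} (hΘ : IsParity a Θ) (hD : IsTwoStepSet Γ D)
    {μ : Measure (Γ → Fin 2)} [IsProbabilityMeasure μ] {π : I → Fin 2 → ℝ}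
    {p : I → Fin 2 → Fin 2 → ℝ} (hμ : IsMarkovMeasure Γ π p μ)
    {χ : (Γ → Fin 2) → A →ₗ[ℂ] ℂ} (hχ : ∀ ω, IsCellProduct a φ ω (χ ω))
    {ψ : A →ₗ[ℂ] ℂ} (hψ : IsMixture μ χ ψ) (n : I) (η : I → Fin 2)
    {W : Set I} (hW : ∀ j ∈ W, ∃ c, j ∈ cell Γ D c ∧ cell Γ D c ⊆ W)
    (hleft : ∀ c, cell Γ D c ⊆ W → DependsWithin φ (Set.Iic n) c)
    {Q L : List (starts Γ D ⊕ Γ)} (hQL : (Q ++ L).Nodup) (hnot : ∀ c ∈ Q ++ L, ¬ cell Γ D c ⊆ W)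
    (hright : ∀ c ∈ L, DependsWithin φ (Set.Ici n) c)
    {y : starts Γ D ⊕ Γ → A} (hy : ∀ c, y c ∈ loc a (cell Γ D c))
    (hQ : ∀ ω, (Q.map fun c => cellState φ ω c (y c)).prod = cylFun Γ n n η ω)
    {z : A} (hz : z ∈ loc a W) :
    ψ (z * (word Q y * word L y)) * ψ (word Q y) = ψ (z * word Q y) * ψ (word Q y * word L y) := by
  have hc := hψ.continuous
  have hc' : ∀ v : A, Continuous fun z => ψ (z * v) := fun v =>
    hc.comp (continuous_id.mul continuous_const)
  let M : Submodule ℂ A := LinearMap.eqLocus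
    ((ψ (word Q y)) • (ψ ∘ₗ LinearMap.mulRight ℂ (word Q y * word L y)))
    ((ψ (word Q y * word L y)) • (ψ ∘ₗ LinearMap.mulRight ℂ (word Q y)))
  have hM : IsClosed (M : Set A) :=
    isClosed_eq (continuous_const.mul (hc' _)) (continuous_const.mul (hc' _))
  suffices hzM : z ∈ M by
    have hzM : ψ (word Q y) * ψ (z * (word Q y * word L y)) =
      ψ (word Q y * word L y) * ψ (z * word Q y) := hzM
    rw [mul_comm, hzM, mul_comm]
  refine ha.mem_of_forall_word hΘ hD.isPartition hW M hM ?_ hz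
  intro K x hK hKW hx
  change ψ (word Q y) * ψ (word K x * (word Q y * word L y)) =
      ψ (word Q y * word L y) * ψ (word K x * word Q y)
  have hQ' : Q.Nodup := (List.nodup_append.1 hQL).1
  have hwQL : word Q y * word L y = word (Q ++ L) y := by
    rw [word, word, word, List.map_append, List.prod_append]
  have hKQL : (K ++ (Q ++ L)).Nodup := by
    refine List.nodup_append.2 ⟨hK, hQL, ?_⟩
    rintro c hc _ hc' rfl
    exact hnot c hc' (hKW c hc)
  have hKQ : (K ++ Q).Nodup := by
    rw [← List.append_assoc] at hKQL
    exact (List.nodup_append.1 hKQL).1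
  obtain ⟨s, hs1, hs2, hs3⟩ := dependsOn_list_prod (φ := φ) x fun c hc => hleft c (hKW c hc)
  obtain ⟨t, ht1, ht2, ht3⟩ := dependsOn_list_prod (φ := φ) y hright
  have key := hμ.integral_mul n η hs1 ht1 hs2 ht2 hs3 ht3
  have e1 : ψ (word Q y) = ∫ ω, cylFun Γ n n η ω ∂μ := by
    rw [hψ.eq]
    exact integral_congr_ae (Eventually.of_forall fun ω => by
      simp only [(hχ ω).2 Q y hQ' hy, hQ])
  have e2 : ψ (word Q y * word L y) = ∫ ω, cylFun Γ n n η ω *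
      (L.map fun c => cellState φ ω c (y c)).prod ∂μ := by
    rw [hψ.eq]
    exact integral_congr_ae (Eventually.of_forall fun ω => by
      simp only [(hχ ω).word_mul_word hQL hy hy, hQ])
  have e3 : ψ (word K x * word Q y) = ∫ ω, cylFun Γ n n η ω *
      (K.map fun c => cellState φ ω c (x c)).prod ∂μ := by
    rw [hψ.eq]
    exact integral_congr_ae (Eventually.of_forall fun ω => by
      simp only [(hχ ω).word_mul_word hKQ hx hy, hQ, mul_comm])
  have e4 : ψ (word K x * (word Q y * word L y)) = ∫ ω, cylFun Γ n n η ω *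
      ((K.map fun c => cellState φ ω c (x c)).prod *
        (L.map fun c => cellState φ ω c (y c)).prod) ∂μ := by
    rw [hψ.eq, hwQL]
    refine integral_congr_ae (Eventually.of_forall fun ω => ?_)
    simp only [(hχ ω).word_mul_word hKQL hx hy, List.map_append, List.prod_append, hQ]
    ring
  rw [e1, e2, e3, e4, mul_comm, key, mul_comm]

end Mixture

/-! ### Cuts of the chain that split no cell -/

section CellGeometry

variable {I : Type*} [LinearOrder I] [SuccOrder I] {Γ D : Set I}

/-- The hypothesis says that n is not the right end of a two-step block, so the cut just before n
splits no cell. -/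
theorem cell_subset_Iio {n : I} (hn : ∀ i ∈ D, Order.succ i ≠ n) {c : starts Γ D ⊕ Γ} {j : I}
    (hj : j ∈ cell Γ D c) (hjn : j < n) : cell Γ D c ⊆ Set.Iio n := by
  rcases c with k | k
  · have hk : (k : I) < n := by
      rcases hj with rfl | ⟨-, rfl⟩
      exacts [hjn, (Order.le_succ _).trans_lt hjn]
    rintro i (rfl | ⟨hkD, rfl⟩)
    exacts [hk, lt_of_le_of_ne (Order.succ_le_of_lt hk) (hn _ hkD)]
  · have hj : j = k := hj
    rintro i (rfl : i = k)
    exact hj ▸ hjn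

/-- The only cell that the cut just after n could split is a two-step block starting at n. -/
theorem cell_subset_Iic {n : I} (hn : n ∉ D) {c : starts Γ D ⊕ Γ} {j : I}
    (hj : j ∈ cell Γ D c) (hjn : j ≤ n) : cell Γ D c ⊆ Set.Iic n := by
  rcases c with k | k
  · have hk : (k : I) ≤ n := by
      rcases hj with rfl | ⟨-, rfl⟩
      exacts [hjn, (Order.le_succ _).trans hjn]
    rintro i (rfl | ⟨hkD, rfl⟩)
    · exact hk
    · exact Order.succ_le_of_lt (lt_of_le_of_ne hk fun h => hn (h ▸ hkD))
  · have hj : j = k := hj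
    rintro i (rfl : i = k)
    exact hj ▸ hjn

theorem IsTwoStepSet.exists_cell_Iio (hD : IsTwoStepSet Γ D) {n : I}
    (hn : ∀ i ∈ D, Order.succ i ≠ n) :
    ∀ j ∈ Set.Iio n, ∃ c, j ∈ cell Γ D c ∧ cell Γ D c ⊆ Set.Iio n := fun j hj =>
  let ⟨c, hc⟩ := hD.isPartition.cover j
  ⟨c, hc, cell_subset_Iio hn hc hj⟩

theorem IsTwoStepSet.exists_cell_Iic (hD : IsTwoStepSet Γ D) {n : I} (hn : n ∉ D) :
    ∀ j ∈ Set.Iic n, ∃ c, j ∈ cell Γ D c ∧ cell Γ D c ⊆ Set.Iic n := fun j hj =>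
  let ⟨c, hc⟩ := hD.isPartition.cover j
  ⟨c, hc, cell_subset_Iic hn hc hj⟩

end CellGeometry

/-! ### Replacing one letter of a word -/

section Update

variable {I A : Type*} [CStarAlgebra A] {a : I → A}

theorem update_mem {J : Type*} [DecidableEq J] {supp : J → Set I} {x : J → A}
    (hx : ∀ c, x c ∈ loc a (supp c)) {c : J} {y : A} (hy : y ∈ loc a (supp c)) (c' : J) :
    Function.update x c y c' ∈ loc a (supp c') := by
  by_cases h : c' = c
  · subst h
    rwa [Function.update_self]
  · rw [Function.update_of_ne h]
    exact hx c'

end Update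

/-! ### Spin dependence of the block at n in the cases (b) and (c) -/

section StepDependence

variable {I : Type*} [LinearOrder I] [SuccOrder I] {A : Type*} [CStarAlgebra A] {a : I → A}
  {Γ D : Set I} {φ : (j : starts Γ D) → (Γ → Fin 2) → (loc a (block D j) →ₗ[ℂ] ℂ)}

/-- Two configurations can be compared through the one that changes only the spin at n + 1: that
change has no effect, and the remaining difference is not read by f. -/
theorem dependsOn_empty_of_not_dependsOnSpin {n : I} {X : Type*} {f : (Γ → Fin 2) → X}
    (h : ∀ hn : Order.succ n ∈ Γ, ¬ DependsOnSpin f ⟨Order.succ n, hn⟩)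
    (hf : DependsOn f {i : Γ | (i : I) = Order.succ n}) : DependsOn f ∅ := by
  intro ω ω' _
  by_cases hn : Order.succ n ∈ Γ
  · have h1 : f ω = f (Function.update ω ⟨Order.succ n, hn⟩ (ω' ⟨Order.succ n, hn⟩)) := by
      by_contra hne
      exact h hn ⟨_, _, fun k hk => (Function.update_of_ne hk _ _).symm, hne⟩
    rw [h1]
    refine hf fun i hi => ?_
    obtain rfl : i = ⟨Order.succ n, hn⟩ := Subtype.ext hi
    exact Function.update_self _ _ _
  · exact hf fun i hi => absurd ((show (i : I) = Order.succ n from hi) ▸ i.2) hn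

/-- In case (c) the cell that contains n also belongs to the past: a two-step block reads no spin,
and a one-step block at n does not read the spin at n + 1. -/
theorem IsBlockFamily.dependsWithin_Iic_of_not (hΓ : ∀ n ∈ Γ, ¬ IsMax n)
    (hφ : IsBlockFamily a Γ D φ) {n : I} (hnΓ : n ∉ Γ)
    (h : ¬ (n ∈ D ∨ ∃ (hn : n ∈ starts Γ D) (h : Order.succ n ∈ Γ),
      DependsOnSpin (φ ⟨n, hn⟩) ⟨Order.succ n, h⟩)) {c : starts Γ D ⊕ Γ}
    (hc : cell Γ D c ⊆ Set.Iic n) : DependsWithin φ (Set.Iic n) c := by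
  push Not at h
  by_cases hnc : n ∈ cell Γ D c
  · rcases c with k | k
    · by_cases hk : (k : I) ∈ D
      · exact ⟨_, Set.finite_empty, by simp, dependsOn_cellState_inl fun ω ω' _ =>
          hφ.two_step k hk ω ω'⟩
      · obtain rfl : n = k := hnc.resolve_right fun h => hk h.1
        rcases hφ.dependsOn k with hd | hd | hd
        · exact ⟨_, Set.finite_empty, by simp, dependsOn_cellState_inl hd⟩
        · refine ⟨_, finite_pred_set hΓ _, fun i hi => ?_, dependsOn_cellState_inl hd⟩
          have hi : Order.succ (i : I) = k := hi
          exact (Order.le_succ (i : I)).trans hi.le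
        · exact ⟨_, Set.finite_empty, by simp, dependsOn_cellState_inl
            (dependsOn_empty_of_not_dependsOnSpin (fun hn => h.2 k.2 hn) hd)⟩
    · exact absurd ((show n = k from hnc) ▸ k.2) hnΓ
  · exact hφ.dependsWithin_Iic hΓ fun i hi => lt_of_le_of_ne (hc hi) fun h => hnc (h ▸ hi)

/-- Real dependence on the spin at n + 1 excludes the alternative that the block reads the spin at n
- 1, so its state belongs to the future of n. -/
theorem IsBlockFamily.dependsWithin_of_dependsOnSpin (hφ : IsBlockFamily a Γ D φ) {n : I}
    (hmax : ¬ IsMax n) {hn : n ∈ starts Γ D} {hs : Order.succ n ∈ Γ}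
    (h : DependsOnSpin (φ ⟨n, hn⟩) ⟨Order.succ n, hs⟩) :
    DependsWithin φ (Set.Ici n) (Sum.inl ⟨n, hn⟩) := by
  rcases hφ.dependsOn ⟨n, hn⟩ with hd | hd | hd
  · exact ⟨_, Set.finite_empty, by simp, dependsOn_cellState_inl hd⟩
  · obtain ⟨ω, ω', h1, h2⟩ := h
    refine absurd (hd fun i hi => h1 i ?_) h2
    rintro rfl
    have hi : Order.succ (Order.succ n) = n := hi
    exact absurd (Order.lt_succ_of_not_isMax hmax) (not_lt.2 ((Order.le_succ _).trans hi.le))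
  · refine ⟨_, finite_succ_set _, fun i hi => ?_, dependsOn_cellState_inl hd⟩
    have hi : (i : I) = Order.succ n := hi
    exact (Order.le_succ n).trans hi.ge

end StepDependence

/-! ### Factorization of the mixed state at a cut or through a projection -/

section Factorization

variable {I : Type*} [LinearOrder I] [SuccOrder I] [LocallyFiniteOrder I] [PredOrder I]
  {A : Type*} [CStarAlgebra A] [Nontrivial A] {a : I → A}
  {Γ D : Set I} {φ : (j : starts Γ D) → (Γ → Fin 2) → (loc a (block D j) →ₗ[ℂ] ℂ)}
  {μ : Measure (Γ → Fin 2)} [IsProbabilityMeasure μ] {π : I → Fin 2 → ℝ}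
  {p : I → Fin 2 → Fin 2 → ℝ} {χ : (Γ → Fin 2) → A →ₗ[ℂ] ℂ} {ψ : A →ₗ[ℂ] ℂ}
  {Θ : A ≃⋆ₐ[ℂ] A}

omit [Nontrivial A] in
/-- Across a site outside `Γ` the mixture factorizes. -/
theorem IsMixture.factor (ha : IsCAR a) (hΘ : IsParity a Θ) (hD : IsTwoStepSet Γ D)
    (hμ : IsMarkovMeasure Γ π p μ) (hχ : ∀ ω, IsCellProduct a φ ω (χ ω)) (hψ : IsMixture μ χ ψ)
    {n : I} (hn : n ∉ Γ) {W : Set I} (hW : ∀ j ∈ W, ∃ c, j ∈ cell Γ D c ∧ cell Γ D c ⊆ W)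
    (hleft : ∀ c, cell Γ D c ⊆ W → DependsWithin φ (Set.Iic n) c)
    {L : List (starts Γ D ⊕ Γ)} (hL : L.Nodup) (hnot : ∀ c ∈ L, ¬ cell Γ D c ⊆ W)
    (hright : ∀ c ∈ L, DependsWithin φ (Set.Ici n) c)
    {y : starts Γ D ⊕ Γ → A} (hy : ∀ c, y c ∈ loc a (cell Γ D c)) {z : A} (hz : z ∈ loc a W) :
    ψ (z * word L y) = ψ z * ψ (word L y) := by
  -- For n ∉ Γ the cylinder at n imposes no condition, its indicator is 1, and the empty word can
  -- serve as Q; the pattern 0 is arbitrary.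
  have := hψ.markov ha hΘ hD hμ hχ n 0 hW hleft (Q := []) (L := L) (by simpa using hL)
    (by simpa using hnot) hright hy (fun ω => by
      rw [cylFun_apply, if_pos]
      · simp
      · intro j hj
        exact absurd ((le_antisymm hj.2 hj.1 : (j : I) = n) ▸ j.2) hn) hz
  simpa [word, hψ.isState.1] using this

-- Inserting the projection amounts to conditioning on the spin at n; this is how the classical
-- Markov property reaches the algebra.
omit [PredOrder I] [LocallyFiniteOrder I] [IsProbabilityMeasure μ] in
theorem cellState_proj (ha : IsCAR a) (hΘ : IsParity a Θ) {n : I} (hn : n ∈ Γ) (i : Fin 2)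
    (ω : Γ → Fin 2) : cellState φ ω (Sum.inr ⟨n, hn⟩) (proj a n i) =
      cylFun Γ n n (fun _ => i) ω := by
  have h := ha.siteState_proj_mul hΘ n (ω ⟨n, hn⟩) i (one_mem (loc a {n}))
  rw [mul_one, (ha.siteState_isEvenStateOn hΘ n _).map_one, mul_one] at h
  rw [show cellState φ ω (Sum.inr ⟨n, hn⟩) (proj a n i) = _ from h, cylFun_apply]
  refine if_congr ⟨fun h j hj => ?_, fun h => h _ ⟨le_rfl, le_rfl⟩⟩ rfl rfl
  obtain rfl : j = ⟨n, hn⟩ := Subtype.ext (le_antisymm hj.2 hj.1)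
  exact h

-- In the one-site window [n, n] no transition occurs and the Markov weight is π. With π > 0 the
-- denominators of case (a) do not vanish.
omit [IsProbabilityMeasure μ] in
theorem IsMixture.apply_proj (ha : IsCAR a) (hΘ : IsParity a Θ)
    (hμ : IsMarkovMeasure Γ π p μ) (hχ : ∀ ω, IsCellProduct a φ ω (χ ω)) (hψ : IsMixture μ χ ψ)
    {n : I} (hn : n ∈ Γ) (i : Fin 2) : ψ (proj a n i) = π n i := by
  have h : ∀ ω, χ ω (proj a n i) = cylFun Γ n n (fun _ => i) ω := fun ω => by
    have := (hχ ω).2 [Sum.inr ⟨n, hn⟩] (Function.update 1 (Sum.inr ⟨n, hn⟩) (proj a n i))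
      (by simp) (update_mem (supp := cell Γ D) (fun _ => one_mem _)
        (proj_mem_loc a (Set.mem_singleton n) i))
    simpa [word, cellState_proj ha hΘ hn] using this
  rw [hψ.eq]
  simp only [h]
  rw [integral_cylFun, cylinder, hμ n n fun _ => i]
  rw [Finset.Icc_self, Finset.filter_singleton, if_pos hn]
  simp

/-- The Markov property at a site of `Γ`. -/
theorem IsMixture.mul_proj_mul (ha : IsCAR a) (hΘ : IsParity a Θ) (hΓ : ∀ n ∈ Γ, ¬ IsMax n)
    (hD : IsTwoStepSet Γ D) (hφ : IsBlockFamily a Γ D φ)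
    (hμ : IsMarkovMeasure Γ π p μ) (hχ : ∀ ω, IsCellProduct a φ ω (χ ω)) (hψ : IsMixture μ χ ψ)
    {n : I} (hn : n ∈ Γ) (i : Fin 2) {x y : A} (hx : x ∈ loc a (Set.Iio n))
    (hy : y ∈ loc a {Order.succ n}) :
    ψ (x * (proj a n i * y)) * ψ (proj a n i) = ψ (x * proj a n i) * ψ (proj a n i * y) := by
  obtain ⟨c, hc, hcn, hdep⟩ := hφ.exists_cell_succ hΓ hD (hΓ n hn) fun h => (hD n h).2.1 hn
  have hne : (Sum.inr ⟨n, hn⟩ : starts Γ D ⊕ Γ) ≠ c := by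
    rintro rfl
    exact hcn fun j (hj : j = n) => hj.le
  have hnot : ∀ c' : starts Γ D ⊕ Γ, c' = Sum.inr ⟨n, hn⟩ ∨ c' = c →
      ¬ cell Γ D c' ⊆ Set.Iio n := by
    rintro c' (rfl | rfl) h
    · exact lt_irrefl n (h rfl)
    · exact hcn fun j hj => (h hj).le
  have := hψ.markov ha hΘ hD hμ hχ n (fun _ => i)
    (hD.exists_cell_Iio fun j hj h => (hD j hj).2.2.1 (h ▸ hn))
    (fun c hc => hφ.dependsWithin_Iic hΓ hc) (Q := [Sum.inr ⟨n, hn⟩]) (L := [c])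
    (by simpa using hne) (by simpa using hnot) (by simpa using hdep)
    (y := Function.update (Function.update 1 c y) (Sum.inr ⟨n, hn⟩) (proj a n i))
    (update_mem (supp := cell Γ D) (update_mem (fun _ => one_mem _) (loc_mono (by simpa using hc) hy))
      (proj_mem_loc a (Set.mem_singleton n) i))
    (fun ω => by simp [cellState_proj ha hΘ hn]) hx
  simpa [word, Function.update_of_ne hne.symm] using this

-- Pinching replaces the letter at n by ∑ Tr(x P_i) P_i, and the pure state of ω_n picks out the
-- term i = ω_n, its own value at x.
omit [PredOrder I] [LocallyFiniteOrder I] [IsProbabilityMeasure μ] in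
theorem IsCellProduct.apply_pinch (ha : IsCAR a) (hΘ : IsParity a Θ)
    (hD : IsTwoStepSet Γ D) {ω : Γ → Fin 2} {χ : A →ₗ[ℂ] ℂ} (hχ : IsCellProduct a φ ω χ)
    {n : I} (hn : n ∈ Γ) (x : A) : χ (pinch a n x) = χ x := by
  have hc : Continuous χ := AddMonoidHomClass.continuous_of_bound χ 1 fun x => by
    simpa using hχ.1.norm_apply_le x
  refine ha.ext_words hΘ hD (S := χ ∘ₗ (pinch a n : A →ₗ[ℂ] A)) (T := χ)
    (hc.comp (pinch a n).continuous) hc ?_ x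
  intro L x hL hx
  change χ (pinch a n (word L x)) = χ (word L x)
  have hloc : IsLocalMap a (cell Γ D (Sum.inr ⟨n, hn⟩)) (pinch a n) := ha.isLocalMap_pinch hΘ n
  have hx' : x (Sum.inr ⟨n, hn⟩) ∈ loc a {n} := hx (Sum.inr ⟨n, hn⟩)
  rw [IsLocalMap.apply_word hD.isPartition.disjoint (c := Sum.inr ⟨n, hn⟩) hloc hL hx,
    hχ.2 L _ hL (update_mem (supp := cell Γ D) hx (hloc.mem _ hx')), hχ.2 L x hL hx]
  refine congrArg List.prod (List.map_congr_left fun c _ => ?_)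
  by_cases h : c = Sum.inr ⟨n, hn⟩
  · subst h
    rw [Function.update_self, ha.pinch_eq hΘ n hx']
    simp only [map_sum, map_smul, cellState_proj ha hΘ hn, smul_eq_mul]
    rw [Finset.sum_eq_single (ω ⟨n, hn⟩)]
    · rw [cylFun_apply, if_pos, mul_one]
      · rfl
      · intro j hj
        obtain rfl : j = ⟨n, hn⟩ := Subtype.ext (le_antisymm hj.2 hj.1)
        rfl
    · intro i _ hi
      rw [cylFun_apply, if_neg, mul_zero]
      exact fun h => hi (h ⟨n, hn⟩ ⟨le_rfl, le_rfl⟩).symm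
    · simp
  · rw [Function.update_of_ne h]

end Factorization

/-! ### Inclusions between regions and complements of sites -/

section Sites

variable {I : Type*} [LinearOrder I]

theorem Iio_subset_compl_singleton (n : I) : Set.Iio n ⊆ ({n} : Set I)ᶜ :=
  fun _ hj h => hj.ne h

theorem Iic_subset_compl_singleton {n m : I} (h : n < m) : Set.Iic n ⊆ ({m} : Set I)ᶜ :=
  fun _ hj h' => (hj.trans_lt h).ne h'

omit [LinearOrder I] in
theorem singleton_subset_compl {n m : I} (h : n ≠ m) : ({n} : Set I) ⊆ ({m} : Set I)ᶜ :=
  fun _ hj h' => h (hj.symm.trans h')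

end Sites

/-! ### Two constructions of step expectations -/

section Step

theorem mem_centralizer_proj {I A : Type*} [CStarAlgebra A] {a : I → A} {n : I} {z : A} :
    z ∈ StarSubalgebra.centralizer ℂ (Set.range (proj a n)) ↔
      ∀ i, proj a n i * z = z * proj a n i := by
  rw [StarSubalgebra.mem_centralizer_iff, Set.forall_mem_range]
  simp only [star_proj, and_self]

variable {I : Type*} [LinearOrder I] [SuccOrder I] {A : Type*} [CStarAlgebra A] {a : I → A}
  {Θ : A ≃⋆ₐ[ℂ] A} {n : I}

/-- The elements over `{j ≤ n + 1}` are finite sums of products. -/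
theorem IsCAR.exists_sum_mul (ha : IsCAR a) (hΘ : IsParity a Θ) {z : A}
    (hz : z ∈ loc a (Set.Iic (Order.succ n))) :
    ∃ (ι : Type) (_ : Fintype ι) (x xn y : ι → A), (∀ k, x k ∈ loc a (Set.Iio n)) ∧
      (∀ k, xn k ∈ loc a {n}) ∧ (∀ k, y k ∈ loc a {Order.succ n}) ∧
      z = ∑ k, x k * xn k * y k := by
  let F := siteFrame ha hΘ (Order.succ n)
  let G := siteFrame ha hΘ n
  let := F.fin
  let := G.fin
  refine ⟨F.ι × G.ι, inferInstance, fun k => G.coeff k.2 (F.coeff k.1 z), fun k => G.e k.2,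
    fun k => F.e k.1, fun k => ?_, fun k => G.e_mem _, fun k => F.e_mem _, ?_⟩
  · refine loc_mono ?_ (G.coeff_mem _ _ (F.coeff_mem _ _ hz k.1) k.2)
    rintro i ⟨⟨hi, hi'⟩, hi''⟩
    exact lt_of_le_of_ne (Order.le_of_lt_succ (lt_of_le_of_ne hi hi')) hi''
  · rw [Fintype.sum_prod_type]
    conv_lhs => rw [← F.sum_coeff z]
    refine Finset.sum_congr rfl fun k _ => ?_
    change _ = ∑ l, G.coeff l (F.coeff k z) * G.e l * F.e k
    rw [← Finset.sum_mul, G.sum_coeff]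

/-- `T` is the extension to the whole algebra of an even quasi-conditional expectation at `n`
that is also a conditional expectation. -/
structure IsStep (a : I → A) (Θ : A ≃⋆ₐ[ℂ] A) (n : I) (T : A →L[ℂ] A) : Prop where
  cp : IsCP T
  map_one : T 1 = 1
  mem : ∀ z ∈ loc a (Set.Iic (Order.succ n)), T z ∈ loc a (Set.Iic n)
  mul_left : ∀ c ∈ loc a (Set.Iio n), ∀ z, T (c * z) = c * T z
  parity : ∀ z, T (Θ z) = Θ (T z)
  mem_site : ∀ z ∈ loc a {n, Order.succ n}, T z ∈ loc a {n}
  range : ∃ R : StarSubalgebra ℂ A, IsClosed (R : Set A) ∧ R ≤ loc a (Set.Iic n) ∧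
    (∀ z ∈ loc a (Set.Iic (Order.succ n)), T z ∈ R) ∧ ∀ z ∈ R, T z = z

/-- As n + 1 ∈ b, slicing ends in 𝔄_{n]}; as b ⊆ {n, n+1}, everything before n passes through. The
range is the algebra over the sites up to n + 1 outside b, where slicing is the identity. -/
theorem IsSlice.isStep {b : Set I} {f : A →ₗ[ℂ] ℂ} {Φ : A →L[ℂ] A} (h : IsSlice a Θ b f Φ)
    (hs : Order.succ n ∈ b) (hb : b ⊆ {n, Order.succ n}) (hn : ¬ IsMax n) : IsStep a Θ n Φ := by
  have h1 : Set.Iic (Order.succ n) \ b ⊆ Set.Iic n := fun i hi =>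
    Order.le_of_lt_succ (lt_of_le_of_ne hi.1 fun h => hi.2 (h ▸ hs))
  have h2 : Set.Iio n ⊆ bᶜ := by
    intro i hi hib
    rcases hb hib with rfl | rfl
    exacts [lt_irrefl _ hi, absurd (Order.le_succ n) (not_le.2 hi)]
  refine ⟨h.cp, h.map_one, fun z hz => loc_mono h1 (h.mem _ z hz), fun c hc z =>
    h.mul_left c (loc_mono h2 hc) z, h.parity, fun z hz => loc_mono ?_ (h.mem _ z hz),
    loc a (Set.Iic (Order.succ n) \ b), isClosed_loc _ _, loc_mono h1, fun z hz => h.mem _ z hz,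
    fun z hz => h.apply_of_mem_compl (loc_mono (fun i hi => hi.2) hz)⟩
  rintro i ⟨rfl | rfl, hi⟩
  exacts [rfl, absurd hs hi]

/-- The map that pinches at the site `n` and slices at the next site, with a state that depends
on the projection at `n`. -/
theorem IsCAR.isStep_pinch (ha : IsCAR a) (hΘ : IsParity a Θ) {f : Fin 2 → A →ₗ[ℂ] ℂ}
    {Φ : Fin 2 → A →L[ℂ] A} (h : ∀ i, IsSlice a Θ {Order.succ n} (f i) (Φ i)) (hn : ¬ IsMax n) :
    IsStep a Θ n (sandwich (proj a n 0) (proj a n 0) * Φ 0 +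
      sandwich (proj a n 1) (proj a n 1) * Φ 1) := by
  set T := sandwich (proj a n 0) (proj a n 0) * Φ 0 + sandwich (proj a n 1) (proj a n 1) * Φ 1
    with hT
  have hTz : ∀ z, T z = ∑ i, proj a n i * (Φ i z * proj a n i) := fun z => by
    rw [Fin.sum_univ_two]
    rfl
  have hs : ∀ i, IsStep a Θ n (Φ i) := fun i => (h i).isStep rfl (by simp) hn
  have hlt := Order.lt_succ_of_not_isMax hn
  have hcomp : Set.Iic n ⊆ ({Order.succ n} : Set I)ᶜ :=
    Iic_subset_compl_singleton hlt
  have hfix : ∀ i, ∀ z ∈ loc a (Set.Iic n), Φ i z = z := fun i z hz =>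
    (h i).apply_of_mem_compl (loc_mono hcomp hz)
  have hmem : ∀ z ∈ loc a (Set.Iic (Order.succ n)), T z ∈ loc a (Set.Iic n) := fun z hz => by
    rw [hTz]
    have hp := fun i => proj_mem_loc a (Set.mem_Iic.2 (le_refl n)) i
    exact sum_mem fun i _ => mul_mem (hp i) (mul_mem ((hs i).mem z hz) (hp i))
  have hone : ∀ z ∈ loc a (Set.Iic n), (∀ i, proj a n i * z = z * proj a n i) → T z = z := by
    intro z hz hc
    rw [hTz]
    simp only [hfix _ z hz, ← hc, ← mul_assoc, ha.proj_mul_self]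
    rw [← Finset.sum_mul, ha.sum_proj, one_mul]
  -- The range is the part of 𝔄_{n]} that commutes with the projections at n: each sum of
  -- compressions commutes with them, and an element commuting with them is recovered as ∑ P_i z
  -- P_i.
  refine ⟨?_, hone 1 (one_mem _) (by simp), hmem, fun c hc z => ?_, fun z => ?_, fun z hz => ?_,
    loc a (Set.Iic n) ⊓ StarSubalgebra.centralizer ℂ (Set.range (proj a n)), ?_, inf_le_left,
    fun z hz => ⟨hmem z hz, ?_⟩, fun z hz => hone z hz.1 fun i => ?_⟩
  · have h0 := (h 0).cp.conj (proj a n 0)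
    have h1 := (h 1).cp.conj (proj a n 1)
    rw [star_proj] at h0 h1
    exact h0.add h1
  · rw [hTz, hTz, Finset.mul_sum]
    refine Finset.sum_congr rfl fun i _ => ?_
    have hc' : proj a n i * c = c * proj a n i :=
      ha.proj_commute hΘ n i (loc_mono (Iio_subset_compl_singleton n) hc)
    rw [(hs i).mul_left c hc, ← mul_assoc c, ← hc']
    simp only [mul_assoc]
  · simp only [hTz, map_sum, map_mul, hΘ.proj, (h _).parity]
  · rw [hTz]
    have hp := fun i => proj_mem_loc a (Set.mem_singleton n) i
    exact sum_mem fun i _ => mul_mem (hp i) (mul_mem ((hs i).mem_site z hz) (hp i))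
  · have : ((loc a (Set.Iic n) ⊓ StarSubalgebra.centralizer ℂ (Set.range (proj a n)) :
        StarSubalgebra ℂ A) : Set A) =
        (loc a (Set.Iic n) : Set A) ∩ ⋂ i, {z | proj a n i * z = z * proj a n i} := by
      ext z
      refine and_congr Iff.rfl (mem_centralizer_proj.trans ?_)
      simp only [Set.mem_iInter]
      rfl
    rw [this]
    exact (isClosed_loc _ _).inter (isClosed_iInter fun i =>
      isClosed_eq (continuous_const.mul continuous_id) (continuous_id.mul continuous_const))
  · refine mem_centralizer_proj.2 fun k => ?_
    rw [hTz, Finset.mul_sum, Finset.sum_mul]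
    refine Finset.sum_congr rfl fun i _ => ?_
    by_cases hik : k = i
    · subst hik
      rw [← mul_assoc, ha.proj_mul_self, mul_assoc, mul_assoc, ha.proj_mul_self]
    · rw [← mul_assoc, ha.proj_mul_of_ne n hik, zero_mul, mul_assoc, mul_assoc,
        ha.proj_mul_of_ne n (Ne.symm hik), mul_zero, mul_zero]
  · exact mem_centralizer_proj.1 hz.2 i

end Step

/-! ### Existence and invariance of the step expectation in each case -/

section Exists

variable {I : Type*} [LinearOrder I] [SuccOrder I] [LocallyFiniteOrder I] [PredOrder I]
  {A : Type*} [CStarAlgebra A] [Nontrivial A] {a : I → A}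
  {Γ D : Set I} {φ : (j : starts Γ D) → (Γ → Fin 2) → (loc a (block D j) →ₗ[ℂ] ℂ)}
  {μ : Measure (Γ → Fin 2)} [IsProbabilityMeasure μ] {π : I → Fin 2 → ℝ}
  {p : I → Fin 2 → Fin 2 → ℝ} {χ : (Γ → Fin 2) → A →ₗ[ℂ] ℂ} {ψ : A →ₗ[ℂ] ℂ}
  {Θ : A ≃⋆ₐ[ℂ] A}

/-- The prescribed value of the step expectation on `x x_n y`. -/
noncomputable def stepValue (a : I → A) (Γ D : Set I)
    (φ : (j : starts Γ D) → (Γ → Fin 2) → (loc a (block D j) →ₗ[ℂ] ℂ)) (ψ : A →ₗ[ℂ] ℂ) (n : I)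
    (x : A) (xn : loc a {n}) (y : A) : A :=
  if n ∈ Γ then
    x * ∑ i : Fin 2, (siteTrace a n (xn * siteProj a n i) *
      (ψ (proj a n i * y) / ψ (proj a n i))) • proj a n i
  else if n ∈ D ∨ ∃ (hn : n ∈ starts Γ D) (h : Order.succ n ∈ Γ),
      DependsOnSpin (φ ⟨n, hn⟩) ⟨Order.succ n, h⟩ then
    ψ ((xn : A) * y) • x
  else
    ψ y • (x * (xn : A))

/-- Case (a). The pinching at n costs nothing under ψ, and the compressions of x_n are scalar
multiples of P_i. Invariance is then the identity ψ(x P_i y) ψ(P_i) = ψ(x P_i) ψ(P_i y). -/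
theorem IsMixture.exists_step_of_mem (ha : IsCAR a) (hΘ : IsParity a Θ)
    (hΓ : ∀ n ∈ Γ, ¬ IsMax n) (hD : IsTwoStepSet Γ D) (hφ : IsBlockFamily a Γ D φ)
    (hπ : ∀ n ∈ Γ, ∀ i, 0 < π n i) (hμ : IsMarkovMeasure Γ π p μ)
    (hχ : ∀ ω, IsCellProduct a φ ω (χ ω)) (hψ : IsMixture μ χ ψ) {n : I} (hn : n ∈ Γ) :
    ∃ T, IsStep a Θ n T ∧ ∀ x ∈ loc a (Set.Iio n), ∀ xn : loc a {n}, ∀ y ∈ loc a {Order.succ n},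
      T (x * xn * y) = stepValue a Γ D φ ψ n x xn y ∧ ψ (T (x * xn * y)) = ψ (x * xn * y) := by
  have hlt := Order.lt_succ_of_not_isMax (hΓ n hn)
  have hP : ∀ i, 0 < ψ (proj a n i) := fun i => by
    rw [hψ.apply_proj ha hΘ hμ hχ hn]
    exact_mod_cast hπ n hn i
  have hcs : ∀ i, ∀ y ∈ loc a {Order.succ n}, proj a n i * y = y * proj a n i := fun i y hy =>
    ha.proj_commute hΘ n i (loc_mono (singleton_subset_compl hlt.ne') hy)
  have hcl : ∀ i, ∀ x ∈ loc a (Set.Iio n), proj a n i * x = x * proj a n i := fun i x hx =>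
    ha.proj_commute hΘ n i (loc_mono (Iio_subset_compl_singleton n) hx)
  -- The state ψ conditioned on P_i. It is required to be a state only on the site n + 1, where P_i
  -- commutes with everything.
  let f : Fin 2 → A →ₗ[ℂ] ℂ := fun i =>
    (ψ (proj a n i))⁻¹ • (ψ ∘ₗ LinearMap.mulLeft ℂ (proj a n i))
  have hfy : ∀ i y, f i y = ψ (proj a n i * y) / ψ (proj a n i) := fun i y => by
    change (ψ (proj a n i))⁻¹ * ψ (proj a n i * y) = _
    rw [div_eq_inv_mul]
  have hf : ∀ i, IsEvenStateOn a Θ {Order.succ n} (f i) := fun i => by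
    refine ⟨?_, fun x hx => ?_, fun x hx => ?_⟩
    · rw [hfy, mul_one, div_self (hP i).ne']
    · rw [hfy, div_eq_inv_mul]
      refine mul_nonneg (inv_nonneg.2 (hP i).le) ?_
      -- Since P_i commutes with x⁺x, the product is the square of x P_i, which gives positivity.
      have : proj a n i * (star x * x) = star (x * proj a n i) * (x * proj a n i) := by
        rw [star_mul, star_proj, mul_assoc, ← mul_assoc (star x), hcs i _ (mul_mem (star_mem hx) hx),
          ← hcs i _ (mul_mem (star_mem hx) hx), ← mul_assoc (proj a n i) (proj a n i),
          ha.proj_mul_self]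
      rw [this]
      exact hψ.isState.2 _
    · rw [hfy, hfy, ← hψ.parity ha hΘ hD hφ hχ (proj a n i * x), map_mul Θ, hΘ.proj]
  choose Φ hΦ using fun i => ha.exists_slice hΘ (Set.finite_singleton _) (hf i)
  refine ⟨_, ha.isStep_pinch hΘ hΦ (hΓ n hn), fun x hx xn y hy => ?_⟩
  set T := sandwich (proj a n 0) (proj a n 0) * Φ 0 + sandwich (proj a n 1) (proj a n 1) * Φ 1
  have hpin : ∀ w : A, ∑ i, proj a n i * (w * proj a n i) = pinch a n w := fun w => by
    rw [Fin.sum_univ_two]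
    rfl
  have hsand : ∀ i, proj a n i * (x * xn * proj a n i) =
      siteTrace a n (xn * siteProj a n i) • (x * proj a n i) := fun i => by
    rw [mul_assoc x, ← mul_assoc, hcl i x hx, mul_assoc x, ← mul_assoc (proj a n i),
      ha.proj_mul_mul_proj hΘ, mul_smul_comm]
  have hval : T (x * xn * y) = ∑ i, (siteTrace a n (xn * siteProj a n i) *
      (ψ (proj a n i * y) / ψ (proj a n i))) • (x * proj a n i) := by
    have : T (x * xn * y) = ∑ i, proj a n i * (Φ i (x * xn * y) * proj a n i) := by
      rw [Fin.sum_univ_two]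
      rfl
    rw [this]
    refine Finset.sum_congr rfl fun i _ => ?_
    have hxx : x * xn ∈ loc a ({Order.succ n} : Set I)ᶜ :=
      mul_mem (loc_mono (Set.Iio_subset_Iic_self.trans (Iic_subset_compl_singleton hlt)) hx)
        (loc_mono (singleton_subset_compl hlt.ne) xn.2)
    rw [(hΦ i).mul_left _ hxx, (hΦ i).apply_of_mem y hy, mul_smul_comm, mul_one, hfy,
      smul_mul_assoc, mul_smul_comm, hsand, smul_smul, mul_comm]
  refine ⟨?_, ?_⟩
  · rw [hval, stepValue, if_pos hn, Finset.mul_sum]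
    simp only [mul_smul_comm]
  · rw [hval, map_sum]
    have hpψ : ∀ w, ψ (pinch a n w) = ψ w := fun w => by
      simp only [hψ.eq, fun ω => (hχ ω).apply_pinch ha hΘ hD hn w]
    rw [← hpψ (x * xn * y), ← hpin, map_sum]
    refine Finset.sum_congr rfl fun i _ => ?_
    rw [mul_assoc (x * (xn : A)), ← hcs i y hy, ← mul_assoc (x * (xn : A)), ← mul_assoc, hsand,
      smul_mul_assoc, map_smul, map_smul, smul_eq_mul, smul_eq_mul, mul_assoc x, mul_assoc]
    congr 1
    have := hψ.mul_proj_mul ha hΘ hΓ hD hφ hμ hχ hn i hx hy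
    rw [div_mul_eq_mul_div, div_eq_iff (hP i).ne', this, mul_comm]

/-- The step expectation at a site outside `Γ` that is not coupled to the next one. -/
theorem IsMixture.exists_step_single (ha : IsCAR a) (hΘ : IsParity a Θ)
    (hΓ : ∀ n ∈ Γ, ¬ IsMax n) (hD : IsTwoStepSet Γ D) (hφ : IsBlockFamily a Γ D φ)
    (hμ : IsMarkovMeasure Γ π p μ)
    (hχ : ∀ ω, IsCellProduct a φ ω (χ ω)) (hψ : IsMixture μ χ ψ) {n : I} (hmax : ¬ IsMax n)
    (hn : n ∉ Γ) (h : ¬ (n ∈ D ∨ ∃ (hn : n ∈ starts Γ D) (h : Order.succ n ∈ Γ),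
      DependsOnSpin (φ ⟨n, hn⟩) ⟨Order.succ n, h⟩)) :
    ∃ T, IsStep a Θ n T ∧ ∀ x ∈ loc a (Set.Iio n), ∀ xn : loc a {n}, ∀ y ∈ loc a {Order.succ n},
      T (x * xn * y) = stepValue a Γ D φ ψ n x xn y ∧ ψ (T (x * xn * y)) = ψ (x * xn * y) := by
  have hlt := Order.lt_succ_of_not_isMax hmax
  have hnD : n ∉ D := fun hD => h (Or.inl hD)
  obtain ⟨Φ, hΦ⟩ := ha.exists_slice hΘ (Set.finite_singleton (Order.succ n))
    (hψ.isEvenStateOn ha hΘ hD hφ hχ _)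
  refine ⟨Φ, hΦ.isStep rfl (by simp) hmax, fun x hx xn y hy => ?_⟩
  have hxx : x * xn ∈ loc a (Set.Iic n) :=
    mul_mem (loc_mono Set.Iio_subset_Iic_self hx) (loc_mono (by simp) xn.2)
  have hval : Φ (x * xn * y) = ψ y • (x * xn) := by
    rw [hΦ.mul_left _ (loc_mono (Iic_subset_compl_singleton hlt) hxx),
      hΦ.apply_of_mem y hy, mul_smul_comm, mul_one]
  refine ⟨by rw [hval, stepValue, if_neg hn, if_neg h], ?_⟩
  obtain ⟨c, hc, hcn, hdep⟩ := hφ.exists_cell_succ hΓ hD hmax hnD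
  have := hψ.factor ha hΘ hD hμ hχ hn (hD.exists_cell_Iic hnD)
    (fun c hc => hφ.dependsWithin_Iic_of_not hΓ hn h hc) (L := [c]) (by simp) (by simpa using hcn)
    (by simpa using hdep) (y := Function.update 1 c y)
    (update_mem (supp := cell Γ D) (fun _ => one_mem _) (loc_mono (by simpa using hc) hy)) hxx
  simp only [word, List.map_cons, List.map_nil, List.prod_singleton, Function.update_self] at this
  rw [hval, this, map_smul, smul_eq_mul, mul_comm]

/-- The step expectation at a site outside `Γ` that is coupled to the next one. -/
theorem IsMixture.exists_step_double (ha : IsCAR a) (hΘ : IsParity a Θ)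
    (hΓ : ∀ n ∈ Γ, ¬ IsMax n) (hD : IsTwoStepSet Γ D) (hφ : IsBlockFamily a Γ D φ)
    (hμ : IsMarkovMeasure Γ π p μ)
    (hχ : ∀ ω, IsCellProduct a φ ω (χ ω)) (hψ : IsMixture μ χ ψ) {n : I} (hmax : ¬ IsMax n)
    (hn : n ∉ Γ) (h : n ∈ D ∨ ∃ (hn : n ∈ starts Γ D) (h : Order.succ n ∈ Γ),
      DependsOnSpin (φ ⟨n, hn⟩) ⟨Order.succ n, h⟩) :
    ∃ T, IsStep a Θ n T ∧ ∀ x ∈ loc a (Set.Iio n), ∀ xn : loc a {n}, ∀ y ∈ loc a {Order.succ n},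
      T (x * xn * y) = stepValue a Γ D φ ψ n x xn y ∧ ψ (T (x * xn * y)) = ψ (x * xn * y) := by
  have hlt := Order.lt_succ_of_not_isMax hmax
  obtain ⟨Φ, hΦ⟩ := ha.exists_slice hΘ (Set.toFinite {n, Order.succ n})
    (hψ.isEvenStateOn ha hΘ hD hφ hχ _)
  refine ⟨Φ, hΦ.isStep (by simp) subset_rfl hmax, fun x hx xn y hy => ?_⟩
  have hxy : (xn : A) * y ∈ loc a {n, Order.succ n} :=
    mul_mem (loc_mono (by simp) xn.2) (loc_mono (by simp) hy)
  have hval : Φ (x * xn * y) = ψ (xn * y) • x := by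
    rw [mul_assoc, hΦ.mul_left _ (loc_mono ?_ hx), hΦ.apply_of_mem _ hxy, mul_smul_comm, mul_one]
    rintro j hj (rfl | rfl)
    exacts [lt_irrefl _ hj, lt_asymm hlt hj]
  refine ⟨by rw [hval, stepValue, if_neg hn, if_pos h], ?_⟩
  have hst : n ∈ starts Γ D := h.elim (fun h => hD.mem_starts h) (fun h => h.1)
  have hni : ∀ c : starts Γ D ⊕ Γ, n ∈ cell Γ D c ∨ Order.succ n ∈ cell Γ D c →
      ¬ cell Γ D c ⊆ Set.Iio n := by
    rintro c (hc | hc) hs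
    exacts [lt_irrefl _ (hs hc), lt_asymm hlt (hs hc)]
  have key : ψ (x * (xn * y)) = ψ x * ψ (xn * y) := by
    have hfac := fun L h1 h2 h3 (y : starts Γ D ⊕ Γ → A) (hy : ∀ c, y c ∈ loc a (cell Γ D c)) =>
      hψ.factor ha hΘ hD hμ hχ hn (hD.exists_cell_Iio hst.2)
        (fun c hc => hφ.dependsWithin_Iic hΓ hc) (L := L) h1 h2 h3 hy hx
    rcases h with h | ⟨_, hs, h⟩
    -- In a two-step block x_n y is a single letter, and its state reads no spin at all.
    · have := hfac [Sum.inl ⟨n, hst⟩] (by simp)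
        (by simpa using hni (Sum.inl ⟨n, hst⟩) (Or.inl (Or.inl rfl)))
        (by simpa using ⟨_, Set.finite_empty, by simp, dependsOn_cellState_inl fun ω ω' _ =>
          hφ.two_step ⟨n, hst⟩ h ω ω'⟩) (Function.update 1 (Sum.inl ⟨n, hst⟩) (xn * y))
        (update_mem (supp := cell Γ D) (fun _ => one_mem _) (loc_mono (by
          rintro i (rfl | rfl)
          exacts [Or.inl rfl, Or.inr ⟨h, rfl⟩]) hxy))
      simpa only [word, List.map_cons, List.map_nil, List.prod_singleton,
        Function.update_self] using this
    -- Here x_n and y are two letters coupled through the spin at n + 1; both belong to the future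
    -- of n, so the cut before n still factorizes.
    · have hne : (Sum.inr ⟨Order.succ n, hs⟩ : starts Γ D ⊕ Γ) ≠ Sum.inl ⟨n, hst⟩ := by simp
      have := hfac [Sum.inl ⟨n, hst⟩, Sum.inr ⟨Order.succ n, hs⟩] (by simp)
        (by
          intro c hc
          simp only [List.mem_cons, List.not_mem_nil, or_false] at hc
          rcases hc with rfl | rfl
          exacts [hni _ (Or.inl (Or.inl rfl)), hni _ (Or.inr rfl)])
        (by
          intro c hc
          simp only [List.mem_cons, List.not_mem_nil, or_false] at hc
          rcases hc with rfl | rfl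
          exacts [hφ.dependsWithin_of_dependsOnSpin hmax h,
            dependsWithin_inr _ (Order.le_succ n)])
        (Function.update (Function.update 1 (Sum.inl ⟨n, hst⟩) (xn : A))
          (Sum.inr ⟨Order.succ n, hs⟩) y)
        (update_mem (supp := cell Γ D) (update_mem (supp := cell Γ D) (fun _ => one_mem _)
          (loc_mono (by rintro i rfl; exact Or.inl rfl) xn.2)) hy)
      simpa only [word, List.map_cons, List.map_nil, List.prod_cons, List.prod_nil, mul_one,
        Function.update_self, Function.update_of_ne hne.symm] using this
  rw [hval, mul_assoc, key, map_smul, smul_eq_mul, mul_comm]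

theorem IsMixture.exists_step (ha : IsCAR a) (hΘ : IsParity a Θ)
    (hΓ : ∀ n ∈ Γ, ¬ IsMax n) (hD : IsTwoStepSet Γ D) (hφ : IsBlockFamily a Γ D φ)
    (hπ : ∀ n ∈ Γ, ∀ i, 0 < π n i) (hμ : IsMarkovMeasure Γ π p μ)
    (hχ : ∀ ω, IsCellProduct a φ ω (χ ω)) (hψ : IsMixture μ χ ψ) {n : I} (hmax : ¬ IsMax n) :
    ∃ T, IsStep a Θ n T ∧ ∀ x ∈ loc a (Set.Iio n), ∀ xn : loc a {n}, ∀ y ∈ loc a {Order.succ n},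
      T (x * xn * y) = stepValue a Γ D φ ψ n x xn y ∧ ψ (T (x * xn * y)) = ψ (x * xn * y) := by
  by_cases hn : n ∈ Γ
  · exact hψ.exists_step_of_mem ha hΘ hΓ hD hφ hπ hμ hχ hn
  · by_cases h : n ∈ D ∨ ∃ (hn : n ∈ starts Γ D) (h : Order.succ n ∈ Γ),
      DependsOnSpin (φ ⟨n, hn⟩) ⟨Order.succ n, h⟩
    · exact hψ.exists_step_double ha hΘ hΓ hD hφ hμ hχ hmax hn h
    · exact hψ.exists_step_single ha hΘ hΓ hD hφ hμ hχ hmax hn h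

end Exists

/-! ### Restriction to 𝔄_{n+1]} and uniqueness -/

section Restrict

variable {I : Type*} [LinearOrder I] [SuccOrder I] {A : Type*} [CStarAlgebra A] {a : I → A}
  {Θ : A ≃⋆ₐ[ℂ] A} {n : I}

/-- The restriction of a map to a local algebra. -/
noncomputable def restrictLoc (a : I → A) (Λ : Set I) (T : A →L[ℂ] A) : loc a Λ →ₗ[ℂ] A :=
  (T : A →ₗ[ℂ] A) ∘ₗ (loc a Λ).subtype.toAlgHom.toLinearMap

omit [LinearOrder I] [SuccOrder I] in
theorem restrictLoc_apply (Λ : Set I) (T : A →L[ℂ] A) (x : loc a Λ) :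
    restrictLoc a Λ T x = T x := rfl

/-- A linear map on the local algebra is determined by its values on products. -/
theorem IsCAR.ext_step (ha : IsCAR a) (hΘ : IsParity a Θ) {V : Type*} [AddCommGroup V] [Module ℂ V]
    {E E' : loc a (Set.Iic (Order.succ n)) →ₗ[ℂ] V}
    (h : ∀ (x : loc a (Set.Iio n)) (xn : loc a {n}) (y : loc a {Order.succ n})
      (z : loc a (Set.Iic (Order.succ n))), (z : A) = (x : A) * (xn : A) * (y : A) →
      E z = E' z) : E = E' := by
  ext ⟨z, hz⟩
  obtain ⟨ι, _, x, xn, y, hx, hxn, hy, hsum⟩ := ha.exists_sum_mul hΘ hz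
  have hmem : ∀ k, x k * xn k * y k ∈ loc a (Set.Iic (Order.succ n)) := fun k =>
    mul_mem (mul_mem (loc_mono (fun i hi => (le_of_lt hi).trans (Order.le_succ n)) (hx k))
      (loc_mono (by simpa using Order.le_succ n) (hxn k))) (loc_mono (by simp) (hy k))
  have hz' : (⟨z, hz⟩ : loc a (Set.Iic (Order.succ n))) = ∑ k, ⟨_, hmem k⟩ := by
    refine Subtype.ext ?_
    rw [AddSubmonoidClass.coe_finsetSum]
    exact hsum
  rw [hz', map_sum, map_sum]
  exact Finset.sum_congr rfl fun k _ => h ⟨_, hx k⟩ ⟨_, hxn k⟩ ⟨_, hy k⟩ _ rfl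

theorem IsStep.isCondExpOnto {T : A →L[ℂ] A} (h : IsStep a Θ n T) :
    ∃ R : StarSubalgebra ℂ A, R ≤ loc a (Set.Iic n) ∧
      IsCondExpOnto R (restrictLoc a (Set.Iic (Order.succ n)) T) := by
  obtain ⟨R, h1, h2, h3, h4⟩ := h.range
  exact ⟨R, h2, h1, h2.trans (loc_mono (Set.Iic_subset_Iic.2 (Order.le_succ n))),
    fun x => h3 x x.2, fun x hx => h4 x hx, fun x => h.cp.norm_le h.map_one x⟩

theorem IsStep.isQuasiCondExp {T : A →L[ℂ] A} (h : IsStep a Θ n T) :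
    IsQuasiCondExp (loc a (Set.Iio n)) (loc a (Set.Iic n))
      (restrictLoc a (Set.Iic (Order.succ n)) T) where
  left_le := loc_mono Set.Iio_subset_Iic_self
  right_le := loc_mono (Set.Iic_subset_Iic.2 (Order.le_succ n))
  range_le x := h.mem x x.2
  completelyPositive m x y :=
    CStarAlgebra.nonneg_iff_eq_star_mul_self.1 (h.cp m (fun i => (x i : A)) y)
  map_one := h.map_one
  map_mul c x hc := h.mul_left c hc x

end Restrict

end CAR

/-! ### Assembly of the theorem -/

theorem theorem3p2 {I : Type*} [LinearOrder I] [LocallyFiniteOrder I] [SuccOrder I] [PredOrder I]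
    {A : Type*} [CStarAlgebra A] [Nontrivial A] (a : I → A) (ha : CAR.IsCAR a)
    (Γ : Set I) (hΓ : ∀ n ∈ Γ, ¬ IsMax n)
    (π : I → Fin 2 → ℝ) (p : I → Fin 2 → Fin 2 → ℝ) (hπ : ∀ n ∈ Γ, ∀ i, 0 < π n i)
    (μ : Measure (Γ → Fin 2)) [IsProbabilityMeasure μ] (hμ : CAR.IsMarkovMeasure Γ π p μ)
    (D : Set I) (hD : CAR.IsTwoStepSet Γ D)
    (φ : (j : CAR.starts Γ D) → (Γ → Fin 2) → (CAR.loc a (CAR.block D j) →ₗ[ℂ] ℂ))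
    (hφ : CAR.IsBlockFamily a Γ D φ) :
    (∃! Θ : A ≃⋆ₐ[ℂ] A, CAR.IsParity a Θ) ∧
    Nonempty (CAR.Ingredients a Γ D φ) ∧
    ∀ S : CAR.Ingredients a Γ D φ,
      (∀ x : CAR.diagAlg a Γ, Measurable fun ω => S.prodState ω (S.ev ω x)) ∧
      ∃ ψ : A →ₗ[ℂ] ℂ,
        (∀ x, Integrable (fun ω => S.prodState ω (S.ev ω (S.diagExp x))) μ ∧
          ψ x = ∫ ω, S.prodState ω (S.ev ω (S.diagExp x)) ∂μ) ∧
        ∃ E : (n : I) → (CAR.loc a (Set.Iic (Order.succ n)) →ₗ[ℂ] A),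
          (∀ n, ¬ IsMax n →
            (CAR.IsStepMap a Γ D φ ψ n (E n) ∧
              ∀ E', CAR.IsStepMap a Γ D φ ψ n E' → E' = E n) ∧
            (∃ R : StarSubalgebra ℂ A, R ≤ CAR.loc a (Set.Iic n) ∧
              CAR.IsCondExpOnto R (E n)) ∧
            (∀ Θ : A ≃⋆ₐ[ℂ] A, CAR.IsParity a Θ →
              ∀ x y : CAR.loc a (Set.Iic (Order.succ n)), (y : A) = Θ x → E n y = Θ (E n x))) ∧
          CAR.IsMarkovStateWrt a ψ E := by
  -- Countability of the chain enters here and in all infinite products below.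
  obtain ⟨Θ, hΘ⟩ := ha.exists_parity
  refine ⟨⟨Θ, hΘ, fun Θ' h => ha.parity_unique h hΘ⟩, hφ.nonempty_ingredients ha hΘ hD,
    fun S => ?_⟩
  choose χ hχ using hφ.exists_cellProduct ha hΘ hD
  have hev : ∀ ω x, S.prodState ω (S.ev ω (S.diagExp x)) = χ ω x := fun ω x =>
    CAR.Ingredients.eval_eq ha hΘ hD S ω (hχ ω) x
  obtain ⟨ψ, hψ⟩ := CAR.IsCellProduct.exists_mixture ha hΘ hΓ hD hφ hχ μ
  simp only [hev]
  refine ⟨fun x => ?_, ψ, fun x => ⟨hψ.integrable x, hψ.eq x⟩, ?_⟩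
  -- Elements of 𝔇 are fixed by 𝓔, so measurability on 𝔇 is a case of measurability of ω ↦ χ_ω.
  · have hx : S.diagExp x = x := Subtype.ext (ha.diagExp_of_mem hΘ S.isDiagExp x.2)
    rw [← hx]
    simp only [hev]
    exact CAR.IsCellProduct.measurable ha hΘ hΓ hD hφ hχ x
  -- At a last site nothing is claimed, and T takes an arbitrary value there.
  · choose! T hT hTv using fun n (hn : ¬ IsMax n) => hψ.exists_step ha hΘ hΓ hD hφ hπ hμ hχ hn
    have hstep : ∀ n, ¬ IsMax n → CAR.IsStepMap a Γ D φ ψ n (CAR.restrictLoc a _ (T n)) := by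
      intro n hn x xn y z hz
      rw [CAR.restrictLoc_apply, hz, (hTv n hn x x.2 xn y y.2).1]
      rfl
    refine ⟨fun n => CAR.restrictLoc a _ (T n), fun n hn => ⟨⟨hstep n hn, fun E' hE' =>
      ha.ext_step hΘ fun x xn y z hz => ?_⟩, (hT n hn).isCondExpOnto, ?_⟩,
      hψ.isState, fun n hn => (hT n hn).isQuasiCondExp, fun n hn => ?_,
      fun n hn x hx => (hT n hn).mem_site x hx⟩
    · rw [hE' x xn y z hz, hstep n hn x xn y z hz]
    · intro Θ' hΘ' x y hxy
      obtain rfl := ha.parity_unique hΘ' hΘ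
      rw [CAR.restrictLoc_apply, CAR.restrictLoc_apply, hxy, (hT n hn).parity]
    -- Invariance is an equality of two linear functionals on 𝔄_{n+1]}, so products decide it.
    · refine LinearMap.congr_fun (f := ψ ∘ₗ CAR.restrictLoc a _ (T n))
        (g := ψ ∘ₗ (CAR.loc a _).subtype.toAlgHom.toLinearMap) (ha.ext_step hΘ fun x xn y z hz => ?_)
      change ψ (T n z) = ψ z
      rw [hz, (hTv n hn x x.2 xn y y.2).2]
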